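/- **Theorem.** Let $G$ be a second countable, compact (Hausdorff) abelian group, $H$ a countable, discrete abelian group, and $A$ a separable (not necessarily unital) C*-algebra. Let $\alpha:G\curvearrowright A$ be a point-norm continuous action and $\beta:H\curvearrowright A$ an action by $*$-automorphisms. Then (i) $\alpha$ has the Rokhlin property if and only if the dual action $\hat\alpha:\hat G\curvearrowright A\rtimes_\alpha G$ is approximately representable; (ii) $\beta$ is approximately representable if and only if the dual action $\hat\beta:\hat H\curvearrowright A\rtimes_\beta H$ has the Rokhlin property. Here the following notions are used. *Crossed product and dual action.* For a continuous action $\alpha$ of a locally compact abelian group $G$ with Haar measure $dt$, the (full) crossed product $A\rtimes_\alpha G$ is the enveloping C*-algebra of $L^1(G,A,\alpha)$, i.e. the completion of $C_c(G,A)$, with $(f*g)(s)=\int_G f(t)\,\alpha_t(g(t^{-1}s))\,dt$ and $f^*(s)=\alpha_s(f(s^{-1})^*)$, in the largest C*-seminorm dominated by the $L^1$-norm. The dual action of the Pontryagin dual $\hat G$ is determined by $\hat\alpha_\chi(f)(s)=\chi(s)f(s)$ for $f\in C_c(G,A)$ and $\chi\in\hat G$. The dual of a second countable compact abelian group is countable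 and discrete, and vice versa. *Rokhlin property.* For a separable C*-algebra $A$ let $A_\infty=\ell^\infty(\mathbb N,A)/c_0(\mathbb N,A)$, which contains $A$ as (classes of) constant sequences, and let $F_\infty(A)=(A_\infty\cap A')/\{x\in A_\infty : xa=ax=0\text{ for all }a\in A\}$, which is unital. A continuous action $\alpha$ of a compact group $G$ on $A$ induces, by componentwise application, an action $\tilde\alpha_\infty$ on $F_\infty(A)$; let $F_{\infty,\alpha}(A)$ be the C*-subalgebra of all $x\in F_\infty(A)$ for which $g\mapsto\tilde\alpha_{\infty,g}(x)$ is norm continuous. The action $\alpha$ has the *Rokhlin property* if there is a unital $*$-homomorphism $\varphi:C(G)\to F_{\infty,\alpha}(A)$ with $\varphi(f(g^{-1}\,\cdot\,))=\tilde\alpha_{\infty,g}(\varphi(f))$ for all $g\in G$ and $f\in C(G)$. *Approximate representability.* An action $\alpha$ of a discrete group $H$ on a separable C*-algebra $A$ is *approximately representable* if there are contractions $x_{n,h}\in A$ ($n\in\mathbb N$, $h\in H$) such that for all $g,h\in H$ and $a\in A$: (1) $(x_{n,h}x_{n,h}^*)_n$ and $(x_{n,h}^*x_{n,h})_n$ are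 approximate units for $A$; (2) $\lim_{n\to\infty}\|a(x_{n,g}x_{n,h}-x_{n,gh})\|+\|(x_{n,g}x_{n,h}-x_{n,gh})a\|=0$; (3) $\lim_{n\to\infty}\|\alpha_h(a)-x_{n,h}ax_{n,h}^*\|=0$; (4) $\lim_{n\to\infty}\|a(x_{n,ghg^{-1}}-\alpha_g(x_{n,h}))\|+\|(x_{n,ghg^{-1}}-\alpha_g(x_{n,h}))a\|=0$. -/

import Mathlib

open MeasureTheory Filter Topology
open scoped ENNReal CompactlySupported

set_option linter.unusedSectionVars false

noncomputable section

/-- A complex ⋆-algebra with a C⋆-seminorm. -/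
class PreCStarAlgebra (R : Type*) extends NonUnitalSeminormedRing R, StarRing R, NormedSpace ℂ R,
    IsScalarTower ℂ R R, SMulCommClass ℂ R R, StarModule ℂ R where
  norm_mul_self_le : ∀ x : R, ‖x‖ * ‖x‖ ≤ ‖star x * x‖

instance (priority := 100) PreCStarAlgebra.toNormedStarGroup (R : Type*) [PreCStarAlgebra R] :
    NormedStarGroup R where
  norm_star_le x := by
    obtain h | h := (norm_nonneg (star x)).eq_or_lt
    · rw [← h]; exact norm_nonneg x
    · refine le_of_mul_le_mul_right ?_ h
      simpa [mul_comm] using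
        (PreCStarAlgebra.norm_mul_self_le (star x)).trans (norm_mul_le _ _)

/-- The Hausdorff completion of a ⋆-algebra with a C⋆-seminorm. -/
def CStarCompletion (R : Type*) [PreCStarAlgebra R] : Type _ := UniformSpace.Completion R

namespace CStarCompletion

open UniformSpace

variable {R : Type*} [PreCStarAlgebra R]

instance : NormedAddCommGroup (CStarCompletion R) :=
  inferInstanceAs (NormedAddCommGroup (Completion (R)))

instance : NormedSpace ℂ (CStarCompletion R) :=
  inferInstanceAs (NormedSpace ℂ (Completion (R)))

instance : CompleteSpace (CStarCompletion R) :=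
  inferInstanceAs (CompleteSpace (Completion (R)))

/-- The canonical map into the completion. -/
def of (f : R) : CStarCompletion R := (f : Completion (R))

lemma norm_of (f : R) : ‖(of f : CStarCompletion R)‖ = ‖f‖ := Completion.norm_coe f

lemma continuous_of : Continuous (of : R → CStarCompletion R) :=
  Completion.continuous_coe _

lemma isDenseInducing_of : IsDenseInducing (of : R → CStarCompletion R) :=
  Completion.isDenseInducing_coe

lemma denseRange_of : DenseRange (of : R → CStarCompletion R) :=
  isDenseInducing_of.dense

lemma of_add (f g : R) : (of (f + g) : CStarCompletion R) = of f + of g :=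
  Completion.coe_add f g

lemma of_zero : (of 0 : CStarCompletion R) = 0 := rfl

lemma of_smul (c : ℂ) (f : R) : (of (c • f) : CStarCompletion R) = c • of f :=
  Completion.coe_smul c f

/-- The product of the completion is the continuous extension of that of `R`. -/
instance : Mul (CStarCompletion R) :=
  ⟨fun x y => (isDenseInducing_of.prodMap isDenseInducing_of).extend
    (fun p : R × R => (of (p.1 * p.2) : CStarCompletion R)) (x, y)⟩

/-- The involution of the completion is the continuous extension of that of `R`. -/
instance : Star (CStarCompletion R) :=
  ⟨(Completion.map star : Completion (R) → Completion (R))⟩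

lemma of_mul (f g : R) : (of (f * g) : CStarCompletion R) = of f * of g :=
  ((isDenseInducing_of.prodMap isDenseInducing_of).extend_eq
    (f := fun p : R × R => (of (p.1 * p.2) : CStarCompletion R))
    (continuous_of.comp continuous_mul) (f, g)).symm

lemma of_star (f : R) : (of (star f) : CStarCompletion R) = star (of f) :=
  (Completion.map_coe star_isometry.uniformContinuous f).symm

instance : ContinuousMul (CStarCompletion R) where
  continuous_mul := by
    let m : R →+ R →+ Completion (R) :=
      (AddMonoidHom.mul : R →+ R →+ R).compr₂ Completion.toCompl
    have : Continuous fun p : R × R => m p.1 p.2 :=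
      (Completion.continuous_coe _).comp continuous_mul
    have di : IsDenseInducing (Completion.toCompl : R → Completion (R)) :=
      Completion.isDenseInducing_coe
    exact (di.extend_Z_bilin di this :)

instance : ContinuousStar (CStarCompletion R) where
  continuous_star := Completion.continuous_map

lemma induction₁ {p : CStarCompletion R → Prop}
    (hp : IsClosed {x | p x}) (h : ∀ f, p (of f)) (x : CStarCompletion R) : p x :=
  Completion.induction_on x hp h

lemma eq_of_eqOn {F : CStarCompletion R → CStarCompletion R}
    {F' : CStarCompletion R → CStarCompletion R} (hF : Continuous F) (hF' : Continuous F')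
    (h : ∀ f, F (of f) = F' (of f)) (x : CStarCompletion R) : F x = F' x :=
  induction₁ (isClosed_eq hF hF') h x

protected lemma mul_assoc (x y z : CStarCompletion R) : x * y * z = x * (y * z) := by
  revert x; refine eq_of_eqOn ((continuous_id.mul continuous_const).mul continuous_const)
    (continuous_id.mul continuous_const) fun f => ?_
  revert y; refine eq_of_eqOn ((continuous_const.mul continuous_id).mul continuous_const)
    (continuous_const.mul (continuous_id.mul continuous_const)) fun g => ?_
  revert z; refine eq_of_eqOn (continuous_const.mul continuous_id)
    (continuous_const.mul (continuous_const.mul continuous_id)) fun h => ?_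
  simp only [← of_mul, mul_assoc]

protected lemma mul_add (x y z : CStarCompletion R) : x * (y + z) = x * y + x * z := by
  revert x; refine eq_of_eqOn (continuous_id.mul continuous_const)
    ((continuous_id.mul continuous_const).add (continuous_id.mul continuous_const)) fun f => ?_
  revert y; refine eq_of_eqOn (continuous_const.mul (continuous_id.add continuous_const))
    ((continuous_const.mul continuous_id).add continuous_const) fun g => ?_
  revert z; refine eq_of_eqOn (continuous_const.mul (continuous_const.add continuous_id))
    (continuous_const.add (continuous_const.mul continuous_id)) fun h => ?_
  simp only [← of_mul, ← of_add, mul_add]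

protected lemma add_mul (x y z : CStarCompletion R) : (x + y) * z = x * z + y * z := by
  revert x; refine eq_of_eqOn ((continuous_id.add continuous_const).mul continuous_const)
    ((continuous_id.mul continuous_const).add continuous_const) fun f => ?_
  revert y; refine eq_of_eqOn ((continuous_const.add continuous_id).mul continuous_const)
    (continuous_const.add (continuous_id.mul continuous_const)) fun g => ?_
  revert z; refine eq_of_eqOn (continuous_const.mul continuous_id)
    ((continuous_const.mul continuous_id).add (continuous_const.mul continuous_id)) fun h => ?_
  simp only [← of_mul, ← of_add, add_mul]

protected lemma norm_mul_le (x y : CStarCompletion R) : ‖x * y‖ ≤ ‖x‖ * ‖y‖ := by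
  revert x; refine induction₁ (isClosed_le (continuous_id.mul continuous_const).norm
    (continuous_id.norm.mul continuous_const)) fun f => ?_
  revert y; refine induction₁ (isClosed_le (continuous_const.mul continuous_id).norm
    (continuous_const.mul continuous_id.norm)) fun g => ?_
  simpa only [← of_mul, norm_of] using norm_mul_le f g

protected lemma star_add (x y : CStarCompletion R) : star (x + y) = star x + star y := by
  revert x; refine eq_of_eqOn (continuous_id.add continuous_const).star
    (continuous_id.star.add continuous_const) fun f => ?_
  revert y; refine eq_of_eqOn (continuous_const.add continuous_id).star
    (continuous_const.add continuous_id.star) fun g => ?_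
  simp only [← of_star, ← of_add, star_add]

protected lemma star_mul (x y : CStarCompletion R) : star (x * y) = star y * star x := by
  revert x; refine eq_of_eqOn (continuous_id.mul continuous_const).star
    (continuous_const.mul continuous_id.star) fun f => ?_
  revert y; refine eq_of_eqOn (continuous_const.mul continuous_id).star
    (continuous_id.star.mul continuous_const) fun g => ?_
  simp only [← of_star, ← of_mul, star_mul]

protected lemma star_star (x : CStarCompletion R) : star (star x) = x := by
  revert x; refine eq_of_eqOn continuous_id.star.star continuous_id fun f => ?_
  rw [← of_star, ← of_star, star_star]

protected lemma norm_mul_self_le (x : CStarCompletion R) : ‖x‖ * ‖x‖ ≤ ‖star x * x‖ := by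
  revert x; refine induction₁ (isClosed_le (continuous_id.norm.mul continuous_id.norm)
    (continuous_id.star.mul continuous_id).norm) fun f => ?_
  simpa only [← of_star, ← of_mul, norm_of] using PreCStarAlgebra.norm_mul_self_le f

protected lemma smul_mul (c : ℂ) (x y : CStarCompletion R) : (c • x) * y = c • (x * y) := by
  revert x; refine eq_of_eqOn ((continuous_id.const_smul c).mul continuous_const)
    ((continuous_id.mul continuous_const).const_smul c) fun f => ?_
  revert y; refine eq_of_eqOn (continuous_const.mul continuous_id)
    ((continuous_const.mul continuous_id).const_smul c) fun g => ?_
  simp only [← of_mul, ← of_smul, smul_mul_assoc]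

protected lemma mul_smul (c : ℂ) (x y : CStarCompletion R) : x * (c • y) = c • (x * y) := by
  revert x; refine eq_of_eqOn (continuous_id.mul continuous_const)
    ((continuous_id.mul continuous_const).const_smul c) fun f => ?_
  revert y; refine eq_of_eqOn (continuous_const.mul (continuous_id.const_smul c))
    ((continuous_const.mul continuous_id).const_smul c) fun g => ?_
  simp only [← of_mul, ← of_smul, mul_smul_comm]

protected lemma star_smul (c : ℂ) (x : CStarCompletion R) : star (c • x) = star c • star x := by
  revert x; refine eq_of_eqOn ((continuous_id.const_smul c).star)
    (continuous_id.star.const_smul (star c)) fun f => ?_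
  simp only [← of_star, ← of_smul, star_smul]

instance : NonUnitalNormedRing (CStarCompletion R) where
  __ : NormedAddCommGroup (CStarCompletion R) := inferInstance
  zero_mul x := by
    have h := CStarCompletion.add_mul 0 0 x
    rw [add_zero] at h
    exact left_eq_add.1 h
  mul_zero x := by
    have h := CStarCompletion.mul_add x 0 0
    rw [add_zero] at h
    exact left_eq_add.1 h
  mul_assoc := CStarCompletion.mul_assoc
  left_distrib := CStarCompletion.mul_add
  right_distrib := CStarCompletion.add_mul
  norm_mul_le := CStarCompletion.norm_mul_le

instance : StarRing (CStarCompletion R) where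
  star_involutive := CStarCompletion.star_star
  star_add := CStarCompletion.star_add
  star_mul := CStarCompletion.star_mul

/-- The completion is a C⋆-algebra. -/
instance : NonUnitalCStarAlgebra (CStarCompletion R) where
  norm_mul_self_le := CStarCompletion.norm_mul_self_le
  smul_assoc := CStarCompletion.smul_mul
  smul_comm c x y := (CStarCompletion.mul_smul c x y).symm
  star_smul := CStarCompletion.star_smul

end CStarCompletion

/-- A (point-norm continuous) action of a topological group `G` on a C⋆-algebra `A` by
⋆-automorphisms. -/
structure CStarAction (G A : Type*) [Group G] [TopologicalSpace G] [NonUnitalCStarAlgebra A] where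
  toHom : G →* (A ≃⋆ₐ[ℂ] A)
  continuous_apply : ∀ a : A, Continuous fun g : G => toHom g a

namespace CStarAction

section Basic

variable {G A : Type*} [Group G] [TopologicalSpace G] [NonUnitalCStarAlgebra A]

instance : CoeFun (CStarAction G A) (fun _ => G → (A ≃⋆ₐ[ℂ] A)) := ⟨fun α => α.toHom⟩

variable (α : CStarAction G A)

lemma norm_apply (g : G) (a : A) : ‖α g a‖ = ‖a‖ := StarAlgEquiv.norm_map (α g) a

lemma one_apply (a : A) : α 1 a = a := by rw [map_one]; rfl

lemma mul_apply (g h : G) (a : A) : α (g * h) a = α g (α h a) := by rw [map_mul]; rfl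

lemma continuous_uncurry : Continuous fun p : G × A => α p.1 p.2 := by
  rw [continuous_iff_continuousAt]
  rintro ⟨g₀, a₀⟩
  have h1 : Tendsto (fun p : G × A => α p.1 (p.2 - a₀)) (𝓝 (g₀, a₀)) (𝓝 0) := by
    rw [tendsto_zero_iff_norm_tendsto_zero]
    simp only [norm_apply]
    have : Continuous fun p : G × A => ‖p.2 - a₀‖ := by fun_prop
    simpa using this.tendsto (g₀, a₀)
  have h2 : Tendsto (fun p : G × A => α p.1 a₀) (𝓝 (g₀, a₀)) (𝓝 (α g₀ a₀)) :=
    ((α.continuous_apply a₀).comp continuous_fst).tendsto (g₀, a₀)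
  have := h1.add h2
  simpa [ContinuousAt, ← map_add] using this

lemma continuous_comp {X : Type*} [TopologicalSpace X] {u : X → G} {v : X → A}
    (hu : Continuous u) (hv : Continuous v) : Continuous fun x => α (u x) (v x) :=
  α.continuous_uncurry.comp (hu.prodMk hv)

/-- The automorphism `α g` as a continuous linear map. -/
def toCLM (g : G) : A →L[ℂ] A :=
  LinearMap.mkContinuous
    { toFun := fun a => α g a
      map_add' := fun a b => map_add (α g) a b
      map_smul' := fun c a => map_smul (α g) c a } 1 fun a => by simp [norm_apply]

@[simp] lemma toCLM_apply (g : G) (a : A) : α.toCLM g a = α g a := rfl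

end Basic

end CStarAction

/-- The space `C_c(G, A)`, regarded as the algebra with the convolution product and involution that
are twisted by `α`, for the Haar measure `μ`. -/
def ConvAlg {G A : Type*} [Group G] [TopologicalSpace G] [MeasurableSpace G]
    [NonUnitalCStarAlgebra A] (_α : CStarAction G A) (_μ : Measure G) : Type _ := C_c(G, A)

namespace ConvAlg

variable {G A : Type*} [CommGroup G] [TopologicalSpace G] [MeasurableSpace G]
  [NonUnitalCStarAlgebra A] {α : CStarAction G A} {μ : Measure G}

instance : AddCommGroup (ConvAlg α μ) := inferInstanceAs (AddCommGroup C_c(G, A))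
instance : Module ℂ (ConvAlg α μ) := inferInstanceAs (Module ℂ C_c(G, A))
instance : FunLike (ConvAlg α μ) G A := inferInstanceAs (FunLike C_c(G, A) G A)

@[ext] lemma ext {f g : ConvAlg α μ} (h : ∀ s, f s = g s) : f = g := DFunLike.ext _ _ h

lemma continuous (f : ConvAlg α μ) : Continuous f := (show C_c(G, A) from f).continuous
lemma hasCompactSupport (f : ConvAlg α μ) : HasCompactSupport f :=
  (show C_c(G, A) from f).hasCompactSupport

@[simp] lemma add_apply (f g : ConvAlg α μ) (s : G) : (f + g) s = f s + g s := rfl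
@[simp] lemma neg_apply (f : ConvAlg α μ) (s : G) : (-f) s = -f s := rfl
@[simp] lemma sub_apply (f g : ConvAlg α μ) (s : G) : (f - g) s = f s - g s := rfl
@[simp] lemma zero_apply (s : G) : (0 : ConvAlg α μ) s = 0 := rfl
@[simp] lemma smul_apply (c : ℂ) (f : ConvAlg α μ) (s : G) : (c • f) s = c • f s := rfl

lemma apply_eq_zero {f : ConvAlg α μ} {s : G} (h : s ∉ tsupport f) : f s = 0 :=
  image_eq_zero_of_notMem_tsupport h

/-- Build an element of `ConvAlg α μ` from a continuous compactly supported function. -/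
def mk (f : G → A) (hf : Continuous f) (hc : HasCompactSupport f) : ConvAlg α μ :=
  (⟨⟨f, hf⟩, hc⟩ : C_c(G, A))

@[simp] lemma mk_apply (f : G → A) (hf : Continuous f) (hc : HasCompactSupport f) (s : G) :
    (mk f hf hc : ConvAlg α μ) s = f s := rfl

variable [IsTopologicalGroup G] [BorelSpace G]

lemma integrand_continuous (f g : ConvAlg α μ) :
    Continuous fun p : G × G => f p.2 * α p.2 (g (p.2⁻¹ * p.1)) :=
  (f.continuous.comp continuous_snd).mul
    (α.continuous_comp continuous_snd (g.continuous.comp (by fun_prop)))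

lemma integrand_integrable [IsFiniteMeasureOnCompacts μ] (f g : ConvAlg α μ) (s : G) :
    Integrable (fun t => f t * α t (g (t⁻¹ * s))) μ := by
  refine Continuous.integrable_of_hasCompactSupport ?_ ?_
  · exact (integrand_continuous f g).comp (Continuous.prodMk_right s)
  · exact f.hasCompactSupport.mul_right

lemma conv_continuous [IsFiniteMeasureOnCompacts μ] (f g : ConvAlg α μ) :
    Continuous fun s => ∫ t, f t * α t (g (t⁻¹ * s)) ∂μ := by
  rw [← continuousOn_univ]
  refine continuousOn_integral_of_compact_support (k := tsupport f) f.hasCompactSupport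
    (f := fun s t => f t * α t (g (t⁻¹ * s))) (integrand_continuous f g).continuousOn ?_
  intro p x _ hx
  simp [apply_eq_zero hx]

lemma conv_hasCompactSupport (f g : ConvAlg α μ) :
    HasCompactSupport fun s => ∫ t, f t * α t (g (t⁻¹ * s)) ∂μ := by
  have hK : IsCompact ((fun p : G × G => p.1 * p.2) '' (tsupport f ×ˢ tsupport g)) :=
    (f.hasCompactSupport.isCompact.prod g.hasCompactSupport.isCompact).image continuous_mul
  refine HasCompactSupport.intro hK fun s hs => ?_
  refine integral_eq_zero_of_ae (Eventually.of_forall fun t => ?_)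
  by_cases ht : t ∈ tsupport f
  · have : t⁻¹ * s ∉ tsupport g := fun h => hs ⟨(t, t⁻¹ * s), ⟨ht, h⟩, by simp⟩
    simp [apply_eq_zero this]
  · simp [apply_eq_zero ht]

/-- `(f * g)(s) = ∫ f(t) α_t(g(t⁻¹ s)) dt`. -/
instance [IsFiniteMeasureOnCompacts μ] : Mul (ConvAlg α μ) where
  mul f g := mk (fun s => ∫ t, f t * α t (g (t⁻¹ * s)) ∂μ) (conv_continuous f g)
    (conv_hasCompactSupport f g)

lemma mul_apply [IsFiniteMeasureOnCompacts μ] (f g : ConvAlg α μ) (s : G) :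
    (f * g) s = ∫ t, f t * α t (g (t⁻¹ * s)) ∂μ := rfl

/-- `f⋆(s) = α_s(f(s⁻¹)⋆)`; the group is abelian, so no modular function appears. -/
instance : Star (ConvAlg α μ) where
  star f := mk (fun s => α s (star (f s⁻¹)))
    (α.continuous_comp continuous_id ((f.continuous.comp continuous_inv).star)) <| by
      have hK : IsCompact ((fun s : G => s⁻¹) '' tsupport f) :=
        f.hasCompactSupport.isCompact.image continuous_inv
      refine HasCompactSupport.intro hK fun s hs => ?_
      have : s⁻¹ ∉ tsupport f := fun h => hs ⟨s⁻¹, h, by simp⟩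
      simp [apply_eq_zero this]

lemma star_apply (f : ConvAlg α μ) (s : G) : (star f) s = α s (star (f s⁻¹)) := rfl

section Ring

variable [IsFiniteMeasureOnCompacts μ] [μ.IsMulLeftInvariant]

lemma mul_assoc' (f g h : ConvAlg α μ) : f * g * h = f * (g * h) := by
  ext s
  simp only [mul_apply]
  have e1 : ∀ u, (∫ t, f t * α t (g (t⁻¹ * u)) ∂μ) * α u (h (u⁻¹ * s))
      = ∫ t, f t * α t (g (t⁻¹ * u)) * α u (h (u⁻¹ * s)) ∂μ := fun u =>
    (((ContinuousLinearMap.mul ℂ A).flip (α u (h (u⁻¹ * s)))).integral_comp_comm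
      (integrand_integrable f g u)).symm
  have e2 : ∀ t, f t * α t (∫ u, g u * α u (h (u⁻¹ * (t⁻¹ * s))) ∂μ)
      = ∫ u, f t * α t (g u * α u (h (u⁻¹ * (t⁻¹ * s)))) ∂μ := fun t =>
    (((ContinuousLinearMap.mul ℂ A (f t)).comp (α.toCLM t)).integral_comp_comm
      (integrand_integrable g h (t⁻¹ * s))).symm
  simp only [e1, e2]
  rw [integral_integral_swap_of_hasCompactSupport]
  · refine integral_congr_ae (Eventually.of_forall fun t => ?_)
    dsimp only
    rw [← integral_mul_left_eq_self _ t]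
    refine integral_congr_ae (Eventually.of_forall fun u => ?_)
    dsimp only
    rw [map_mul (α t), ← CStarAction.mul_apply]
    simp [mul_assoc]
  · have h1 : Continuous fun p : G × G => f p.2 * α p.2 (g (p.2⁻¹ * p.1)) :=
      integrand_continuous f g
    have h2 : Continuous fun p : G × G => α p.1 (h (p.1⁻¹ * s)) :=
      α.continuous_comp continuous_fst (h.continuous.comp (by fun_prop))
    exact h1.mul h2
  · have hK : IsCompact ((fun p : G × G => (p.1 * p.2, p.1)) '' (tsupport f ×ˢ tsupport g)) :=
      (f.hasCompactSupport.isCompact.prod g.hasCompactSupport.isCompact).image (by fun_prop)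
    refine HasCompactSupport.intro hK ?_
    rintro ⟨u, t⟩ hs
    simp only [Function.uncurry]
    by_cases ht : t ∈ tsupport f
    · have : t⁻¹ * u ∉ tsupport g := fun h => hs ⟨(t, t⁻¹ * u), ⟨ht, h⟩, by simp⟩
      simp [apply_eq_zero this]
    · simp [apply_eq_zero ht]

instance : NonUnitalRing (ConvAlg α μ) where
  left_distrib f g h := by
    ext s
    simp only [mul_apply, add_apply, map_add, mul_add]
    exact integral_add (integrand_integrable f g s) (integrand_integrable f h s)
  right_distrib f g h := by
    ext s
    simp only [mul_apply, add_apply, add_mul]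
    exact integral_add (integrand_integrable f h s) (integrand_integrable g h s)
  zero_mul f := by ext s; simp [mul_apply]
  mul_zero f := by ext s; simp [mul_apply]
  mul_assoc := mul_assoc'

instance : IsScalarTower ℂ (ConvAlg α μ) (ConvAlg α μ) where
  smul_assoc c f g := by
    ext s
    simp only [smul_eq_mul, mul_apply, smul_apply, smul_mul_assoc]
    exact integral_smul c _

instance : SMulCommClass ℂ (ConvAlg α μ) (ConvAlg α μ) where
  smul_comm c f g := by
    ext s
    simp only [smul_eq_mul, mul_apply, smul_apply, map_smul, mul_smul_comm]
    exact (integral_smul c _).symm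

instance : StarRing (ConvAlg α μ) where
  star_involutive f := by
    ext s
    rw [star_apply, star_apply, ← map_star, star_star, ← CStarAction.mul_apply]
    simp
  star_add f g := by ext s; simp [star_apply]
  star_mul f g := by
    ext s
    simp only [star_apply, mul_apply]
    have e : α s (star (∫ t, f t * α t (g (t⁻¹ * s⁻¹)) ∂μ))
        = ∫ t, α s (star (f t * α t (g (t⁻¹ * s⁻¹)))) ∂μ :=
      ((((α.toCLM s).restrictScalars ℝ).comp
        ((starL' ℝ : A ≃L[ℝ] A) : A →L[ℝ] A)).integral_comp_comm
        (integrand_integrable f g s⁻¹)).symm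
    rw [e, ← integral_mul_left_eq_self _ s⁻¹]
    refine integral_congr_ae (Eventually.of_forall fun t => ?_)
    dsimp only
    rw [star_mul, map_mul, ← map_star, ← CStarAction.mul_apply, ← CStarAction.mul_apply]
    simp [mul_comm]

instance : StarModule ℂ (ConvAlg α μ) where
  star_smul c f := by ext s; simp [star_apply]

end Ring

end ConvAlg

/-- A C⋆-seminorm on a complex ⋆-algebra. -/
structure IsCStarSeminorm {R : Type*} [NonUnitalRing R] [StarRing R] [Module ℂ R]
    (p : Seminorm ℂ R) : Prop where
  mul_le : ∀ x y, p (x * y) ≤ p x * p y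
  star_mul_self : ∀ x, p (star x * x) = p x ^ 2

namespace ConvAlg

variable {G A : Type*} [CommGroup G] [TopologicalSpace G] [MeasurableSpace G]
  [NonUnitalCStarAlgebra A] {α : CStarAction G A} {μ : Measure G}
  [IsTopologicalGroup G] [BorelSpace G] [IsFiniteMeasureOnCompacts μ] [μ.IsMulLeftInvariant]

variable (α μ) in
/-- The C⋆-seminorms on `C_c(G, A)` that are dominated by the `L¹`-norm. -/
def AdmissibleSeminorm : Type _ :=
  {p : Seminorm ℂ (ConvAlg α μ) // IsCStarSeminorm p ∧ ∀ f, p f ≤ ∫ s, ‖f s‖ ∂μ}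

instance : Nonempty (AdmissibleSeminorm α μ) :=
  ⟨⟨0, ⟨fun _ _ => by simp, fun _ => by simp⟩,
    fun f => by simpa using integral_nonneg fun s => norm_nonneg (f s)⟩⟩

/-- The universal norm on `C_c(G, A)`: the largest C⋆-seminorm that is dominated by the
`L¹`-norm. -/
def universalNorm (f : ConvAlg α μ) : ℝ := ⨆ p : AdmissibleSeminorm α μ, p.1 f

lemma bddAbove_range (f : ConvAlg α μ) :
    BddAbove (Set.range fun p : AdmissibleSeminorm α μ => p.1 f) :=
  ⟨∫ s, ‖f s‖ ∂μ, by rintro _ ⟨p, rfl⟩; exact p.2.2 f⟩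

lemma le_universalNorm (p : AdmissibleSeminorm α μ) (f : ConvAlg α μ) :
    p.1 f ≤ universalNorm f := le_ciSup (bddAbove_range f) p

lemma universalNorm_le {f : ConvAlg α μ} {c : ℝ} (h : ∀ p : AdmissibleSeminorm α μ, p.1 f ≤ c) :
    universalNorm f ≤ c := ciSup_le h

lemma universalNorm_nonneg (f : ConvAlg α μ) : 0 ≤ universalNorm f :=
  (apply_nonneg _ _).trans (le_universalNorm (Classical.arbitrary _) f)

lemma universalNorm_smul_le (c : ℂ) (f : ConvAlg α μ) :
    universalNorm (c • f) ≤ ‖c‖ * universalNorm f :=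
  universalNorm_le fun p => by
    rw [map_smul_eq_mul]
    exact mul_le_mul_of_nonneg_left (le_universalNorm p f) (norm_nonneg c)

variable (α μ) in
/-- The universal norm as a seminorm on the additive group. -/
def universalSeminorm : AddGroupSeminorm (ConvAlg α μ) where
  toFun := universalNorm
  map_zero' := le_antisymm (universalNorm_le fun p => by simp) (universalNorm_nonneg _)
  add_le' f g := universalNorm_le fun p =>
    (map_add_le_add p.1 f g).trans (add_le_add (le_universalNorm p f) (le_universalNorm p g))
  neg' f := by simp [universalNorm]

instance : NonUnitalSeminormedRing (ConvAlg α μ) where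
  __ := (universalSeminorm α μ).toSeminormedAddCommGroup
  __ : NonUnitalRing (ConvAlg α μ) := inferInstance
  norm_mul_le f g := universalNorm_le fun p => (p.2.1.mul_le f g).trans <|
    mul_le_mul (le_universalNorm p f) (le_universalNorm p g) (apply_nonneg _ _)
      (universalNorm_nonneg f)

instance : NormedSpace ℂ (ConvAlg α μ) where
  norm_smul_le c f := universalNorm_smul_le c f

lemma norm_eq_iSup (f : ConvAlg α μ) : ‖f‖ = ⨆ p : AdmissibleSeminorm α μ, p.1 f := rfl

lemma norm_le_integral (f : ConvAlg α μ) : ‖f‖ ≤ ∫ s, ‖f s‖ ∂μ :=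
  universalNorm_le fun p => p.2.2 f

protected lemma norm_mul_self_le (f : ConvAlg α μ) : ‖f‖ * ‖f‖ ≤ ‖star f * f‖ := by
  rw [← pow_two]
  refine (Real.le_sqrt (norm_nonneg f) (norm_nonneg _)).1 (universalNorm_le fun p => ?_)
  refine Real.le_sqrt_of_sq_le ?_
  rw [← p.2.1.star_mul_self f]
  exact le_universalNorm p _

instance : PreCStarAlgebra (ConvAlg α μ) where
  norm_mul_self_le := ConvAlg.norm_mul_self_le

end ConvAlg

/-- The (full) crossed product `A ⋊_α G`: the completion of the convolution algebra `C_c(G, A)` in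
its universal norm, i.e. the enveloping C⋆-algebra of `L¹(G, A)`. -/
abbrev CrossedProduct {G A : Type*} [CommGroup G] [TopologicalSpace G] [IsTopologicalGroup G]
    [MeasurableSpace G] [BorelSpace G] [NonUnitalCStarAlgebra A] (α : CStarAction G A)
    (μ : Measure G) [IsFiniteMeasureOnCompacts μ] [μ.IsMulLeftInvariant] : Type _ :=
  CStarCompletion (ConvAlg α μ)

namespace CStarCompletion

open UniformSpace

variable {R : Type*} [PreCStarAlgebra R]

/-- The continuous extension of an isometric ⋆-homomorphism to the completion. -/
def map (φ : R →⋆ₙₐ[ℂ] R) (hφ : ∀ x, ‖φ x‖ = ‖x‖) :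
    CStarCompletion R →⋆ₙₐ[ℂ] CStarCompletion R :=
  have hu : UniformContinuous φ := (AddMonoidHomClass.isometry_of_norm φ hφ).uniformContinuous
  let F : CStarCompletion R → CStarCompletion R :=
    (Completion.map φ : Completion R → Completion R)
  have hF : Continuous F := Completion.continuous_map
  have hof : ∀ x : R, F (of x) = of (φ x) := fun x => Completion.map_coe hu x
  have hadd : ∀ x y, F (x + y) = F x + F y := fun x y => by
    revert x; refine eq_of_eqOn (hF.comp (continuous_id.add continuous_const))
      (hF.add continuous_const) fun f => ?_
    revert y; refine eq_of_eqOn (hF.comp (continuous_const.add continuous_id))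
      (continuous_const.add hF) fun g => ?_
    simp only [← of_add, hof, map_add]
  { toFun := F
    map_smul' := fun c x => by
      revert x; refine eq_of_eqOn (hF.comp (continuous_id.const_smul c))
        (hF.const_smul c) fun f => ?_
      simp only [← of_smul, hof, map_smul, MonoidHom.id_apply]
    map_zero' := by rw [← of_zero, hof, map_zero]
    map_add' := hadd
    map_mul' := fun x y => by
      revert x; refine eq_of_eqOn (hF.comp (continuous_id.mul continuous_const))
        (hF.mul continuous_const) fun f => ?_
      revert y; refine eq_of_eqOn (hF.comp (continuous_const.mul continuous_id))
        (continuous_const.mul hF) fun g => ?_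
      simp only [← of_mul, hof, map_mul]
    map_star' := fun x => by
      revert x; refine eq_of_eqOn (hF.comp continuous_id.star) hF.star fun f => ?_
      simp only [← of_star, hof, map_star] }

@[simp] lemma map_of (φ : R →⋆ₙₐ[ℂ] R) (hφ : ∀ x, ‖φ x‖ = ‖x‖) (x : R) :
    map φ hφ (of x) = of (φ x) :=
  Completion.map_coe (AddMonoidHomClass.isometry_of_norm φ hφ).uniformContinuous x

lemma continuous_map (φ : R →⋆ₙₐ[ℂ] R) (hφ : ∀ x, ‖φ x‖ = ‖x‖) : Continuous (map φ hφ) :=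
  Completion.continuous_map (f := φ)

end CStarCompletion

namespace ConvAlg

variable {G A : Type*} [CommGroup G] [TopologicalSpace G] [MeasurableSpace G]
  [NonUnitalCStarAlgebra A] {α : CStarAction G A} {μ : Measure G}
  [IsTopologicalGroup G] [BorelSpace G] [IsFiniteMeasureOnCompacts μ] [μ.IsMulLeftInvariant]

/-- Pointwise multiplication by a character, `(χ • f)(s) = χ(s) f(s)`, on `C_c(G, A)`. -/
def charMul (χ : PontryaginDual G) : ConvAlg α μ →⋆ₙₐ[ℂ] ConvAlg α μ where
  toFun f := mk (fun s => (χ s : ℂ) • f s)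
    ((continuous_subtype_val.comp (map_continuous χ)).smul f.continuous)
    (f.hasCompactSupport.smul_left (f := fun s => (χ s : ℂ)))
  map_smul' c f := by ext s; simp [smul_comm c]
  map_zero' := by ext s; simp
  map_add' f g := by ext s; simp
  map_mul' f g := by
    ext s
    simp only [mul_apply, mk_apply]
    rw [← integral_smul]
    refine integral_congr_ae (Eventually.of_forall fun t => ?_)
    have h : χ s = χ t * χ (t⁻¹ * s) := by rw [← map_mul]; simp
    simp only [h, Circle.coe_mul, map_smul, smul_mul_assoc, mul_smul_comm, smul_smul,
      mul_comm (χ t : ℂ)]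
  map_star' f := by
    ext s
    simp [star_apply, ← Circle.coe_inv_eq_conj]

@[simp] lemma charMul_apply (χ : PontryaginDual G) (f : ConvAlg α μ) (s : G) :
    charMul χ f s = (χ s : ℂ) • f s := rfl

lemma charMul_one (f : ConvAlg α μ) : charMul 1 f = f := by ext s; simp

lemma charMul_mul (χ ψ : PontryaginDual G) (f : ConvAlg α μ) :
    charMul (χ * ψ) f = charMul χ (charMul ψ f) := by
  ext s
  have h : (χ * ψ) s = χ s * ψ s := rfl
  simp [smul_smul, h]

lemma norm_charMul_le (χ : PontryaginDual G) (f : ConvAlg α μ) : ‖charMul χ f‖ ≤ ‖f‖ := by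
  refine universalNorm_le fun p => ?_
  let q : Seminorm ℂ (ConvAlg α μ) := p.1.comp (σ₁₂ := RingHom.id ℂ)
    { toFun := charMul χ, map_add' := map_add _,
      map_smul' := fun c f => map_smul (charMul χ) c f }
  have hq : IsCStarSeminorm q :=
    ⟨fun f g => by simpa [q] using p.2.1.mul_le (charMul χ f) (charMul χ g),
      fun f => by simpa [q, map_star] using p.2.1.star_mul_self (charMul χ f)⟩
  have hq' : ∀ f, q f ≤ ∫ s, ‖f s‖ ∂μ := fun f => by
    have h := p.2.2 (charMul χ f)
    simp only [charMul_apply, norm_smul, Circle.norm_coe, one_mul] at h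
    exact h
  exact le_universalNorm ⟨q, hq, hq'⟩ f

lemma norm_charMul (χ : PontryaginDual G) (f : ConvAlg α μ) : ‖charMul χ f‖ = ‖f‖ := by
  refine le_antisymm (norm_charMul_le χ f) ?_
  calc ‖f‖ = ‖charMul χ⁻¹ (charMul χ f)‖ := by rw [← charMul_mul, inv_mul_cancel, charMul_one]
    _ ≤ _ := norm_charMul_le _ _

lemma continuous_charMul [LocallyCompactSpace G] (f : ConvAlg α μ) :
    Continuous fun χ : PontryaginDual G => charMul χ f := by
  rw [continuous_iff_continuousAt]
  intro χ₀
  rw [ContinuousAt, tendsto_iff_norm_sub_tendsto_zero]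
  have hev : Continuous fun p : PontryaginDual G × G => p.1 p.2 :=
    (ContinuousMonoidHom.instContinuousEval (A := G) (B := Circle)).continuous_eval
  have hc : Continuous fun p : PontryaginDual G × G =>
      ‖(p.1 p.2 : ℂ) • f p.2 - (χ₀ p.2 : ℂ) • f p.2‖ :=
    (((continuous_subtype_val.comp hev).smul (f.continuous.comp continuous_snd)).sub
      ((continuous_subtype_val.comp ((map_continuous χ₀).comp continuous_snd)).smul
        (f.continuous.comp continuous_snd))).norm
  have hI : Continuous fun χ : PontryaginDual G =>
      ∫ s, ‖(χ s : ℂ) • f s - (χ₀ s : ℂ) • f s‖ ∂μ := by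
    rw [← continuousOn_univ]
    refine continuousOn_integral_of_compact_support (k := tsupport f) f.hasCompactSupport
      (f := fun (χ : PontryaginDual G) s => ‖(χ s : ℂ) • f s - (χ₀ s : ℂ) • f s‖)
      hc.continuousOn ?_
    intro χ s _ hs
    simp [apply_eq_zero hs]
  have h0 := hI.tendsto χ₀
  simp only [sub_self, norm_zero, integral_zero] at h0
  exact squeeze_zero (fun _ => norm_nonneg _) (fun χ => norm_le_integral _) h0

end ConvAlg

section DualAction

variable {G A : Type*} [CommGroup G] [TopologicalSpace G] [IsTopologicalGroup G]
  [MeasurableSpace G] [BorelSpace G] [NonUnitalCStarAlgebra A]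

variable (α : CStarAction G A) (μ : Measure G) [IsFiniteMeasureOnCompacts μ]
    [μ.IsMulLeftInvariant]

/-- The extension of `f ↦ χ • f` on `C_c(G, A)` to the crossed product. -/
def dualHom (χ : PontryaginDual G) : CrossedProduct α μ →⋆ₙₐ[ℂ] CrossedProduct α μ :=
  CStarCompletion.map (ConvAlg.charMul χ) (ConvAlg.norm_charMul χ)

lemma dualHom_of (χ : PontryaginDual G) (f : ConvAlg α μ) :
    dualHom α μ χ (CStarCompletion.of f) = CStarCompletion.of (ConvAlg.charMul χ f) :=
  CStarCompletion.map_of _ _ f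

lemma continuous_dualHom (χ : PontryaginDual G) : Continuous (dualHom α μ χ) :=
  CStarCompletion.continuous_map _ _

lemma dualHom_one (x : CrossedProduct α μ) : dualHom α μ 1 x = x :=
  CStarCompletion.eq_of_eqOn (continuous_dualHom α μ 1) continuous_id
    (fun f => by rw [dualHom_of, ConvAlg.charMul_one]; rfl) x

lemma dualHom_mul (χ ψ : PontryaginDual G) (x : CrossedProduct α μ) :
    dualHom α μ (χ * ψ) x = dualHom α μ χ (dualHom α μ ψ x) :=
  CStarCompletion.eq_of_eqOn (continuous_dualHom α μ (χ * ψ))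
    ((continuous_dualHom α μ χ).comp (continuous_dualHom α μ ψ))
    (fun f => by
      rw [dualHom_of, ConvAlg.charMul_mul, Function.comp_apply, dualHom_of, dualHom_of]) x

/-- The automorphism `α̂_χ` of the crossed product. -/
def dualAut (χ : PontryaginDual G) : CrossedProduct α μ ≃⋆ₐ[ℂ] CrossedProduct α μ :=
  { toFun := dualHom α μ χ
    invFun := dualHom α μ χ⁻¹
    left_inv := fun x => by rw [← dualHom_mul, inv_mul_cancel, dualHom_one]
    right_inv := fun x => by rw [← dualHom_mul, mul_inv_cancel, dualHom_one]
    map_mul' := map_mul (dualHom α μ χ)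
    map_add' := map_add (dualHom α μ χ)
    map_star' := map_star (dualHom α μ χ)
    map_smul' := map_smul (dualHom α μ χ) }

lemma dualAut_apply (χ : PontryaginDual G) (x : CrossedProduct α μ) :
    dualAut α μ χ x = dualHom α μ χ x := rfl

/-- The dual action `α̂` of the Pontryagin dual of `G` on `A ⋊_α G`; on `C_c(G, A)` it is given by
`α̂_χ(f)(s) = χ(s) f(s)`. -/
def dualAction [LocallyCompactSpace G] : CStarAction (PontryaginDual G) (CrossedProduct α μ) where
  toHom :=
    { toFun := dualAut α μ
      map_one' := StarAlgEquiv.ext fun x => dualHom_one α μ x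
      map_mul' := fun χ ψ => StarAlgEquiv.ext fun x => dualHom_mul α μ χ ψ x }
  continuous_apply := fun x => by
    refine continuous_of_uniform_approx_of_continuous fun u hu => ?_
    obtain ⟨ε, hε, hεu⟩ := Metric.mem_uniformity_dist.1 hu
    obtain ⟨f, hf⟩ := CStarCompletion.denseRange_of.exists_dist_lt x hε
    refine ⟨fun χ => dualHom α μ χ (CStarCompletion.of f), ?_, fun χ => hεu ?_⟩
    · simp only [dualHom_of]
      exact CStarCompletion.continuous_of.comp (ConvAlg.continuous_charMul f)
    · have := (StarAlgEquiv.isometry (dualAut α μ χ)).dist_eq x (CStarCompletion.of f)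
      exact this.trans_lt hf

end DualAction

/-- A closed two-sided self-adjoint ideal of a C⋆-algebra. -/
structure ClosedStarIdeal (B : Type*) [NonUnitalCStarAlgebra B] extends Submodule ℂ B where
  mul_mem_left : ∀ b : B, ∀ {x}, x ∈ carrier → b * x ∈ carrier
  mul_mem_right : ∀ b : B, ∀ {x}, x ∈ carrier → x * b ∈ carrier
  star_mem : ∀ {x}, x ∈ carrier → star x ∈ carrier
  isClosed : IsClosed carrier

/-- The quotient C⋆-algebra `B / I`, with the quotient norm. -/
def CStarQuotient {B : Type*} [NonUnitalCStarAlgebra B] (I : ClosedStarIdeal B) : Type _ :=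
  B ⧸ I.toSubmodule

namespace ClosedStarIdeal

variable {B : Type*} [NonUnitalCStarAlgebra B] (I : ClosedStarIdeal B)

instance isClosed' : IsClosed (I.toSubmodule : Set B) := I.isClosed

/-- The ideal as a C⋆-subalgebra. -/
def toSubalgebra : NonUnitalStarSubalgebra ℂ B where
  carrier := I.carrier
  add_mem' := I.add_mem'
  zero_mem' := I.zero_mem'
  smul_mem' := I.smul_mem'
  mul_mem' := fun {a _} _ hb => I.mul_mem_left a hb
  star_mem' := I.star_mem

instance : IsClosed (I.toSubalgebra : Set B) := I.isClosed

lemma exists_approx {y : B} (hy : y ∈ I.toSubmodule) {ε : ℝ} (hε : 0 < ε) :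
    ∃ u ∈ I.toSubmodule, ‖(1 - u : Unitization ℂ B)‖ ≤ 1 ∧ star u = u ∧ ‖y - y * u‖ < ε := by
  let : PartialOrder I.toSubalgebra := CStarAlgebra.spectralOrder _
  have : StarOrderedRing I.toSubalgebra := CStarAlgebra.spectralOrderedRing _
  let : PartialOrder (Unitization ℂ B) := CStarAlgebra.spectralOrder _
  have : StarOrderedRing (Unitization ℂ B) := CStarAlgebra.spectralOrderedRing _
  have hau := CStarAlgebra.increasingApproximateUnit I.toSubalgebra
  have := hau.neBot
  let y' : I.toSubalgebra := ⟨y, hy⟩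
  have h1 := (hau.tendsto_mul_left y').eventually (Metric.ball_mem_nhds y' hε)
  obtain ⟨u, hu1, hu2, hu3⟩ :=
    (h1.and (hau.eventually_nonneg.and hau.eventually_norm)).exists
  refine ⟨u, u.2, ?_, ?_, ?_⟩
  · obtain ⟨c, hc⟩ := CStarAlgebra.nonneg_iff_eq_star_mul_self.1 hu2
    have hn : (0 : Unitization ℂ B) ≤ ((u : B) : Unitization ℂ B) := by
      have : ((u : B) : Unitization ℂ B)
          = star ((c : B) : Unitization ℂ B) * ((c : B) : Unitization ℂ B) := by
        rw [hc]; simp [← Unitization.inr_star]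
      rw [this]; exact star_mul_self_nonneg _
    have hle : ((u : B) : Unitization ℂ B) ≤ 1 := by
      rw [← CStarAlgebra.norm_le_one_iff_of_nonneg _ hn, Unitization.norm_inr]
      exact hu3
    rw [CStarAlgebra.norm_le_one_iff_of_nonneg _ (sub_nonneg.2 hle)]
    exact sub_le_self _ hn
  · have := (IsSelfAdjoint.of_nonneg hu2).star_eq
    exact congrArg Subtype.val this
  · rw [← norm_neg, neg_sub]
    have := mem_ball_iff_norm.1 hu1
    exact this

end ClosedStarIdeal

namespace CStarQuotient

variable {B : Type*} [NonUnitalCStarAlgebra B] {I : ClosedStarIdeal B}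

instance : NormedAddCommGroup (CStarQuotient I) :=
  inferInstanceAs (NormedAddCommGroup (B ⧸ I.toSubmodule))
instance : NormedSpace ℂ (CStarQuotient I) :=
  inferInstanceAs (NormedSpace ℂ (B ⧸ I.toSubmodule))
instance : CompleteSpace (CStarQuotient I) :=
  inferInstanceAs (CompleteSpace (B ⧸ I.toSubmodule))

variable (I) in
/-- The class of `x` in `B / I`. -/
def mk (x : B) : CStarQuotient I := (Submodule.Quotient.mk x : B ⧸ I.toSubmodule)

lemma mk_surjective : Function.Surjective (mk I) := Submodule.Quotient.mk_surjective _
lemma mk_eq_mk {x y : B} : mk I x = mk I y ↔ x - y ∈ I.toSubmodule := Submodule.Quotient.eq _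
lemma mk_add (x y : B) : mk I (x + y) = mk I x + mk I y := rfl
lemma mk_zero : mk I 0 = 0 := rfl
lemma mk_smul (c : ℂ) (x : B) : mk I (c • x) = c • mk I x := rfl
lemma norm_mk_le (x : B) : ‖mk I x‖ ≤ ‖x‖ := Submodule.Quotient.norm_mk_le _ x
lemma exists_rep (x : CStarQuotient I) {ε : ℝ} (hε : 0 < ε) : ∃ b, mk I b = x ∧ ‖b‖ < ‖x‖ + ε :=
  Submodule.Quotient.norm_mk_lt x hε

instance : Mul (CStarQuotient I) where
  mul := Quotient.map₂ (· * ·) fun a b hab c d hcd => by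
    replace hab := (Submodule.quotientRel_def _).1 hab
    replace hcd := (Submodule.quotientRel_def _).1 hcd
    refine (Submodule.quotientRel_def _).2 ?_
    have : a * c - b * d = a * (c - d) + (a - b) * d := by
      rw [mul_sub, sub_mul]; abel
    rw [this]
    exact I.add_mem' (I.mul_mem_left a hcd) (I.mul_mem_right d hab)

instance : Star (CStarQuotient I) where
  star := Quotient.map star fun a b hab => by
    replace hab := (Submodule.quotientRel_def _).1 hab
    refine (Submodule.quotientRel_def _).2 ?_
    rw [← star_sub]
    exact I.star_mem hab

lemma mk_mul (x y : B) : mk I (x * y) = mk I x * mk I y := rfl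
lemma mk_star (x : B) : mk I (star x) = star (mk I x) := rfl

protected lemma norm_mul_le (x y : CStarQuotient I) : ‖x * y‖ ≤ ‖x‖ * ‖y‖ := by
  have h : ∀ ε > 0, ‖x * y‖ ≤ (‖x‖ + ε) * (‖y‖ + ε) := fun ε hε => by
    obtain ⟨a, rfl, ha⟩ := exists_rep x hε
    obtain ⟨b, rfl, hb⟩ := exists_rep y hε
    rw [← mk_mul]
    exact (norm_mk_le _).trans <| (norm_mul_le a b).trans <|
      mul_le_mul ha.le hb.le (norm_nonneg _) (by positivity)
  have hc : Tendsto (fun ε : ℝ => (‖x‖ + ε) * (‖y‖ + ε)) (𝓝[>] 0) (𝓝 (‖x‖ * ‖y‖)) := by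
    have : Continuous fun ε : ℝ => (‖x‖ + ε) * (‖y‖ + ε) := by fun_prop
    simpa using (this.tendsto 0).mono_left nhdsWithin_le_nhds
  exact ge_of_tendsto hc (eventually_nhdsWithin_of_forall h)

instance : NonUnitalNormedRing (CStarQuotient I) where
  __ : NormedAddCommGroup (CStarQuotient I) := inferInstance
  zero_mul x := by
    obtain ⟨a, rfl⟩ := mk_surjective x
    rw [← mk_zero, ← mk_mul, zero_mul]
  mul_zero x := by
    obtain ⟨a, rfl⟩ := mk_surjective x
    rw [← mk_zero, ← mk_mul, mul_zero]
  mul_assoc x y z := by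
    obtain ⟨a, rfl⟩ := mk_surjective x
    obtain ⟨b, rfl⟩ := mk_surjective y
    obtain ⟨c, rfl⟩ := mk_surjective z
    simp only [← mk_mul, mul_assoc]
  left_distrib x y z := by
    obtain ⟨a, rfl⟩ := mk_surjective x
    obtain ⟨b, rfl⟩ := mk_surjective y
    obtain ⟨c, rfl⟩ := mk_surjective z
    simp only [← mk_mul, ← mk_add, mul_add]
  right_distrib x y z := by
    obtain ⟨a, rfl⟩ := mk_surjective x
    obtain ⟨b, rfl⟩ := mk_surjective y
    obtain ⟨c, rfl⟩ := mk_surjective z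
    simp only [← mk_mul, ← mk_add, add_mul]
  norm_mul_le := CStarQuotient.norm_mul_le

instance : StarRing (CStarQuotient I) where
  star_involutive x := by
    obtain ⟨a, rfl⟩ := mk_surjective x
    simp only [← mk_star, star_star]
  star_add x y := by
    obtain ⟨a, rfl⟩ := mk_surjective x
    obtain ⟨b, rfl⟩ := mk_surjective y
    simp only [← mk_star, ← mk_add, star_add]
  star_mul x y := by
    obtain ⟨a, rfl⟩ := mk_surjective x
    obtain ⟨b, rfl⟩ := mk_surjective y
    simp only [← mk_star, ← mk_mul, star_mul]

protected lemma norm_mul_self_le (x : CStarQuotient I) : ‖x‖ * ‖x‖ ≤ ‖star x * x‖ := by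
  refine le_of_forall_pos_le_add fun ε hε => ?_
  obtain ⟨a, rfl⟩ := mk_surjective x
  obtain ⟨z, hz, hzn⟩ := exists_rep (star (mk I a) * mk I a) (half_pos hε)
  rw [← mk_star, ← mk_mul, mk_eq_mk] at hz
  obtain ⟨u, huI, hu1, hus, huy⟩ := I.exists_approx hz (half_pos hε)
  have h1 : ‖mk I a‖ ≤ ‖a - a * u‖ := by
    have : mk I a = mk I (a - a * u) := by
      rw [mk_eq_mk, sub_sub_cancel]
      exact I.mul_mem_left a huI
    rw [this]
    exact norm_mk_le _
  let v : Unitization ℂ B := 1 - (u : Unitization ℂ B)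
  have hv : star v = v := by simp [v, ← Unitization.inr_star, hus]
  have h2 : ((a - a * u : B) : Unitization ℂ B) = a * v := by simp [v, mul_sub]
  set w := z - star a * a with hw
  have h3 : ‖a - a * u‖ * ‖a - a * u‖ ≤ ‖z‖ + ‖w - w * u‖ := by
    have e1 : star (((a - a * u : B) : Unitization ℂ B)) * ((a - a * u : B) : Unitization ℂ B)
        = v * (z * v) - v * ((w - w * u : B) : Unitization ℂ B) := by
      have : ((w - w * u : B) : Unitization ℂ B) = w * v := by simp [v, mul_sub]
      rw [this, h2, star_mul, hv, hw]
      simp [mul_assoc, sub_mul, mul_sub]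
    rw [← Unitization.norm_inr (𝕜 := ℂ) (a - a * u), ← CStarRing.norm_star_mul_self, e1,
      ← Unitization.norm_inr (𝕜 := ℂ) z, ← Unitization.norm_inr (𝕜 := ℂ) (w - w * u)]
    refine (norm_sub_le _ _).trans (add_le_add ?_ ?_)
    · refine (norm_mul_le _ _).trans ?_
      refine (mul_le_mul hu1 (norm_mul_le _ _) (norm_nonneg _) zero_le_one).trans ?_
      rw [one_mul]
      exact mul_le_of_le_one_right (norm_nonneg _) hu1
    · refine (norm_mul_le _ _).trans ?_
      exact mul_le_of_le_one_left (norm_nonneg _) hu1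
  calc ‖mk I a‖ * ‖mk I a‖ ≤ ‖a - a * u‖ * ‖a - a * u‖ :=
        mul_self_le_mul_self (norm_nonneg _) h1
    _ ≤ ‖z‖ + ‖w - w * u‖ := h3
    _ ≤ ‖star (mk I a) * mk I a‖ + ε := by linarith

/-- The quotient is a C⋆-algebra. -/
instance : NonUnitalCStarAlgebra (CStarQuotient I) where
  norm_mul_self_le := CStarQuotient.norm_mul_self_le
  smul_assoc c x y := by
    obtain ⟨a, rfl⟩ := mk_surjective x
    obtain ⟨b, rfl⟩ := mk_surjective y
    simp only [smul_eq_mul, ← mk_smul, ← mk_mul, smul_mul_assoc]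
  smul_comm c x y := by
    obtain ⟨a, rfl⟩ := mk_surjective x
    obtain ⟨b, rfl⟩ := mk_surjective y
    simp only [smul_eq_mul, ← mk_smul, ← mk_mul, mul_smul_comm]
  star_smul c x := by
    obtain ⟨a, rfl⟩ := mk_surjective x
    simp only [← mk_smul, ← mk_star, star_smul]

variable (I) in
/-- The quotient map as a ⋆-homomorphism. -/
def mkHom : B →⋆ₙₐ[ℂ] CStarQuotient I where
  toFun := mk I
  map_smul' _ _ := rfl
  map_zero' := rfl
  map_add' _ _ := rfl
  map_mul' _ _ := rfl
  map_star' _ := rfl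

/-- The map of `B / I` induced by a ⋆-endomorphism of `B` that maps `I` to itself. -/
def map (φ : B →⋆ₙₐ[ℂ] B) (h : ∀ x ∈ I.toSubmodule, φ x ∈ I.toSubmodule) :
    CStarQuotient I →⋆ₙₐ[ℂ] CStarQuotient I where
  toFun := Quotient.map φ fun a b hab => by
    replace hab := (Submodule.quotientRel_def _).1 hab
    refine (Submodule.quotientRel_def _).2 ?_
    rw [← map_sub]
    exact h _ hab
  map_smul' c x := by
    obtain ⟨a, rfl⟩ := mk_surjective x
    exact congrArg (mk I) (map_smul φ c a)
  map_zero' := congrArg (mk I) (map_zero φ)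
  map_add' x y := by
    obtain ⟨a, rfl⟩ := mk_surjective x
    obtain ⟨b, rfl⟩ := mk_surjective y
    exact congrArg (mk I) (map_add φ a b)
  map_mul' x y := by
    obtain ⟨a, rfl⟩ := mk_surjective x
    obtain ⟨b, rfl⟩ := mk_surjective y
    exact congrArg (mk I) (map_mul φ a b)
  map_star' x := by
    obtain ⟨a, rfl⟩ := mk_surjective x
    exact congrArg (mk I) (map_star φ a)

lemma map_mk (φ : B →⋆ₙₐ[ℂ] B) (h : ∀ x ∈ I.toSubmodule, φ x ∈ I.toSubmodule) (x : B) :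
    map φ h (mk I x) = mk I (φ x) := rfl

end CStarQuotient

section SequenceAlgebra

variable (A : Type*) [NonUnitalCStarAlgebra A]

/-- The ideal of bounded sequences in `A` that converge to zero in norm. -/
def nullSequences : ClosedStarIdeal (lp (fun _ : ℕ => A) ∞) where
  carrier := {x | Tendsto (fun n => ‖x n‖) atTop (𝓝 0)}
  add_mem' {x y} hx hy := by
    simp only [Set.mem_ofPred_eq, ← tendsto_zero_iff_norm_tendsto_zero] at *
    simpa using! hx.add hy
  zero_mem' := by simp
  smul_mem' c x hx := by
    simp only [Set.mem_ofPred_eq, ← tendsto_zero_iff_norm_tendsto_zero] at *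
    simpa using! hx.const_smul c
  mul_mem_left b x hx := by
    refine squeeze_zero (fun _ => norm_nonneg _) (fun n => ?_)
      (by simpa using Tendsto.const_mul ‖b‖ hx)
    exact (norm_mul_le (b n) (x n)).trans
      (mul_le_mul_of_nonneg_right (lp.norm_apply_le_norm ENNReal.top_ne_zero b n) (norm_nonneg _))
  mul_mem_right b x hx := by
    refine squeeze_zero (fun _ => norm_nonneg _) (fun n => ?_)
      (by simpa using Tendsto.mul_const ‖b‖ hx)
    exact (norm_mul_le (x n) (b n)).trans
      (mul_le_mul_of_nonneg_left (lp.norm_apply_le_norm ENNReal.top_ne_zero b n) (norm_nonneg _))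
  star_mem {x} hx := by simpa using hx
  isClosed := by
    refine isClosed_of_closure_subset fun x hx => ?_
    rw [Set.mem_ofPred_eq, Metric.tendsto_atTop]
    intro ε hε
    obtain ⟨y, hy, hxy⟩ := Metric.mem_closure_iff.1 hx (ε / 2) (half_pos hε)
    obtain ⟨N, hN⟩ := (Metric.tendsto_atTop.1 hy) (ε / 2) (half_pos hε)
    refine ⟨N, fun n hn => ?_⟩
    have h1 : ‖y n‖ < ε / 2 := by simpa using hN n hn
    have h2 : ‖x n - y n‖ < ε / 2 :=
      (lp.norm_apply_le_norm ENNReal.top_ne_zero (x - y) n).trans_lt (by rwa [← dist_eq_norm])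
    have h3 : ‖x n‖ ≤ ‖x n - y n‖ + ‖y n‖ := by
      simpa using norm_add_le (x n - y n) (y n)
    simp only [dist_zero_right, norm_norm]
    linarith

/-- The sequence algebra `A_∞ = ℓ^∞(ℕ, A) / c_0(ℕ, A)`. -/
abbrev SequenceAlgebra : Type _ := CStarQuotient (nullSequences A)

variable {A}

/-- The constant sequence with value `a`. -/
def constSeq (a : A) : lp (fun _ : ℕ => A) ∞ :=
  ⟨fun _ => a, memℓp_infty ⟨‖a‖, by rintro _ ⟨n, rfl⟩; exact le_rfl⟩⟩

variable (A) in
/-- The canonical embedding of `A` into `A_∞` by constant sequences. -/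
def seqEmbed : A →⋆ₙₐ[ℂ] SequenceAlgebra A where
  toFun a := CStarQuotient.mk _ (constSeq a)
  map_smul' _ _ := rfl
  map_zero' := rfl
  map_add' _ _ := rfl
  map_mul' _ _ := rfl
  map_star' _ := rfl

/-- Componentwise application of a ⋆-homomorphism to bounded sequences. -/
def seqMap (φ : A →⋆ₙₐ[ℂ] A) : lp (fun _ : ℕ => A) ∞ →⋆ₙₐ[ℂ] lp (fun _ : ℕ => A) ∞ where
  toFun x := ⟨fun n => φ (x n), memℓp_infty ⟨‖x‖, by
    rintro _ ⟨n, rfl⟩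
    exact (NonUnitalStarAlgHom.norm_apply_le φ (x n)).trans
      (lp.norm_apply_le_norm ENNReal.top_ne_zero x n)⟩⟩
  map_smul' c x := by ext n; exact map_smul φ c (x n)
  map_zero' := by ext n; exact map_zero φ
  map_add' x y := by ext n; exact map_add φ (x n) (y n)
  map_mul' x y := by ext n; exact map_mul φ (x n) (y n)
  map_star' x := by ext n; exact map_star φ (x n)

/-- The ⋆-endomorphism of `A_∞` given by componentwise application of `φ`. -/
def seqAlgMap (φ : A →⋆ₙₐ[ℂ] A) : SequenceAlgebra A →⋆ₙₐ[ℂ] SequenceAlgebra A :=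
  CStarQuotient.map (seqMap φ) fun x hx =>
    squeeze_zero (fun _ => norm_nonneg _)
      (fun n => NonUnitalStarAlgHom.norm_apply_le φ (x n)) hx

lemma seqAlgMap_seqEmbed (φ : A →⋆ₙₐ[ℂ] A) (a : A) :
    seqAlgMap φ (seqEmbed A a) = seqEmbed A (φ a) := rfl

variable (A) in
/-- The relative commutant `A_∞ ∩ A'`. -/
def relCommutant : NonUnitalStarSubalgebra ℂ (SequenceAlgebra A) :=
  NonUnitalStarSubalgebra.centralizer ℂ (Set.range (seqEmbed A))

lemma mem_relCommutant {x : SequenceAlgebra A} :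
    x ∈ relCommutant A ↔ ∀ a, seqEmbed A a * x = x * seqEmbed A a := by
  rw [relCommutant, NonUnitalStarSubalgebra.mem_centralizer_iff]
  refine ⟨fun h a => (h _ ⟨a, rfl⟩).1, ?_⟩
  rintro h _ ⟨a, rfl⟩
  exact ⟨h a, by rw [← map_star]; exact h _⟩

instance : IsClosed (relCommutant A : Set (SequenceAlgebra A)) := by
  have : (relCommutant A : Set (SequenceAlgebra A))
      = ⋂ a, {x | seqEmbed A a * x = x * seqEmbed A a} := by
    ext x; simp [mem_relCommutant]
  rw [this]
  exact isClosed_iInter fun a => isClosed_eq (continuous_const.fun_mul continuous_id)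
    (continuous_id.fun_mul continuous_const)

variable (A) in
/-- The annihilator `ann(A, A_∞) = {x | x a = a x = 0 for all a ∈ A}`, as an ideal of
`A_∞ ∩ A'`. -/
def annihilator : ClosedStarIdeal (relCommutant A) where
  carrier := {x | ∀ a, (x : SequenceAlgebra A) * seqEmbed A a = 0 ∧
    seqEmbed A a * (x : SequenceAlgebra A) = 0}
  add_mem' {x y} hx hy a := by simp [add_mul, mul_add, hx a, hy a]
  zero_mem' a := by simp
  smul_mem' c x hx a := by
    have h := hx a
    exact ⟨by simp [smul_mul_assoc, h.1], by simp [mul_smul_comm, h.2]⟩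
  mul_mem_left b x hx a := by
    refine ⟨?_, ?_⟩
    · simp [mul_assoc, (hx a).1]
    · have := mem_relCommutant.1 b.2 a
      simp [← mul_assoc, this]
      simp [mul_assoc, (hx a).2]
  mul_mem_right b x hx a := by
    refine ⟨?_, ?_⟩
    · have := mem_relCommutant.1 b.2 a
      simp [mul_assoc, ← this]
      simp [← mul_assoc, (hx a).1]
    · simp [← mul_assoc, (hx a).2]
  star_mem {x} hx a := by
    have h := hx (star a)
    rw [map_star] at h
    refine ⟨?_, ?_⟩
    · simpa using congrArg star h.2
    · simpa using congrArg star h.1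
  isClosed := by
    simp only [Set.ofPred_forall, Set.ofPred_and]
    exact isClosed_iInter fun a =>
      (isClosed_eq (continuous_subtype_val.fun_mul continuous_const) continuous_const).inter
        (isClosed_eq (continuous_const.fun_mul continuous_subtype_val) continuous_const)

variable (A) in
/-- Kirchberg's central sequence algebra `F_∞(A) = (A_∞ ∩ A') / ann(A, A_∞)`. -/
abbrev CentralSequenceAlgebra : Type _ := CStarQuotient (annihilator A)

/-- The restriction to `A_∞ ∩ A'` of the automorphism of `A_∞` induced by an automorphism of
`A`. -/
def relCommutantMap (φ : A ≃⋆ₐ[ℂ] A) : relCommutant A →⋆ₙₐ[ℂ] relCommutant A where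
  toFun x := ⟨seqAlgMap (φ : A →⋆ₙₐ[ℂ] A) x, mem_relCommutant.2 fun a => by
    have ha : seqEmbed A a = seqAlgMap (φ : A →⋆ₙₐ[ℂ] A) (seqEmbed A (φ.symm a)) := by
      rw [seqAlgMap_seqEmbed]; simp
    rw [ha, ← map_mul, ← map_mul, mem_relCommutant.1 x.2]⟩
  map_smul' c x := Subtype.ext (map_smul _ c (x : SequenceAlgebra A))
  map_zero' := Subtype.ext (map_zero _)
  map_add' x y := Subtype.ext (map_add _ (x : SequenceAlgebra A) y)
  map_mul' x y := Subtype.ext (map_mul _ (x : SequenceAlgebra A) y)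
  map_star' x := Subtype.ext (map_star _ (x : SequenceAlgebra A))

/-- The ⋆-endomorphism of `F_∞(A)` induced by an automorphism of `A`. -/
def centralMap (φ : A ≃⋆ₐ[ℂ] A) : CentralSequenceAlgebra A →⋆ₙₐ[ℂ] CentralSequenceAlgebra A :=
  CStarQuotient.map (relCommutantMap φ) fun x hx a => by
    have ha : seqEmbed A a = seqAlgMap (φ : A →⋆ₙₐ[ℂ] A) (seqEmbed A (φ.symm a)) := by
      rw [seqAlgMap_seqEmbed]; simp
    have h := hx (φ.symm a)
    refine ⟨?_, ?_⟩
    · change seqAlgMap (φ : A →⋆ₙₐ[ℂ] A) x * _ = 0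
      rw [ha, ← map_mul, h.1, map_zero]
    · change _ * seqAlgMap (φ : A →⋆ₙₐ[ℂ] A) x = 0
      rw [ha, ← map_mul, h.2, map_zero]

end SequenceAlgebra

section Rokhlin

variable {G A : Type*} [Group G] [TopologicalSpace G] [NonUnitalCStarAlgebra A]

/-- `F_{∞,α}(A)`: the elements of `F_∞(A)` on which the induced action is norm continuous. -/
def continuousCentral (α : CStarAction G A) :
    NonUnitalStarSubalgebra ℂ (CentralSequenceAlgebra A) where
  carrier := {x | Continuous fun g => centralMap (α g) x}
  add_mem' {x y} hx hy := by simpa using Continuous.fun_add hx hy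
  zero_mem' := by simpa using continuous_const
  smul_mem' c x hx := by simpa using Continuous.fun_const_smul hx c
  mul_mem' {x y} hx hy := by simpa using Continuous.fun_mul hx hy
  star_mem' {x} hx := by simpa [map_star] using Continuous.star hx

/-- The shift on `C(G)`: `σ_g(f)(h) = f(g⁻¹ h)`. -/
def groupShift [IsTopologicalGroup G] (g : G) (f : C(G, ℂ)) : C(G, ℂ) :=
  ⟨fun h => f (g⁻¹ * h), f.continuous.comp (continuous_const.fun_mul continuous_id)⟩

/-- The Rokhlin property for an action of a compact group: there is a unital equivariant
⋆-homomorphism from `C(G)` to `F_{∞,α}(A)`. -/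
def HasRokhlinProperty [IsTopologicalGroup G] [CompactSpace G] (α : CStarAction G A) : Prop :=
  ∃ φ : C(G, ℂ) →⋆ₙₐ[ℂ] continuousCentral α,
    (∀ x : continuousCentral α, φ 1 * x = x ∧ x * φ 1 = x) ∧
    ∀ (g : G) (f : C(G, ℂ)),
      (φ (groupShift g f) : CentralSequenceAlgebra A) = centralMap (α g) (φ f)

end Rokhlin

/-- Approximate representability of an action of a discrete group on a C⋆-algebra. -/
def IsApproximatelyRepresentable {H A : Type*} [Group H] [NonUnitalCStarAlgebra A]
    (α : H →* (A ≃⋆ₐ[ℂ] A)) : Prop :=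
  ∃ x : ℕ → H → A, (∀ n h, ‖x n h‖ ≤ 1) ∧
    (∀ h, (Filter.map (fun n => x n h * star (x n h)) atTop).IsApproximateUnit ∧
      (Filter.map (fun n => star (x n h) * x n h) atTop).IsApproximateUnit) ∧
    (∀ g h a, Tendsto (fun n => ‖a * (x n g * x n h - x n (g * h))‖ +
      ‖(x n g * x n h - x n (g * h)) * a‖) atTop (𝓝 0)) ∧
    (∀ a h, Tendsto (fun n => ‖α h a - x n h * a * star (x n h)‖) atTop (𝓝 0)) ∧
    (∀ g h a, Tendsto (fun n => ‖a * (x n (g * h * g⁻¹) - α g (x n h))‖ +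
      ‖(x n (g * h * g⁻¹) - α g (x n h)) * a‖) atTop (𝓝 0))

end

/-! Both notions in the theorem are rewritten as asymptotic relations between bounded sequences,
tested against one fixed element of the algebra at a time, and indexed by the same discrete group.
The theorem is then a dictionary between the two systems of relations.

The characters span a dense subspace of C(G). Hence a unital equivariant homomorphism from C(G) to
the central sequence algebra is the same as a multiplicative family of unitaries w_χ there with
α_g(w_χ) = conj(χ(g)) w_χ. Lifting to contractive representatives gives `IsRokhlin`. Approximate
representability reduces in the same way to `IsImplementing`: contractions x_h, asymptotically
multiplicative, isometric and invariant, with x_h a ≈ α_h(a) x_h.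

Part (ii). If x_h implements β_h, then x_h u_h⁻¹ asymptotically commutes with every a u_k in the
crossed product, and the dual action multiplies it by conj(χ(h)). Conversely, given a Rokhlin family
w_h for the dual action, averaging over the compact dual group projects w_h onto its component of
degree h⁻¹. By equivariance and dominated convergence this does not change the asymptotic multiplier
that w_h defines. The component is x_h u_h⁻¹ with x_h in A, and comparing coefficients gives the
relations for x_h.

Part (i). If v_χ is a Rokhlin family for α, then v_χ, acting on functions through their values,
satisfies v_χ g ≈ α̂_χ(g) v_χ. Cutting down by an approximate unit f_n made of functions puts v_χ
f_n into the crossed product. Conversely, an element of the crossed product has a matrix over the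
decomposition of L²(G, A) into isotypic components, with indices in the dual group and entries in
spectral subspaces of A. Asymptotic invariance of x_χ under the dual action makes its matrix
asymptotically constant along diagonals, and an entry at (χθ, θ) is exactly of spectral type χ. This
entry, normalised, is the Rokhlin family. The function s ↦ θ(s) b with b spectral behaves like b
times a matrix unit, so each relation for x_χ becomes a relation between single entries and no
infinite matrix product occurs. Spectral elements span a dense subspace of A, so testing on them
suffices.

Three analytic facts carry this. The regular representation gives an admissible C⋆-seminorm, so its
matrix coefficients are bounded by the universal norm (`ConvAlg.norm_mul_mul_star_apply_one_le`);
amenability is not needed. Left multiplication by an element of A is bounded for the universal norm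
(`ConvAlg.norm_lmul_le`). Finally, `isDualPairing_id` is Pontryagin duality for a compact group:
point separation comes from Gelfand theory of the commutative C⋆-algebra of G, surjectivity from a
comparison of Haar measures. -/

noncomputable section

/-! ### Inverses in an action; the coefficient algebra acting on C_c(G, A) -/

namespace CStarAction

variable {G A : Type*} [Group G] [TopologicalSpace G] [NonUnitalCStarAlgebra A]
  (α : CStarAction G A)

lemma apply_inv_apply (g : G) (a : A) : α g (α g⁻¹ a) = a := by
  rw [← mul_apply, mul_inv_cancel, one_apply]

lemma inv_apply_apply (g : G) (a : A) : α g⁻¹ (α g a) = a := by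
  rw [← mul_apply, inv_mul_cancel, one_apply]

end CStarAction

namespace ConvAlg

variable {G A : Type*} [CommGroup G] [TopologicalSpace G] [MeasurableSpace G]
  [NonUnitalCStarAlgebra A] {α : CStarAction G A} {μ : Measure G}
  [IsTopologicalGroup G] [BorelSpace G]

/-- Left multiplication of a function by an element of the coefficient algebra. -/
def lmul (a : A) (f : ConvAlg α μ) : ConvAlg α μ :=
  mk (fun s => a * f s) (continuous_const.mul f.continuous) f.hasCompactSupport.mul_left

/-- Right multiplication of a function by an element of the coefficient algebra, as in the
multiplier algebra of the crossed product: `(f · a)(s) = f(s) α_s(a)`. -/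
def rmul (f : ConvAlg α μ) (a : A) : ConvAlg α μ :=
  mk (fun s => f s * α s a) (f.continuous.mul (α.continuous_apply a)) f.hasCompactSupport.mul_right

@[simp] lemma lmul_apply (a : A) (f : ConvAlg α μ) (s : G) : lmul a f s = a * f s := rfl
@[simp] lemma rmul_apply (f : ConvAlg α μ) (a : A) (s : G) : rmul f a s = f s * α s a := rfl

lemma lmul_lmul (a b : A) (f : ConvAlg α μ) : lmul a (lmul b f) = lmul (a * b) f := by
  ext s; simp [mul_assoc]

lemma lmul_sub (a : A) (f g : ConvAlg α μ) : lmul a (f - g) = lmul a f - lmul a g := by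
  ext s; simp [mul_sub]

lemma star_lmul (a : A) (f : ConvAlg α μ) : star (lmul a f) = rmul (star f) (star a) := by
  ext s; simp [star_apply]

section Mul

variable [IsFiniteMeasureOnCompacts μ]

lemma lmul_mul (a : A) (f g : ConvAlg α μ) : lmul a f * g = lmul a (f * g) := by
  ext s
  simp only [mul_apply, lmul_apply]
  rw [← integral_const_mul_of_integrable (integrand_integrable f g s)]
  simp only [mul_assoc]

/-- This is the double centralizer identity: `lmul` and `rmul` are the two halves of the multiplier
that `a` defines. -/
lemma mul_lmul (a : A) (f g : ConvAlg α μ) : f * lmul a g = rmul f a * g := by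
  ext s
  simp only [mul_apply, lmul_apply, rmul_apply, map_mul, mul_assoc]

lemma mul_star_apply_one (f g : ConvAlg α μ) : (g * star f) 1 = ∫ t, g t * star (f t) ∂μ := by
  rw [mul_apply]
  refine integral_congr_ae (Eventually.of_forall fun t => ?_)
  simp only [star_apply, mul_one, inv_inv, CStarAction.apply_inv_apply]

end Mul

lemma integrable_mul_star [IsFiniteMeasureOnCompacts μ] (f g : ConvAlg α μ) :
    Integrable (fun t => g t * star (f t)) μ :=
  (g.continuous.mul f.continuous.star).integrable_of_hasCompactSupport
    g.hasCompactSupport.mul_right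

lemma integrable_norm [IsFiniteMeasureOnCompacts μ] (f : ConvAlg α μ) :
    Integrable (fun t => ‖f t‖) μ :=
  (f.continuous.integrable_of_hasCompactSupport f.hasCompactSupport).norm

end ConvAlg

/-! ### The regular representation and its seminorm -/

/-- The functions in `C_c(G, A)`, regarded as a pre-Hilbert module over `A` for the inner product
`⟨f, g⟩ = ∫ g(t) f(t)⋆ dt`. -/
def RegularModule {G A : Type*} [Group G] [TopologicalSpace G] [MeasurableSpace G]
    [NonUnitalCStarAlgebra A] (α : CStarAction G A) (μ : Measure G) : Type _ := ConvAlg α μ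

namespace RegularModule

open ConvAlg

variable {G A : Type*} [CommGroup G] [TopologicalSpace G] [MeasurableSpace G]
  [NonUnitalCStarAlgebra A] {α : CStarAction G A} {μ : Measure G}
  [IsTopologicalGroup G] [BorelSpace G] [μ.IsHaarMeasure]

instance : AddCommGroup (RegularModule α μ) := inferInstanceAs (AddCommGroup (ConvAlg α μ))
instance : Module ℂ (RegularModule α μ) := inferInstanceAs (Module ℂ (ConvAlg α μ))
instance : SMul A (RegularModule α μ) := ⟨fun a f => lmul a (show ConvAlg α μ from f)⟩
instance : Inner A (RegularModule α μ) :=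
  ⟨fun f g => ((show ConvAlg α μ from g) * star (show ConvAlg α μ from f) : ConvAlg α μ) 1⟩
instance : Norm (RegularModule α μ) := CStarModule.norm A

/-- The identity map from `ConvAlg α μ`. -/
def of (f : ConvAlg α μ) : RegularModule α μ := f

lemma inner_of (f g : ConvAlg α μ) : inner A (of f) (of g) = (g * star f) 1 := rfl

section Order

variable [PartialOrder A] [StarOrderedRing A]

/-- A nonnegative continuous integrand with zero integral has zero integral over every measurable
set. Near a point where its value c is nonzero it stays within ‖c‖ / 2 of c, and its integral over
that neighbourhood could not vanish. -/
lemma eq_zero_of_integral_mul_star (f : ConvAlg α μ) (h : ∫ t, f t * star (f t) ∂μ = 0) :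
    f = 0 := by
  ext t₀
  by_contra ht
  set c := f t₀ * star (f t₀) with hc
  have hc0 : 0 < ‖c‖ := norm_pos_iff.2 fun h0 => ht (CStarRing.mul_star_self_eq_zero_iff _ |>.1 h0)
  have hcont : Continuous fun t => f t * star (f t) := f.continuous.mul f.continuous.star
  let U := {t | ‖f t * star (f t) - c‖ < ‖c‖ / 2}
  have hU : IsOpen U := isOpen_lt (hcont.sub continuous_const).norm continuous_const
  have hUf : μ U < ∞ := by
    refine (measure_mono ?_).trans_lt f.hasCompactSupport.isCompact.measure_lt_top
    intro t htU
    by_contra hn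
    have : ‖c‖ < ‖c‖ / 2 := by simpa [U, apply_eq_zero hn] using htU
    linarith
  have hUpos : 0 < μ.real U := by
    refine ENNReal.toReal_pos (hU.measure_pos μ ⟨t₀, ?_⟩).ne' hUf.ne
    simpa [U, ← hc] using hc0
  have hint := integrable_mul_star f f
  have hpos : ∀ s : Set G, 0 ≤ ∫ t in s, f t * star (f t) ∂μ := fun s =>
    integral_nonneg fun t => mul_star_self_nonneg _
  have h0 : ∫ t in U, f t * star (f t) ∂μ = 0 := by
    rw [← integral_add_compl hU.measurableSet hint] at h
    exact ((add_eq_zero_iff_of_nonneg (hpos U) (hpos Uᶜ)).1 h).1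
  have h1 : ∫ t in U, (f t * star (f t) - c) ∂μ = - (μ.real U • c) := by
    rw [integral_sub hint.integrableOn (integrableOn_const hUf.ne), h0, setIntegral_const, zero_sub]
  have h2 := norm_setIntegral_le_of_norm_le_const (f := fun t => f t * star (f t) - c) hUf
    (C := ‖c‖ / 2) (fun t ht => le_of_lt ht)
  rw [h1, norm_neg, norm_smul, Real.norm_of_nonneg hUpos.le] at h2
  nlinarith

/-- The inner product is (g ∗ f⋆)(1), so the algebraic axioms are identities of the convolution
algebra evaluated at 1. Only positivity and definiteness use the integral form. -/
instance instCStarModule : CStarModule A (RegularModule α μ) where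
  inner_add_right {f g h} := by
    change (((show ConvAlg α μ from g) + (show ConvAlg α μ from h)) *
      star (show ConvAlg α μ from f) : ConvAlg α μ) 1 = _
    rw [add_mul]; rfl
  inner_self_nonneg {f} := by
    change 0 ≤ ((show ConvAlg α μ from f) * star (show ConvAlg α μ from f) : ConvAlg α μ) 1
    rw [mul_star_apply_one]
    exact integral_nonneg fun t => mul_star_self_nonneg _
  inner_self {f} := by
    refine ⟨fun h => ?_, ?_⟩
    · change ((show ConvAlg α μ from f) * star (show ConvAlg α μ from f) : ConvAlg α μ) 1 = 0 at h
      rw [mul_star_apply_one] at h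
      exact eq_zero_of_integral_mul_star _ h
    · rintro rfl
      change ((0 : ConvAlg α μ) * star (0 : ConvAlg α μ)) 1 = 0
      rw [zero_mul]; rfl
  inner_op_smul_right {a f g} := by
    change ((lmul a (show ConvAlg α μ from g)) * star (show ConvAlg α μ from f) : ConvAlg α μ) 1 = _
    rw [lmul_mul]; rfl
  inner_smul_right_complex {z f g} := by
    change ((z • (show ConvAlg α μ from g)) * star (show ConvAlg α μ from f) : ConvAlg α μ) 1 = _
    rw [smul_mul_assoc]; rfl
  star_inner f g := by
    have h : ∀ k : ConvAlg α μ, star (k 1) = (star k) 1 := fun k => by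
      simp [star_apply]
    change star (((show ConvAlg α μ from g) * star (show ConvAlg α μ from f) : ConvAlg α μ) 1) =
      ((show ConvAlg α μ from f) * star (show ConvAlg α μ from g) : ConvAlg α μ) 1
    rw [h, star_mul, star_star]
  norm_eq_sqrt_norm_inner_self _ := rfl

/-- The norm of the pre-Hilbert module. -/
instance : NormedAddCommGroup (RegularModule α μ) := CStarModule.normedAddCommGroup A
instance : NormedSpace ℂ (RegularModule α μ) := .ofCore (CStarModule.normedSpaceCore A)

lemma norm_of_sq (f : ConvAlg α μ) : ‖of f‖ ^ 2 = ‖∫ t, f t * star (f t) ∂μ‖ := by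
  rw [← mul_star_apply_one, ← inner_of]
  exact CStarModule.norm_sq_eq A

/-- Multiplying pointwise on the right by a function bounded by `c` is an operator of norm at most
`c`. -/
lemma norm_of_le_of_apply_eq {f g : ConvAlg α μ} {c : ℝ} (hc : 0 ≤ c) {u : G → A}
    (hu : ∀ t, ‖u t‖ ≤ c) (hfg : ∀ t, f t = g t * u t) : ‖of f‖ ≤ c * ‖of g‖ := by
  refine le_of_sq_le_sq ?_ (by positivity)
  rw [mul_pow, norm_of_sq, norm_of_sq, ← Real.norm_of_nonneg (sq_nonneg c), ← norm_smul]
  refine CStarAlgebra.norm_le_norm_of_nonneg_of_le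
    (integral_nonneg fun t => mul_star_self_nonneg _) ?_
  rw [← integral_smul]
  refine integral_mono (integrable_mul_star f f) ((integrable_mul_star g g).smul _) fun t => ?_
  have h1 : f t * star (f t) = g t * (u t * star (u t)) * star (g t) := by
    rw [hfg, star_mul]; simp only [mul_assoc]
  dsimp only
  rw [h1]
  -- Conjugation is monotone: g (u u⋆) g⋆ ≤ ‖u u⋆‖ g g⋆.
  refine le_trans CStarAlgebra.star_right_conjugate_le_norm_smul ?_
  refine smul_le_smul_of_nonneg_right ?_ (mul_star_self_nonneg _)
  rw [CStarRing.norm_self_mul_star, sq]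
  exact mul_self_le_mul_self (norm_nonneg _) (hu t)

/-- Right translation of a function. -/
def translate (s : G) (f : ConvAlg α μ) : ConvAlg α μ :=
  ConvAlg.mk (fun t => f (t * s)) (f.continuous.comp (continuous_mul_const s))
    (f.hasCompactSupport.comp_homeomorph (Homeomorph.mulRight s))

lemma norm_translate (s : G) (f : ConvAlg α μ) : ‖of (translate s f)‖ = ‖of f‖ := by
  refine (sq_eq_sq₀ (norm_nonneg _) (norm_nonneg _)).1 ?_
  rw [norm_of_sq, norm_of_sq]
  congr 1
  exact integral_mul_right_eq_self (fun t => f t * star (f t)) s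

/-- Morally g ∗ f is the integral over s of translates of g · f(s), each of norm at most ‖f(s)‖ ‖g‖.
The module is not complete, so the integral is taken after pairing with a vector k, where it has
values in A. -/
lemma norm_mul_le_integral (f g : ConvAlg α μ) : ‖of (g * f)‖ ≤ (∫ s, ‖f s‖ ∂μ) * ‖of g‖ := by
  have key : ∀ k : ConvAlg α μ,
      ‖inner A (of k) (of (g * f))‖ ≤ ‖of k‖ * ((∫ s, ‖f s‖ ∂μ) * ‖of g‖) := fun k => by
    have e : inner A (of k) (of (g * f))
        = ∫ s, inner A (of (translate s k)) (of (rmul g (f s))) ∂μ := by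
      simp only [inner_of, mul_star_apply_one]
      have e1 : ∀ s, (g * f) s * star (k s)
          = ∫ t, g t * α t (f (t⁻¹ * s)) * star (k s) ∂μ := fun s =>
        (integral_mul_const_of_integrable (integrand_integrable g f s)).symm
      simp only [e1]
      rw [integral_integral_swap_of_hasCompactSupport]
      · rw [integral_integral_swap_of_hasCompactSupport (f := fun s t =>
          rmul g (f s) t * star (translate s k t))]
        · refine integral_congr_ae (Eventually.of_forall fun t => ?_)
          dsimp only
          rw [← integral_mul_left_eq_self _ t]
          simp only [inv_mul_cancel_left]
          rfl
        · exact (((g.continuous.comp continuous_snd).mul (α.continuous_comp continuous_snd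
            (f.continuous.comp continuous_fst))).mul (k.continuous.comp
              (continuous_snd.mul continuous_fst)).star)
        · refine HasCompactSupport.intro
            (f.hasCompactSupport.isCompact.prod g.hasCompactSupport.isCompact) ?_
          rintro ⟨s, t⟩ hst
          by_cases hs : s ∈ tsupport f
          · have ht : t ∉ tsupport g := fun ht => hst ⟨hs, ht⟩
            simp [Function.uncurry, apply_eq_zero ht]
          · simp [Function.uncurry, apply_eq_zero hs]
      · exact (integrand_continuous g f).mul (k.continuous.comp continuous_fst).star
      · refine HasCompactSupport.intro
          (k.hasCompactSupport.isCompact.prod g.hasCompactSupport.isCompact) ?_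
        rintro ⟨s, t⟩ hst
        by_cases hs : s ∈ tsupport k
        · have ht : t ∉ tsupport g := fun ht => hst ⟨hs, ht⟩
          simp [Function.uncurry, apply_eq_zero ht]
        · simp [Function.uncurry, apply_eq_zero hs]
    rw [e]
    refine (norm_integral_le_integral_norm _).trans ?_
    have h : ∀ s, ‖inner A (of (translate s k)) (of (rmul g (f s)))‖
        ≤ ‖of k‖ * (‖f s‖ * ‖of g‖) := fun s => by
      refine (CStarModule.norm_inner_le (RegularModule α μ)).trans ?_
      rw [norm_translate]
      gcongr
      exact norm_of_le_of_apply_eq (norm_nonneg _) (u := fun t => α t (f s))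
        (fun t => (α.norm_apply t (f s)).le) fun t => rfl
    refine (integral_mono_of_nonneg (Eventually.of_forall fun s => norm_nonneg _) ?_
      (Eventually.of_forall h)).trans_eq ?_
    · exact ((integrable_norm f).mul_const _).const_mul _
    · rw [integral_const_mul, integral_mul_const]
  -- Testing against k = g ∗ f itself turns the weak estimate into the norm estimate.
  have h := key (g * f)
  rw [← CStarModule.norm_sq_eq A, sq] at h
  obtain h0 | h0 := (norm_nonneg (of (g * f))).eq_or_lt
  · rw [← h0]
    exact mul_nonneg (integral_nonneg fun _ => norm_nonneg _) (norm_nonneg _)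
  · exact le_of_mul_le_mul_left h h0

/-- Right convolution by `f` on the pre-Hilbert module. -/
def rightConv (f : ConvAlg α μ) : RegularModule α μ →L[ℂ] RegularModule α μ :=
  LinearMap.mkContinuous
    { toFun := fun g => of ((show ConvAlg α μ from g) * f)
      map_add' := fun g h => add_mul (show ConvAlg α μ from g) h f
      map_smul' := fun c g => smul_mul_assoc c (show ConvAlg α μ from g) f }
    (∫ s, ‖f s‖ ∂μ) fun g => norm_mul_le_integral f g

lemma rightConv_of (f g : ConvAlg α μ) : rightConv f (of g) = of (g * f) := rfl

/-- Right convolution by f⋆ is the adjoint of right convolution by f, so ⟨k f, k f⟩ = ⟨k, k f f⋆⟩,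
and Cauchy–Schwarz applies. -/
lemma norm_rightConv_sq_le (f : ConvAlg α μ) :
    ‖rightConv f‖ ^ 2 ≤ ‖rightConv (f * star f)‖ := by
  refine (Real.le_sqrt (norm_nonneg _) (norm_nonneg _)).1 ?_
  refine ContinuousLinearMap.opNorm_le_bound _ (Real.sqrt_nonneg _) fun g => ?_
  refine le_of_sq_le_sq ?_ (by positivity)
  rw [mul_pow, Real.sq_sqrt (norm_nonneg _)]
  have e : inner A (rightConv f g) (rightConv f g) = inner A g (rightConv (f * star f) g) := by
    let k : ConvAlg α μ := g
    change ((k * f) * star (k * f)) 1 = ((k * (f * star f)) * star k) 1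
    rw [star_mul]
    simp only [mul_assoc]
  rw [CStarModule.norm_sq_eq A, e]
  refine (CStarModule.norm_inner_le (RegularModule α μ)).trans ?_
  rw [mul_comm, sq, ← mul_assoc]
  gcongr
  exact ContinuousLinearMap.le_opNorm _ _

/-- Right convolution reverses products. The operator norm still gives a C⋆-seminorm, because
submultiplicativity and the C⋆-identity are symmetric under this reversal once the norm is known to
be star invariant. -/
lemma rightConv_mul (f g : ConvAlg α μ) :
    rightConv (f * g) = (rightConv g).comp (rightConv f) :=
  ContinuousLinearMap.ext fun h => (mul_assoc (show ConvAlg α μ from h) f g).symm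

/-- From ‖R_f‖² ≤ ‖R_{f f⋆}‖ ≤ ‖R_{f⋆}‖ ‖R_f‖ one cancels ‖R_f‖, then exchanges f and f⋆. -/
lemma norm_rightConv_star (f : ConvAlg α μ) : ‖rightConv (star f)‖ = ‖rightConv f‖ := by
  have key : ∀ f : ConvAlg α μ, ‖rightConv f‖ ≤ ‖rightConv (star f)‖ := fun f => by
    obtain h0 | h0 := (norm_nonneg (rightConv f)).eq_or_lt
    · rw [← h0]; exact norm_nonneg _
    · refine le_of_mul_le_mul_right ?_ h0
      rw [← sq]
      refine (norm_rightConv_sq_le f).trans ?_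
      rw [rightConv_mul]
      exact ContinuousLinearMap.opNorm_comp_le _ _
  refine le_antisymm ?_ (key f)
  simpa using key (star f)

variable (α μ) in
/-- The C⋆-seminorm of the regular representation. -/
def regularSeminorm : AdmissibleSeminorm α μ :=
  ⟨(normSeminorm ℂ (RegularModule α μ →L[ℂ] RegularModule α μ)).comp (σ₁₂ := RingHom.id ℂ)
    { toFun := rightConv
      map_add' := fun f g => ContinuousLinearMap.ext fun h =>
        mul_add (show ConvAlg α μ from h) f g
      map_smul' := fun c f => ContinuousLinearMap.ext fun h =>
        mul_smul_comm c (show ConvAlg α μ from h) f },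
    ⟨fun f g => by
        change ‖rightConv (f * g)‖ ≤ ‖rightConv f‖ * ‖rightConv g‖
        rw [rightConv_mul, mul_comm]
        exact ContinuousLinearMap.opNorm_comp_le _ _,
      fun f => by
        change ‖rightConv (star f * f)‖ = ‖rightConv f‖ ^ 2
        refine le_antisymm ?_ ?_
        · rw [rightConv_mul, sq]
          refine (ContinuousLinearMap.opNorm_comp_le _ _).trans ?_
          rw [norm_rightConv_star]
        · simpa [norm_rightConv_star] using norm_rightConv_sq_le (star f)⟩,
    fun f => by
      change ‖rightConv f‖ ≤ _
      exact LinearMap.mkContinuous_norm_le _ (integral_nonneg fun _ => norm_nonneg _) _⟩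

lemma norm_rightConv_le (f : ConvAlg α μ) : ‖rightConv f‖ ≤ ‖f‖ :=
  le_universalNorm (regularSeminorm α μ) f

end Order

end RegularModule

namespace ConvAlg

variable {G A : Type*} [CommGroup G] [TopologicalSpace G] [MeasurableSpace G]
  [NonUnitalCStarAlgebra A] {α : CStarAction G A} {μ : Measure G}
  [IsTopologicalGroup G] [BorelSpace G] [μ.IsHaarMeasure]

/-- The matrix coefficients of the regular representation are bounded by the universal norm. -/
theorem norm_mul_mul_star_apply_one_le (k f g : ConvAlg α μ) :
    ‖(k * f * star g) 1‖
      ≤ √‖∫ t, k t * star (k t) ∂μ‖ * ‖f‖ * √‖∫ t, g t * star (g t) ∂μ‖ := by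
  let : PartialOrder A := CStarAlgebra.spectralOrder _
  have : StarOrderedRing A := CStarAlgebra.spectralOrderedRing _
  rw [← RegularModule.norm_of_sq, ← RegularModule.norm_of_sq, Real.sqrt_sq (norm_nonneg _),
    Real.sqrt_sq (norm_nonneg _), ← RegularModule.inner_of, ← RegularModule.rightConv_of]
  refine (CStarModule.norm_inner_le (RegularModule α μ)).trans ?_
  rw [mul_comm]
  gcongr
  refine (ContinuousLinearMap.le_opNorm _ _).trans ?_
  rw [mul_comm]
  gcongr
  exact RegularModule.norm_rightConv_le f

/-- The regular representation is faithful on C_c(G, A): a null f satisfies ⟨k f, k f⟩ = 0 for every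
k, hence k f = 0. The choice k = f⋆ gives ⟨f⋆, f⋆⟩ = 0. -/
lemma eq_zero_of_norm_eq_zero {f : ConvAlg α μ} (hf : ‖f‖ = 0) : f = 0 := by
  let : PartialOrder A := CStarAlgebra.spectralOrder _
  have : StarOrderedRing A := CStarAlgebra.spectralOrderedRing _
  have h : ∀ k : ConvAlg α μ, k * f = 0 := fun k => by
    have h1 := norm_mul_mul_star_apply_one_le k f (k * f)
    rw [hf, mul_zero, zero_mul] at h1
    refine RegularModule.eq_zero_of_integral_mul_star _ ?_
    rw [← mul_star_apply_one]
    exact norm_le_zero_iff.1 h1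
  have h2 := h (star f)
  rw [← star_eq_zero]
  refine RegularModule.eq_zero_of_integral_mul_star _ ?_
  rw [← mul_star_apply_one, star_star, h2]
  rfl

end ConvAlg

namespace ConvAlg

variable {G A : Type*} [CommGroup G] [TopologicalSpace G] [MeasurableSpace G]
  [NonUnitalCStarAlgebra A] {α : CStarAction G A} {μ : Measure G}
  [IsTopologicalGroup G] [BorelSpace G] [IsFiniteMeasureOnCompacts μ] [μ.IsMulLeftInvariant]

lemma star_lmul_mul (a : A) (f g : ConvAlg α μ) :
    star (lmul a f) * g = star f * lmul (star a) g := by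
  rw [star_lmul, mul_lmul]

/-- In the unitization ‖a‖² - a⋆a = c⋆c. Letting both sides act on f gives (a f)⋆(a f) + (c f)⋆(c f)
= ‖a‖² f⋆f, so (a f)⋆(a f) ≤ ‖a‖² f⋆f in the crossed product. Thus A acts by bounded multipliers for
the universal norm. -/
lemma norm_lmul_le (a : A) (f : ConvAlg α μ) : ‖lmul a f‖ ≤ ‖a‖ * ‖f‖ := by
  let : PartialOrder (Unitization ℂ A) := CStarAlgebra.spectralOrder _
  have : StarOrderedRing (Unitization ℂ A) := CStarAlgebra.spectralOrderedRing _
  let : PartialOrder (CrossedProduct α μ) := CStarAlgebra.spectralOrder _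
  have : StarOrderedRing (CrossedProduct α μ) := CStarAlgebra.spectralOrderedRing _
  obtain ⟨c, hc⟩ : ∃ c : Unitization ℂ A,
      algebraMap ℝ _ (‖a‖ ^ 2) - star (a : Unitization ℂ A) * a = star c * c := by
    refine CStarAlgebra.nonneg_iff_eq_star_mul_self.1 (sub_nonneg.2 ?_)
    have := (IsSelfAdjoint.star_mul_self (a : Unitization ℂ A)).le_algebraMap_norm_self
    rwa [CStarRing.norm_star_mul_self, ← sq, Unitization.norm_inr] at this
  have h1 : ((‖a‖ ^ 2 : ℝ) : ℂ) = star c.fst * c.fst := by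
    have := congrArg (fun z : Unitization ℂ A => z.fst) hc
    simpa [IsScalarTower.algebraMap_apply ℝ ℂ (Unitization ℂ A),
      Unitization.algebraMap_eq_inl, sub_eq_add_neg] using this
  have h2 : -(star a * a) = star c.fst • c.snd + c.fst • star c.snd + star c.snd * c.snd := by
    have := congrArg (fun z : Unitization ℂ A => z.snd) hc
    simpa [IsScalarTower.algebraMap_apply ℝ ℂ (Unitization ℂ A),
      Unitization.algebraMap_eq_inl, sub_eq_add_neg] using this
  -- This is c f, with the scalar part and the part in A acting separately.
  let y : ConvAlg α μ := c.fst • f + lmul c.snd f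
  have e : star (lmul a f) * lmul a f + star y * y = ((‖a‖ ^ 2 : ℝ) : ℂ) • (star f * f) := by
    have e1 : star y * y = star f * (lmul (star c.snd) y) + star f * (star c.fst • y) := by
      simp only [y, star_add, star_smul, add_mul, star_lmul_mul]
      rw [add_comm, smul_mul_assoc, mul_smul_comm]
    rw [e1, star_lmul_mul, ← mul_add, ← mul_add, ← mul_smul_comm]
    congr 1
    ext s
    have h3 : star a * (a * f s) = -((star c.fst • c.snd + c.fst • star c.snd +
        star c.snd * c.snd) * f s) := by rw [← h2, neg_mul, neg_neg, mul_assoc]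
    simp only [add_apply, lmul_apply, smul_apply, y, h3, h1]
    simp only [add_mul, mul_add, smul_mul_assoc, mul_smul_comm, smul_add, smul_smul, mul_assoc]
    abel
  have hle : star (CStarCompletion.of (lmul a f)) * CStarCompletion.of (lmul a f)
      ≤ ((‖a‖ ^ 2 : ℝ) : ℂ) • (star (CStarCompletion.of f) * CStarCompletion.of f) := by
    simp only [← CStarCompletion.of_star, ← CStarCompletion.of_mul, ← CStarCompletion.of_smul]
    rw [← e, CStarCompletion.of_add]
    refine le_add_of_nonneg_right ?_
    rw [CStarCompletion.of_mul, CStarCompletion.of_star]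
    exact star_mul_self_nonneg _
  have := CStarAlgebra.norm_le_norm_of_nonneg_of_le (star_mul_self_nonneg _) hle
  rw [norm_smul, CStarRing.norm_star_mul_self, CStarRing.norm_star_mul_self,
    CStarCompletion.norm_of, CStarCompletion.norm_of, Complex.norm_real,
    Real.norm_of_nonneg (sq_nonneg _)] at this
  refine le_of_sq_le_sq ?_ (by positivity)
  rw [mul_pow, sq, sq ‖f‖]
  exact this

end ConvAlg

/-! ### Calculus of asymptotic equality -/

/-- Two sequences are asymptotically equal if their difference converges to zero. -/
def AsympEq {E : Type*} [SeminormedAddCommGroup E] (x y : ℕ → E) : Prop :=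
  Tendsto (fun n => x n - y n) atTop (𝓝 0)

infix:50 "≋" => AsympEq

namespace AsympEq

section Group

variable {E F : Type*} [SeminormedAddCommGroup E] [SeminormedAddCommGroup F] {x y z : ℕ → E}

lemma refl (x : ℕ → E) : x ≋ x := by simpa [AsympEq] using tendsto_const_nhds

lemma of_eq (h : ∀ n, x n = y n) : x ≋ y := by
  simpa [AsympEq, h] using tendsto_const_nhds

lemma symm (h : x ≋ y) : y ≋ x := by simpa [AsympEq] using Tendsto.neg h

lemma trans (h : x ≋ y) (h' : y ≋ z) : x ≋ z := by simpa [AsympEq] using Tendsto.add h h'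

instance : Trans (α := ℕ → E) AsympEq AsympEq AsympEq := ⟨trans⟩

lemma iff_tendsto {a : E} : (x ≋ fun _ => a) ↔ Tendsto x atTop (𝓝 a) :=
  tendsto_sub_nhds_zero_iff

lemma iff_norm : x ≋ y ↔ Tendsto (fun n => ‖x n - y n‖) atTop (𝓝 0) :=
  tendsto_zero_iff_norm_tendsto_zero

lemma add {x' y' : ℕ → E} (h : x ≋ y) (h' : x' ≋ y') :
    (fun n => x n + x' n) ≋ fun n => y n + y' n := by
  have := Tendsto.add h h'
  simpa [AsympEq, add_sub_add_comm] using this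

lemma of_norm_le {c : ℝ} {w z : ℕ → F} (h : x ≋ y)
    (hle : ∀ n, ‖w n - z n‖ ≤ c * ‖x n - y n‖) : w ≋ z := by
  rw [iff_norm] at h ⊢
  exact squeeze_zero (fun _ => norm_nonneg _) hle (by simpa using h.const_mul c)

lemma smul [NormedSpace ℂ E] (c : ℂ) (h : x ≋ y) : (fun n => c • x n) ≋ fun n => c • y n :=
  h.of_norm_le (c := ‖c‖) fun n => by rw [← smul_sub, norm_smul]

end Group

section Ring

variable {E : Type*} [NonUnitalSeminormedRing E] {x y : ℕ → E}

lemma mul_left {b : ℕ → E} {c : ℝ} (hb : ∀ n, ‖b n‖ ≤ c) (h : x ≋ y) :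
    (fun n => b n * x n) ≋ fun n => b n * y n :=
  h.of_norm_le (c := c) fun n => by
    rw [← mul_sub]
    exact (norm_mul_le _ _).trans (mul_le_mul_of_nonneg_right (hb n) (norm_nonneg _))

lemma mul_right {b : ℕ → E} {c : ℝ} (hb : ∀ n, ‖b n‖ ≤ c) (h : x ≋ y) :
    (fun n => x n * b n) ≋ fun n => y n * b n :=
  h.of_norm_le (c := c) fun n => by
    rw [← sub_mul, mul_comm]
    exact (norm_mul_le _ _).trans (mul_le_mul_of_nonneg_left (hb n) (norm_nonneg _))

lemma const_mul (b : E) (h : x ≋ y) : (fun n => b * x n) ≋ fun n => b * y n :=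
  h.mul_left fun _ => le_refl ‖b‖

lemma mul_const (b : E) (h : x ≋ y) : (fun n => x n * b) ≋ fun n => y n * b :=
  h.mul_right fun _ => le_refl ‖b‖

lemma star [StarRing E] [NormedStarGroup E] (h : x ≋ y) :
    (fun n => star (x n)) ≋ fun n => star (y n) :=
  h.of_norm_le (c := 1) fun n => by rw [← star_sub, norm_star, one_mul]

end Ring

lemma map {A B : Type*} [NonUnitalCStarAlgebra A] [NonUnitalCStarAlgebra B]
    (φ : A →⋆ₙₐ[ℂ] B) {x y : ℕ → A} (h : x ≋ y) :
    (fun n => φ (x n)) ≋ fun n => φ (y n) :=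
  h.of_norm_le (c := 1) fun n => by
    rw [← map_sub, one_mul]
    exact NonUnitalStarAlgHom.norm_apply_le φ _

lemma map_equiv {A : Type*} [NonUnitalCStarAlgebra A] (φ : A ≃⋆ₐ[ℂ] A) {x y : ℕ → A}
    (h : x ≋ y) : (fun n => φ (x n)) ≋ fun n => φ (y n) :=
  h.map (φ : A →⋆ₙₐ[ℂ] A)

/-- A bounded family of sequences that is asymptotically trivial on a set with dense span is so
everywhere. -/
lemma of_mem_closure {E F : Type*} [NormedAddCommGroup E] [NormedSpace ℂ E]
    [NormedAddCommGroup F] [NormedSpace ℂ F] {T S : ℕ → E →L[ℂ] F} {C : ℝ} (hT : ∀ n, ‖T n‖ ≤ C)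
    (hS : ∀ n, ‖S n‖ ≤ C) {s : Set E} (hs : ∀ b ∈ s, (fun n => T n b) ≋ fun n => S n b)
    {b : E} (hb : b ∈ closure (Submodule.span ℂ s : Set E)) :
    (fun n => T n b) ≋ fun n => S n b := by
  have hspan : ∀ b ∈ Submodule.span ℂ s, (fun n => T n b) ≋ fun n => S n b := by
    intro b hb
    induction hb using Submodule.span_induction with
    | mem x hx => exact hs x hx
    | zero => simpa using refl _
    | add x y _ _ hx hy => simpa using hx.add hy
    | smul c x _ hx => simpa using hx.smul c
  have hC : 0 ≤ C := (norm_nonneg _).trans (hT 0)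
  rw [AsympEq, Metric.tendsto_atTop]
  intro ε hε
  -- The two terms with b - d are each at most C ‖b - d‖, so together they stay within ε / 2; the
  -- added 1 covers C = 0.
  obtain ⟨d, hd, hbd⟩ := Metric.mem_closure_iff.1 hb (ε / (4 * (C + 1))) (by positivity)
  obtain ⟨N, hN⟩ := Metric.tendsto_atTop.1 (hspan d hd) (ε / 2) (half_pos hε)
  refine ⟨N, fun n hn => ?_⟩
  have h1 := hN n hn
  simp only [dist_zero_right] at h1 ⊢
  have e : T n b - S n b = (T n d - S n d) + ((T n (b - d)) - S n (b - d)) := by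
    simp only [map_sub]; abel
  rw [dist_eq_norm, lt_div_iff₀ (by positivity)] at hbd
  have h2 : ‖T n (b - d)‖ ≤ C * ‖b - d‖ := (T n).le_of_opNorm_le (hT n) _
  have h3 : ‖S n (b - d)‖ ≤ C * ‖b - d‖ := (S n).le_of_opNorm_le (hS n) _
  calc ‖T n b - S n b‖ ≤ ‖T n d - S n d‖ + (‖T n (b - d)‖ + ‖S n (b - d)‖) := by
        rw [e]; exact (norm_add_le _ _).trans (add_le_add le_rfl (norm_sub_le _ _))
    _ < ε := by nlinarith [norm_nonneg (b - d)]

end AsympEq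

/-! ### Approximate representability by one-sided relations -/

section ApproximatelyRepresentable

variable {H A : Type*} [CommGroup H] [NonUnitalCStarAlgebra A]

/-- A family of sequences of contractions that witnesses approximate representability of an action
of an abelian group, with the one-sided relations only. -/
structure IsImplementing (α : H →* (A ≃⋆ₐ[ℂ] A)) (x : H → ℕ → A) : Prop where
  norm_le : ∀ h n, ‖x h n‖ ≤ 1
  twist : ∀ h a, (fun n => x h n * a) ≋ fun n => α h a * x h n
  star_mul : ∀ h a, (fun n => star (x h n) * (x h n * a)) ≋ fun _ => a
  mul : ∀ g h a, (fun n => x g n * (x h n * a)) ≋ fun n => x (g * h) n * a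
  invariant : ∀ g h a, (fun n => α g (x h n) * a) ≋ fun n => x h n * a

namespace IsImplementing

lemma apply_inv_apply (α : H →* (A ≃⋆ₐ[ℂ] A)) (h : H) (a : A) : α h (α h⁻¹ a) = a := by
  rw [map_inv]; exact (α h).apply_symm_apply a

variable {α : H →* (A ≃⋆ₐ[ℂ] A)} {x : H → ℕ → A} (hx : IsImplementing α x)

include hx

lemma norm_star_le (h : H) (n : ℕ) : ‖star (x h n)‖ ≤ 1 := by
  rw [norm_star]; exact hx.norm_le h n

lemma mul_comm_inv (h : H) (a : A) : (fun n => a * x h n) ≋ fun n => x h n * α h⁻¹ a := by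
  have := (hx.twist h (α h⁻¹ a)).symm
  simpa only [apply_inv_apply] using this

/-- Write x for x_1. The product x⋆ x x a is asymptotically a x after commuting a past the last x,
and asymptotically a after x x a ≈ x a. Since x a ≈ a x, all agree. -/
lemma one (a : A) : (fun n => x 1 n * a) ≋ fun _ => a := by
  have h1 : (fun n => x 1 n * a) ≋ fun n => a * x 1 n := by simpa using hx.twist 1 a
  have h2 : (fun n => star (x 1 n) * (x 1 n * (x 1 n * a))) ≋ fun n => a * x 1 n := by
    refine ((h1.mul_left (hx.norm_le 1)).mul_left (hx.norm_star_le 1)).trans ?_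
    simpa only [mul_assoc] using (hx.star_mul 1 a).mul_right (hx.norm_le 1)
  have h3 : (fun n => star (x 1 n) * (x 1 n * (x 1 n * a))) ≋ fun _ => a := by
    refine ((hx.mul 1 1 a).mul_left (hx.norm_star_le 1)).trans ?_
    simpa using hx.star_mul 1 a
  exact (h1.trans h2.symm).trans h3

/-- Cancel x_h⋆ x_h in x_h⋆ x_h x_{h⁻¹} a. The cancellation is available only next to a fixed
element, so x_{h⁻¹} is first moved to the right of a twisted a. This is the step that makes the
asymptotic isometries asymptotic unitaries. -/
lemma star_eq (h : H) (a : A) : (fun n => star (x h n) * a) ≋ fun n => x h⁻¹ n * a := by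
  have h1 : (fun n => x h n * (x h⁻¹ n * a)) ≋ fun _ => a := by
    refine (hx.mul h h⁻¹ a).trans ?_
    simpa using hx.one a
  have h2 : (fun n => star (x h n) * (x h n * (x h⁻¹ n * a))) ≋ fun n => x h⁻¹ n * a := by
    refine (((hx.twist h⁻¹ a).mul_left (hx.norm_le h)).mul_left (hx.norm_star_le h)).trans ?_
    refine AsympEq.trans ?_ (hx.twist h⁻¹ a).symm
    simpa only [mul_assoc] using (hx.star_mul h (α h⁻¹ a)).mul_right (hx.norm_le h⁻¹)
  exact (h1.mul_left (hx.norm_star_le h)).symm.trans h2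

lemma mul_star (h : H) (a : A) : (fun n => x h n * (star (x h n) * a)) ≋ fun _ => a := by
  refine ((hx.star_eq h a).mul_left (hx.norm_le h)).trans ((hx.mul h h⁻¹ a).trans ?_)
  simpa using hx.one a

lemma conj (h : H) (a : A) : (fun n => x h n * a * star (x h n)) ≋ fun _ => α h a := by
  refine ((hx.twist h a).mul_right (hx.norm_star_le h)).trans ?_
  have := (hx.mul_star h (star (α h a))).star
  simpa [mul_assoc] using this

/-- Left multiplications by a are reduced to right multiplications with a x_h ≈ x_h α_h⁻¹(a);
commutativity of the group makes g h g⁻¹ = h. -/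
lemma isApproximatelyRepresentable : IsApproximatelyRepresentable α := by
  refine ⟨fun n h => x h n, fun n h => hx.norm_le h n, fun h => ⟨?_, ?_⟩, fun g h a => ?_,
    fun a h => ?_, fun g h a => ?_⟩
  · refine ⟨fun a => ?_, fun a => ?_⟩
    · have := (hx.mul_star h (star a)).star
      refine tendsto_map'_iff.2 (AsympEq.iff_tendsto.1 ?_)
      simpa [mul_assoc, Function.comp_def] using this
    · refine tendsto_map'_iff.2 (AsympEq.iff_tendsto.1 ?_)
      simpa [mul_assoc, Function.comp_def] using hx.mul_star h a
  · refine ⟨fun a => ?_, fun a => ?_⟩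
    · have := (hx.star_mul h (star a)).star
      refine tendsto_map'_iff.2 (AsympEq.iff_tendsto.1 ?_)
      simpa [mul_assoc, Function.comp_def] using this
    · refine tendsto_map'_iff.2 (AsympEq.iff_tendsto.1 ?_)
      simpa [mul_assoc, Function.comp_def] using hx.star_mul h a
  · have h1 : (fun n => a * (x g n * x h n)) ≋ fun n => a * x (g * h) n := by
      calc (fun n => a * (x g n * x h n))
          ≋ fun n => x g n * α g⁻¹ a * x h n := by
            simpa only [mul_assoc] using (hx.mul_comm_inv g a).mul_right (hx.norm_le h)
        _ ≋ fun n => x g n * (x h n * α h⁻¹ (α g⁻¹ a)) := by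
            simpa only [mul_assoc] using (hx.mul_comm_inv h (α g⁻¹ a)).mul_left (hx.norm_le g)
        _ ≋ fun n => x (g * h) n * α h⁻¹ (α g⁻¹ a) := hx.mul g h _
        _ ≋ fun n => a * x (g * h) n := by
            have : α (g * h)⁻¹ a = α h⁻¹ (α g⁻¹ a) := by
              rw [mul_inv_rev, map_mul]; rfl
            rw [← this]
            exact (hx.mul_comm_inv (g * h) a).symm
    have h2 := (AsympEq.iff_norm.1 h1).add (AsympEq.iff_norm.1 (hx.mul g h a))
    simpa [mul_sub, sub_mul, mul_assoc] using h2
  · exact AsympEq.iff_norm.1 (hx.conj h a).symm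
  · have h1 : (fun n => a * α g (x h n)) ≋ fun n => a * x h n := by
      -- The translate α_g(x_h) twists by α_g α_h α_g⁻¹, which is α_h because the group is abelian.
      have e : ∀ c, (fun n => α g (x h n) * c) ≋ fun n => α h c * α g (x h n) := fun c => by
        have := (hx.twist h (α g⁻¹ c)).map_equiv (α g)
        simp only [map_mul, apply_inv_apply] at this
        have e2 : α g (α h (α g⁻¹ c)) = α h c := by
          change (α g * α h * α g⁻¹) c = _
          rw [← map_mul, ← map_mul, mul_comm g h, mul_inv_cancel_right]
        rwa [e2] at this
      have e1 := (e (α h⁻¹ a)).symm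
      simp only [apply_inv_apply] at e1
      exact e1.trans ((hx.invariant g h _).trans (hx.mul_comm_inv h a).symm)
    have h2 := (AsympEq.iff_norm.1 h1.symm).add (AsympEq.iff_norm.1 (hx.invariant g h a).symm)
    have hgh : g * h * g⁻¹ = h := by rw [mul_comm g h, mul_inv_cancel_right]
    simpa [mul_sub, sub_mul, mul_assoc, hgh] using h2

end IsImplementing

lemma IsApproximatelyRepresentable.exists_isImplementing {α : H →* (A ≃⋆ₐ[ℂ] A)}
    (hα : IsApproximatelyRepresentable α) : ∃ x : H → ℕ → A, IsImplementing α x := by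
  obtain ⟨x, h0, h1, h2, h3, h4⟩ := hα
  -- Of each two-sided condition only the summand with a on the right is kept.
  have hfst : ∀ {E : Type _} [SeminormedAddCommGroup E] {u v : ℕ → E},
      Tendsto (fun n => ‖u n‖ + ‖v n‖) atTop (𝓝 0) → Tendsto (fun n => ‖v n‖) atTop (𝓝 0) :=
    fun h => squeeze_zero (fun _ => norm_nonneg _)
      (fun n => le_add_of_nonneg_left (norm_nonneg _)) h
  refine ⟨fun h n => x n h, fun h n => h0 n h, fun h a => ?_, fun h a => ?_, fun g h a => ?_,
    fun g h a => ?_⟩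
  -- The covariance relation multiplied by x_h on the right; then x_h⋆ x_h is absorbed as an
  -- approximate unit.
  · have e1 : (fun n => α h a * x n h) ≋ fun n => x n h * a * star (x n h) * x n h :=
      (AsympEq.iff_norm.2 (h3 a h)).mul_right fun n => h0 n h
    have e2 : (fun n => a * (star (x n h) * x n h)) ≋ fun _ => a :=
      AsympEq.iff_tendsto.2 (tendsto_map'_iff.1 ((h1 h).2.tendsto_mul_left a))
    have e3 := e2.mul_left (b := fun n => x n h) fun n => h0 n h
    simp only [mul_assoc] at e1 e3
    exact e3.symm.trans e1.symm
  · have := tendsto_map'_iff.1 ((h1 h).2.tendsto_mul_right a)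
    refine AsympEq.iff_tendsto.2 ?_
    simpa [Function.comp_def, mul_assoc] using this
  · rw [AsympEq.iff_norm]
    simpa [sub_mul, mul_assoc] using hfst (h2 g h a)
  · have hgh : g * h * g⁻¹ = h := by rw [mul_comm g h, mul_inv_cancel_right]
    refine AsympEq.symm (AsympEq.iff_norm.2 ?_)
    simpa [sub_mul, hgh] using hfst (h4 g h a)

end ApproximatelyRepresentable

/-! ### Sequential approximate units and contractive lifts -/

section CStar

variable {A : Type*} [NonUnitalCStarAlgebra A]

/-- Separability extracts a sequence from the canonical net: e_n is chosen to work up to 1 / (n + 1)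
on the first n + 1 members of a dense sequence, and contractivity extends this to all of A.
Self-adjointness gives the other side. -/
lemma exists_approxUnit_sequence [TopologicalSpace.SeparableSpace A] :
    ∃ e : ℕ → A, (∀ n, ‖e n‖ ≤ 1) ∧ (∀ n, star (e n) = e n) ∧
      (∀ a, (fun n => e n * a) ≋ fun _ => a) ∧ ∀ a, (fun n => a * e n) ≋ fun _ => a := by
  let : PartialOrder A := CStarAlgebra.spectralOrder _
  have : StarOrderedRing A := CStarAlgebra.spectralOrderedRing _
  have hau := CStarAlgebra.increasingApproximateUnit A
  have := hau.neBot
  let d := TopologicalSpace.denseSeq A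
  have hex : ∀ n : ℕ, ∃ e : A, ‖e‖ ≤ 1 ∧ star e = e ∧
      ∀ k ∈ Finset.range (n + 1), ‖e * d k - d k‖ < 1 / (n + 1 : ℝ) := fun n => by
    have h1 : ∀ᶠ e in CStarAlgebra.approximateUnit A,
        ∀ k ∈ Finset.range (n + 1), ‖e * d k - d k‖ < 1 / (n + 1 : ℝ) := by
      rw [Filter.eventually_all_finset]
      intro k _
      have := (hau.tendsto_mul_right (d k)).eventually
        (Metric.ball_mem_nhds (d k) (ε := 1 / (n + 1 : ℝ)) (by positivity))
      simpa [dist_eq_norm] using this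
    exact (hau.eventually_norm.and (hau.eventually_star_eq.and h1)).exists
  choose e he1 he2 he3 using hex
  have hl : ∀ a, (fun n => e n * a) ≋ fun _ => a := fun a => by
    rw [AsympEq, Metric.tendsto_atTop]
    intro ε hε
    obtain ⟨k, hk⟩ := (TopologicalSpace.denseRange_denseSeq A).exists_dist_lt a (ε := ε / 3)
      (by positivity)
    obtain ⟨N, hN⟩ := exists_nat_one_div_lt (ε := ε / 3) (by positivity)
    refine ⟨max k N, fun n hn => ?_⟩
    have hn1 : ‖e n * d k - d k‖ < ε / 3 := by
      refine (he3 n k (Finset.mem_range.2 ?_)).trans ((one_div_le_one_div_of_le (by positivity)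
        ?_).trans_lt hN)
      · exact Nat.lt_succ_of_le ((le_max_left _ _).trans hn)
      · have : (N : ℝ) ≤ n := by exact_mod_cast (le_max_right _ _).trans hn
        linarith
    rw [dist_eq_norm] at hk
    have h2 : ‖e n * (a - d k)‖ ≤ ‖a - d k‖ :=
      (norm_mul_le _ _).trans (mul_le_of_le_one_left (norm_nonneg _) (he1 n))
    have e1 : e n * a - a = e n * (a - d k) + (e n * d k - d k) - (a - d k) := by
      rw [mul_sub]; abel
    rw [dist_zero_right, e1]
    have h3 := norm_sub_le (e n * (a - d k) + (e n * d k - d k)) (a - d k)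
    have h4 := norm_add_le (e n * (a - d k)) (e n * d k - d k)
    change ‖a - d k‖ < ε / 3 at hk
    linarith
  refine ⟨e, he1, he2, hl, fun a => ?_⟩
  simpa [he2] using (hl (star a)).star

/-- A contraction in the image of a ⋆-homomorphism lifts to a contraction. -/
lemma exists_lift_norm_le_one {B : Type*} [NonUnitalCStarAlgebra B] (φ : A →⋆ₙₐ[ℂ] B) (b : A)
    (hb : ‖φ b‖ ≤ 1) : ∃ c, ‖c‖ ≤ 1 ∧ φ c = φ b := by
  -- The lift will be c = b (1 - h(b⋆b)) with 1 - h(t) = max(1, t)^(-1/2), so that c⋆c = t / max(1,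
  -- t) at t = b⋆b. The condition h(0) = 0 keeps the calculus inside the non-unital algebra.
  obtain ⟨h, hcont, h0, hle, heq⟩ : ∃ h : ℝ → ℝ, Continuous h ∧ h 0 = 0 ∧
      (∀ t, 0 ≤ t → ‖t - t * h t - (h t * t - h t * t * h t)‖ ≤ 1) ∧ ∀ t ≤ 1, h t = 0 := by
    have hpos : ∀ t : ℝ, 0 < √(max 1 t) := fun t => Real.sqrt_pos.2 (by positivity)
    refine ⟨fun t => 1 - (√(max 1 t))⁻¹, ?_, by simp, fun t ht0 => ?_, fun t ht => by
      simp [max_eq_left ht]⟩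
    · exact continuous_const.sub (Continuous.inv₀ (by fun_prop) fun t => (hpos t).ne')
    · have e3 : t - t * (1 - (√(max 1 t))⁻¹) - ((1 - (√(max 1 t))⁻¹) * t -
          (1 - (√(max 1 t))⁻¹) * t * (1 - (√(max 1 t))⁻¹)) = t * (max 1 t)⁻¹ := by
        have : (√(max 1 t))⁻¹ * (√(max 1 t))⁻¹ = (max 1 t)⁻¹ := by
          rw [← mul_inv, Real.mul_self_sqrt (by positivity)]
        rw [← this]
        ring
      rw [e3, Real.norm_of_nonneg (by positivity), ← div_eq_mul_inv,
        div_le_one (by positivity)]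
      exact le_max_right _ _
  have hsa : IsSelfAdjoint (star b * b) := .star_mul_self b
  have hφsa : IsSelfAdjoint (φ (star b * b)) := hsa.map φ
  have hnn : ∀ t ∈ quasispectrum ℝ (star b * b), 0 ≤ t := by
    let : PartialOrder A := CStarAlgebra.spectralOrder _
    have : StarOrderedRing A := CStarAlgebra.spectralOrderedRing _
    exact fun t ht => quasispectrum_nonneg_of_nonneg _ (star_mul_self_nonneg b) t ht
  refine ⟨b - b * cfcₙ h (star b * b), ?_, ?_⟩
  · have e1 : star (b - b * cfcₙ h (star b * b)) * (b - b * cfcₙ h (star b * b))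
        = cfcₙ (fun t => t - t * h t - (h t * t - h t * t * h t)) (star b * b) := by
      have hs : star (cfcₙ h (star b * b)) = cfcₙ h (star b * b) :=
        (IsSelfAdjoint.cfcₙ (f := h) (a := star b * b)).star_eq
      have hi : cfcₙ (fun t : ℝ => t) (star b * b) = star b * b := cfcₙ_id' ℝ _
      have hc1 : ContinuousOn (fun t => t * h t) (quasispectrum ℝ (star b * b)) := by fun_prop
      have hc2 : ContinuousOn (fun t => h t * t) (quasispectrum ℝ (star b * b)) := by fun_prop
      have hc3 : ContinuousOn (fun t => h t * t * h t) (quasispectrum ℝ (star b * b)) := by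
        fun_prop
      rw [cfcₙ_sub _ _ (star b * b) (by fun_prop) (by simp [h0]) (by fun_prop) (by simp [h0]),
        cfcₙ_sub _ _ (star b * b) (by fun_prop) (by simp [h0]) (by fun_prop) (by simp [h0]),
        cfcₙ_sub _ _ (star b * b) (by fun_prop) (by simp) (by fun_prop) (by simp [h0]),
        cfcₙ_mul (fun t => h t * t) h (star b * b) (by fun_prop) (by simp) (by fun_prop) h0,
        cfcₙ_mul h (fun t => t) (star b * b) (by fun_prop) h0 (by fun_prop) rfl,
        cfcₙ_mul (fun t => t) h (star b * b) (by fun_prop) rfl (by fun_prop) h0, hi]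
      simp only [star_sub, star_mul, hs, sub_mul, mul_sub, mul_assoc]
      abel
    have e2 : ‖b - b * cfcₙ h (star b * b)‖ * ‖b - b * cfcₙ h (star b * b)‖ ≤ 1 := by
      rw [← CStarRing.norm_star_mul_self, e1]
      exact norm_cfcₙ_le fun t ht => hle t (hnn t ht)
    nlinarith [norm_nonneg (b - b * cfcₙ h (star b * b))]
  · have e1 : φ (cfcₙ h (star b * b)) = cfcₙ h (φ (star b * b)) :=
      NonUnitalStarAlgHomClass.map_cfcₙ φ h (star b * b) (by fun_prop) h0
        (AddMonoidHomClass.continuous_of_bound φ 1 fun a => by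
          simpa using NonUnitalStarAlgHom.norm_apply_le φ a)
    -- Since ‖φ(b)‖ ≤ 1, the quasispectrum lies in t ≤ 1, where h vanishes; the correction is
    -- therefore invisible under φ.
    have e2 : cfcₙ h (φ (star b * b)) = 0 := by
      rw [← cfcₙ_zero ℝ (φ (star b * b))]
      refine cfcₙ_congr fun t ht => ?_
      have : ‖t‖ ≤ ‖φ (star b * b)‖ :=
        NonUnitalIsometricContinuousFunctionalCalculus.norm_quasispectrum_le _ ht
      rw [map_mul, map_star, CStarRing.norm_star_mul_self] at this
      have ht1 : t ≤ 1 := (le_abs_self t).trans (this.trans (by nlinarith [norm_nonneg (φ b)]))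
      exact heq t ht1
    rw [map_sub, map_mul, e1, e2, mul_zero, sub_zero]

end CStar

/-! ### Unitary representations of the dual group as representations of C(G) -/

/-- A commutative C⋆-algebra with a unit element, as a unital normed ring. -/
abbrev NormedCommRing.ofUnit {D : Type*} [NonUnitalNormedCommRing D] (u : D)
    (hu : ∀ x, u * x = x) : NormedCommRing D :=
  { (inferInstance : NonUnitalNormedCommRing D) with
    one := u
    one_mul := hu
    mul_one := fun x => (mul_comm x u).trans (hu x) }

/-- A commutative C⋆-algebra with a unit element, as a unital C⋆-algebra. -/
abbrev CommCStarAlgebra.ofUnit {D : Type*} [NonUnitalCommCStarAlgebra D] (u : D)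
    (hu : ∀ x, u * x = x) : CommCStarAlgebra D :=
  let r : NormedCommRing D := NormedCommRing.ofUnit u hu
  let alg : NormedAlgebra ℂ D :=
    { Algebra.ofModule (R := ℂ) (A := D) (fun c x y => smul_mul_assoc c x y)
        (fun c x y => mul_smul_comm c x y) with
      norm_smul_le := fun c x => norm_smul_le c x }
  { r, alg, (inferInstance : NonUnitalCommCStarAlgebra D) with }

/-- A character of `G` as a complex-valued continuous function. -/
def PontryaginDual.toContinuousMap {G : Type*} [Monoid G] [TopologicalSpace G]
    (χ : PontryaginDual G) : C(G, ℂ) :=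
  ⟨fun g => (χ g : ℂ), continuous_subtype_val.comp (map_continuous χ)⟩

@[simp] lemma PontryaginDual.toContinuousMap_apply {G : Type*} [Monoid G] [TopologicalSpace G]
    (χ : PontryaginDual G) (g : G) : χ.toContinuousMap g = χ g := rfl

/-- A group of characters of `G` that puts `G` in duality with the abstract group `H`: it separates
the points of `G`, and every character of `H` is the evaluation at a point of `G`. -/
structure IsDualPairing {G H : Type*} [CommGroup G] [TopologicalSpace G] [CommGroup H]
    (e : H →* PontryaginDual G) : Prop where
  separates : ∀ g g' : G, (∀ h, e h g = e h g') → g = g'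
  exists_eval : ∀ ξ : H →* Circle, ∃ g, ∀ h, e h g = ξ h

section Representation

variable {G H : Type*} [CommGroup G] [TopologicalSpace G] [CompactSpace G] [CommGroup H]
  {e : H →* PontryaginDual G}

open WeakDual

/-- A Gelfand character ω of D restricts along w to a character of H, which is evaluation at a
unique point θ(ω) of G. The homomorphism is composition with θ followed by the inverse Gelfand
transform. -/
lemma IsDualPairing.exists_hom_comm (he : IsDualPairing e) {D : Type*}
    [NonUnitalCommCStarAlgebra D] (w : H → D) (hw1 : ∀ x, w 1 * x = x)
    (hmul : ∀ g h, w (g * h) = w g * w h) (hstar : ∀ h, star (w h) * w h = w 1) :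
    ∃ φ : C(G, ℂ) →⋆ₙₐ[ℂ] D, ∀ h, φ (e h).toContinuousMap = w h := by
  let : CommCStarAlgebra D := CommCStarAlgebra.ofUnit (w 1) hw1
  have hone : (1 : D) = w 1 := rfl
  let ξ : characterSpace ℂ D → H →* Circle := fun ω =>
    { toFun := fun h => ⟨ω (w h), mem_sphere_zero_iff_norm.2 (by
        have h1 : ‖ω (w h)‖ * ‖ω (w h)‖ = 1 := by
          rw [← CStarRing.norm_star_mul_self, ← map_star, ← map_mul, hstar, ← hone, map_one,
            norm_one]
        nlinarith [norm_nonneg (ω (w h))])⟩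
      map_one' := by ext; simp [← hone]
      map_mul' := fun g h => by
        ext
        change ω (w (g * h)) = ω (w g) * ω (w h)
        rw [hmul, map_mul] }
  choose θ hθ using fun ω => he.exists_eval (ξ ω)
  -- A continuous injection of a compact space into a product of circles is an embedding, so
  -- continuity of θ is checked on one h at a time, where it is continuity of a Gelfand transform.
  have hemb : IsClosedEmbedding fun (g : G) (h : H) => e h g :=
    Continuous.isClosedEmbedding (continuous_pi fun h => map_continuous (e h))
      fun g g' hgg => he.separates g g' fun h => congrFun hgg h
  have hθc : Continuous θ := by
    rw [hemb.isInducing.continuous_iff]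
    refine continuous_pi fun h => ?_
    simp only [Function.comp_apply, hθ]
    refine Continuous.subtype_mk ?_ _
    exact (gelfandTransform ℂ D (w h)).continuous
  let Φ : C(G, ℂ) →⋆ₐ[ℂ] D := ((gelfandStarTransform D).symm : _ →⋆ₐ[ℂ] D).comp
    (ContinuousMap.compStarAlgHom' ℂ ℂ ⟨θ, hθc⟩)
  refine ⟨(Φ : C(G, ℂ) →⋆ₙₐ[ℂ] D), fun h => ?_⟩
  change (gelfandStarTransform D).symm _ = _
  rw [StarAlgEquiv.symm_apply_eq]
  ext ω
  change ((e h (θ ω) : Circle) : ℂ) = ω (w h)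
  rw [hθ]
  rfl

/-- The relations force w_h⋆ = w_{h⁻¹}, so the family and its adjoints commute and generate a
commutative C⋆-algebra, to which the commutative case applies. -/
lemma IsDualPairing.exists_hom (he : IsDualPairing e) {F : Type*}
    [NonUnitalCStarAlgebra F] (w : H → F) (hw1 : ∀ x, w 1 * x = x)
    (hmul : ∀ g h, w (g * h) = w g * w h) (hstar : ∀ h, star (w h) * w h = w 1) :
    ∃ φ : C(G, ℂ) →⋆ₙₐ[ℂ] F, ∀ h, φ (e h).toContinuousMap = w h := by
  have hsw : ∀ h, star (w h) = w h⁻¹ := fun h => by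
    have h1 : star (w 1) = w 1 := by
      have := hstar 1
      rw [← this, star_mul, star_star]
    have h2 : ∀ x, x * w 1 = x := fun x => by
      rw [← star_star (x * w 1), star_mul, h1, hw1, star_star]
    calc star (w h) = star (w h) * (w h * w h⁻¹) := by rw [← hmul, mul_inv_cancel, h2]
      _ = w h⁻¹ := by rw [← mul_assoc, hstar, hw1]
  have hcomm : ∀ g h, w g * w h = w h * w g := fun g h => by rw [← hmul, ← hmul, mul_comm]
  let S₀ := NonUnitalStarAlgebra.adjoin ℂ (Set.range w)
  let S : NonUnitalStarSubalgebra ℂ F := S₀.topologicalClosure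
  have hS : IsClosed (S : Set F) := S₀.isClosed_topologicalClosure
  have : IsMulCommutative S₀ := by
    refine NonUnitalStarAlgebra.isMulCommutative_adjoin ℂ ?_ ?_
    · rintro _ ⟨g, rfl⟩ _ ⟨h, rfl⟩; exact hcomm g h
    · rintro _ ⟨g, rfl⟩ _ ⟨h, rfl⟩; rw [hsw]; exact hcomm _ _
  let _ : NonUnitalCommRing S := S₀.nonUnitalCommRingTopologicalClosure
    fun x y => IsMulCommutative.is_comm.comm x y
  let _ : NonUnitalCommCStarAlgebra S := { }
  have hmem : ∀ h, w h ∈ S := fun h => S₀.le_topologicalClosure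
    (NonUnitalStarAlgebra.subset_adjoin ℂ _ ⟨h, rfl⟩)
  obtain ⟨φ, hφ⟩ := he.exists_hom_comm (D := S) (fun h => ⟨w h, hmem h⟩)
    (fun x => Subtype.ext (hw1 x)) (fun g h => Subtype.ext (hmul g h))
    (fun h => Subtype.ext (hstar h))
  exact ⟨(NonUnitalStarSubalgebraClass.subtype S).comp φ, fun h => congrArg Subtype.val (hφ h)⟩

lemma PontryaginDual.toContinuousMap_mul (χ ψ : PontryaginDual G) :
    (χ * ψ).toContinuousMap = χ.toContinuousMap * ψ.toContinuousMap := rfl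

/-- A group of characters that separates points spans a dense subspace of `C(G)`. -/
lemma dense_span_characters (e : H →* PontryaginDual G)
    (he : ∀ g g' : G, (∀ h, e h g = e h g') → g = g') (f : C(G, ℂ)) :
    f ∈ closure (Submodule.span ℂ (Set.range fun h => (e h).toContinuousMap) : Set C(G, ℂ)) := by
  let M : Submonoid C(G, ℂ) :=
    { carrier := Set.range fun h => (e h).toContinuousMap
      one_mem' := ⟨1, by ext; simp⟩
      mul_mem' := by
        rintro _ _ ⟨g, rfl⟩ ⟨h, rfl⟩
        exact ⟨g * h, by dsimp only; rw [map_mul]; exact PontryaginDual.toContinuousMap_mul _ _⟩ }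
  have hstar : ∀ h, star (e h).toContinuousMap = (e h⁻¹).toContinuousMap := fun h => by
    ext g
    rw [map_inv]
    change star ((e h g : Circle) : ℂ) = (((e h g)⁻¹ : Circle) : ℂ)
    rw [Circle.coe_inv_eq_conj]
    rfl
  let S : Subalgebra ℂ C(G, ℂ) := Algebra.adjoin ℂ (M : Set C(G, ℂ))
  -- The characters form a multiplicative monoid closed under conjugation, so their span is already
  -- a ⋆-subalgebra and Stone–Weierstrass applies to it.
  have hSspan : (S.toSubmodule : Submodule ℂ C(G, ℂ)) = Submodule.span ℂ (M : Set C(G, ℂ)) := by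
    rw [Algebra.adjoin_eq_span, Submonoid.closure_eq]
  let S' : StarSubalgebra ℂ C(G, ℂ) :=
    { S with
      star_mem' := fun {x} hx => by
        change x ∈ S.toSubmodule at hx
        change star x ∈ S.toSubmodule
        rw [hSspan] at hx ⊢
        induction hx using Submodule.span_induction with
        | mem x hx =>
          obtain ⟨h, rfl⟩ := hx
          rw [hstar]
          exact Submodule.subset_span ⟨h⁻¹, rfl⟩
        | zero => simp
        | add x y _ _ hx hy => rw [star_add]; exact Submodule.add_mem _ hx hy
        | smul c x _ hx => rw [star_smul]; exact Submodule.smul_mem _ _ hx }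
  have hS' := ContinuousMap.starSubalgebra_topologicalClosure_eq_top_of_separatesPoints S' (by
    intro g g' hgg
    by_contra! hcon
    refine hgg (he g g' fun h => ?_)
    exact Subtype.ext (hcon _ ⟨_, Algebra.subset_adjoin (show _ ∈ M from ⟨h, rfl⟩), rfl⟩))
  have hf : f ∈ S'.topologicalClosure := by rw [hS']; trivial
  have : (S' : Set C(G, ℂ)) = (Submodule.span ℂ (M : Set C(G, ℂ)) : Set C(G, ℂ)) := by
    rw [← hSspan]; rfl
  rw [← SetLike.mem_coe, StarSubalgebra.topologicalClosure_coe, this] at hf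
  exact hf

end Representation

/-! ### Representatives of elements of the central sequence algebra -/

section CentralSequences

variable {A : Type*} [NonUnitalCStarAlgebra A]

/-- A bounded sequence that asymptotically commutes with every element. -/
structure IsCentralSeq (x : ℕ → A) : Prop where
  bounded : ∃ C, ∀ n, ‖x n‖ ≤ C
  central : ∀ a, (fun n => x n * a) ≋ fun n => a * x n

namespace IsCentralSeq

variable {x y : ℕ → A}

lemma star (hx : IsCentralSeq x) : IsCentralSeq fun n => star (x n) where
  bounded := hx.bounded.imp fun _ hC n => (norm_star _).trans_le (hC n)
  central a := by simpa using (hx.central (Star.star a)).star.symm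

lemma mul (hx : IsCentralSeq x) (hy : IsCentralSeq y) : IsCentralSeq fun n => x n * y n where
  bounded := by
    obtain ⟨C, hC⟩ := hx.bounded
    obtain ⟨D, hD⟩ := hy.bounded
    exact ⟨C * D, fun n => (norm_mul_le _ _).trans
      (mul_le_mul (hC n) (hD n) (norm_nonneg _) ((norm_nonneg _).trans (hC n)))⟩
  central a := by
    obtain ⟨C, hC⟩ := hx.bounded
    obtain ⟨D, hD⟩ := hy.bounded
    have h1 := (hy.central a).mul_left hC
    have h2 := (hx.central a).mul_right hD
    simp only [mul_assoc] at h1 h2 ⊢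
    exact h1.trans h2

lemma smul (c : ℂ) (hx : IsCentralSeq x) : IsCentralSeq fun n => c • x n where
  bounded := by
    obtain ⟨C, hC⟩ := hx.bounded
    exact ⟨‖c‖ * C, fun n => (norm_smul c _).trans_le
      (mul_le_mul_of_nonneg_left (hC n) (norm_nonneg c))⟩
  central a := by simpa [smul_mul_assoc, mul_smul_comm] using (hx.central a).smul c

lemma map (φ : A ≃⋆ₐ[ℂ] A) (hx : IsCentralSeq x) : IsCentralSeq fun n => φ (x n) where
  bounded := hx.bounded.imp fun _ hC n => (StarAlgEquiv.norm_map φ (x n)).trans_le (hC n)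
  central a := by simpa using (hx.central (φ.symm a)).map_equiv φ

lemma of_tendsto {C : ℝ} (hC : ∀ n, ‖x n‖ ≤ C) (h : ∀ a, (fun n => x n * a) ≋ fun _ => a)
    (h' : ∀ a, (fun n => a * x n) ≋ fun _ => a) : IsCentralSeq x :=
  ⟨⟨C, hC⟩, fun a => (h a).trans (h' a).symm⟩

/-- The class of a bounded sequence in the sequence algebra. -/
def _root_.seqClass (x : ℕ → A) (hx : ∃ C, ∀ n, ‖x n‖ ≤ C) : SequenceAlgebra A :=
  CStarQuotient.mk _ ⟨x, memℓp_infty (hx.imp fun _ hC => by rintro _ ⟨n, rfl⟩; exact hC n)⟩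

lemma _root_.seqClass_eq_iff (hx : ∃ C, ∀ n, ‖x n‖ ≤ C) (hy : ∃ C, ∀ n, ‖y n‖ ≤ C) :
    seqClass x hx = seqClass y hy ↔ x ≋ y := by
  rw [seqClass, seqClass, CStarQuotient.mk_eq_mk, AsympEq.iff_norm]
  rfl

/-- The class of a central sequence in the central sequence algebra. -/
def toClass (hx : IsCentralSeq x) : CentralSequenceAlgebra A :=
  CStarQuotient.mk _ ⟨seqClass x hx.bounded, mem_relCommutant.2 fun a =>
    (seqClass_eq_iff (x := fun n => a * x n) (y := fun n => x n * a)
      (hx.bounded.imp' (fun C => ‖a‖ * C) fun _ hC n => (norm_mul_le _ _).trans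
        (mul_le_mul_of_nonneg_left (hC n) (norm_nonneg a)))
      (hx.bounded.imp' (fun C => C * ‖a‖) fun _ hC n => (norm_mul_le _ _).trans
        (mul_le_mul_of_nonneg_right (hC n) (norm_nonneg a)))).2 (hx.central a).symm⟩

lemma toClass_mul (hx : IsCentralSeq x) (hy : IsCentralSeq y) :
    (hx.mul hy).toClass = hx.toClass * hy.toClass := rfl

lemma toClass_star (hx : IsCentralSeq x) : hx.star.toClass = Star.star hx.toClass := rfl

lemma toClass_smul (c : ℂ) (hx : IsCentralSeq x) : (hx.smul c).toClass = c • hx.toClass := rfl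

lemma centralMap_toClass (φ : A ≃⋆ₐ[ℂ] A) (hx : IsCentralSeq x) :
    centralMap φ hx.toClass = (hx.map φ).toClass := rfl

/-- Passing to the quotient by the annihilator means that only the multiplier matters, and
centrality makes one side sufficient. -/
lemma toClass_eq_iff (hx : IsCentralSeq x) (hy : IsCentralSeq y) :
    hx.toClass = hy.toClass ↔ ∀ a, (fun n => x n * a) ≋ fun n => y n * a := by
  rw [toClass, toClass, CStarQuotient.mk_eq_mk]
  have key : ∀ a, (seqClass x hx.bounded - seqClass y hy.bounded) * seqEmbed A a = 0 ↔
      (fun n => x n * a) ≋ fun n => y n * a := fun a => by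
    rw [sub_mul, sub_eq_zero]
    refine seqClass_eq_iff (x := fun n => x n * a) (y := fun n => y n * a)
      (hx.bounded.imp' (fun C => C * ‖a‖) fun _ hC n => (norm_mul_le _ _).trans
        (mul_le_mul_of_nonneg_right (hC n) (norm_nonneg a)))
      (hy.bounded.imp' (fun C => C * ‖a‖) fun _ hC n => (norm_mul_le _ _).trans
        (mul_le_mul_of_nonneg_right (hC n) (norm_nonneg a)))
  have key' : ∀ a, seqEmbed A a * (seqClass x hx.bounded - seqClass y hy.bounded) = 0 ↔
      (fun n => a * x n) ≋ fun n => a * y n := fun a => by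
    rw [mul_sub, sub_eq_zero]
    refine seqClass_eq_iff (x := fun n => a * x n) (y := fun n => a * y n)
      (hx.bounded.imp' (fun C => ‖a‖ * C) fun _ hC n => (norm_mul_le _ _).trans
        (mul_le_mul_of_nonneg_left (hC n) (norm_nonneg a)))
      (hy.bounded.imp' (fun C => ‖a‖ * C) fun _ hC n => (norm_mul_le _ _).trans
        (mul_le_mul_of_nonneg_left (hC n) (norm_nonneg a)))
  refine ⟨fun h a => (key a).1 (h a).1, fun h a => ⟨(key a).2 (h a), (key' a).2 ?_⟩⟩
  exact (hx.central a).symm.trans ((h a).trans (hy.central a))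

lemma exists_rep (z : CentralSequenceAlgebra A) : ∃ (x : ℕ → A) (hx : IsCentralSeq x),
    hx.toClass = z := by
  obtain ⟨⟨y, hy⟩, rfl⟩ := CStarQuotient.mk_surjective z
  obtain ⟨x, rfl⟩ := CStarQuotient.mk_surjective y
  refine ⟨x, ⟨⟨‖x‖, lp.norm_apply_le_norm ENNReal.top_ne_zero x⟩, fun a => ?_⟩, rfl⟩
  have := mem_relCommutant.1 hy a
  exact ((seqClass_eq_iff (x := fun n => a * x n) (y := fun n => x n * a)
    ⟨_, lp.norm_apply_le_norm ENNReal.top_ne_zero (constSeq a * x)⟩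
    ⟨_, lp.norm_apply_le_norm ENNReal.top_ne_zero (x * constSeq a)⟩).1 this).symm

/-- There are two quotients to lift through, the annihilator and the null sequences, and each lift
can be taken contractive. -/
lemma exists_rep_norm_le (z : CentralSequenceAlgebra A) (hz : ‖z‖ ≤ 1) :
    ∃ (x : ℕ → A) (hx : IsCentralSeq x), (∀ n, ‖x n‖ ≤ 1) ∧ hx.toClass = z := by
  obtain ⟨y', rfl⟩ := CStarQuotient.mk_surjective z
  obtain ⟨⟨y, hy⟩, hy1, hyz⟩ := exists_lift_norm_le_one (CStarQuotient.mkHom (annihilator A)) y' hz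
  obtain ⟨x', rfl⟩ := CStarQuotient.mk_surjective y
  obtain ⟨x, hx1, hxy⟩ :=
    exists_lift_norm_le_one (CStarQuotient.mkHom (nullSequences A)) x' hy1
  change CStarQuotient.mk _ x = CStarQuotient.mk _ x' at hxy
  have hx2 : ∀ n, ‖x n‖ ≤ 1 := fun n =>
    (lp.norm_apply_le_norm ENNReal.top_ne_zero x n).trans hx1
  refine ⟨x, ⟨⟨1, hx2⟩, fun a => ?_⟩, hx2, ?_⟩
  · have := mem_relCommutant.1 hy a
    rw [← hxy] at this
    exact ((seqClass_eq_iff (x := fun n => a * x n) (y := fun n => x n * a)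
      ⟨_, lp.norm_apply_le_norm ENNReal.top_ne_zero (constSeq a * x)⟩
      ⟨_, lp.norm_apply_le_norm ENNReal.top_ne_zero (x * constSeq a)⟩).1 this).symm
  · rw [show CStarQuotient.mk (annihilator A) y' = _ from hyz.symm]
    change CStarQuotient.mk _ _ = CStarQuotient.mk _ _
    congr 1
    exact Subtype.ext hxy

/-- The class of an approximate unit is a unit of the central sequence algebra. -/
lemma toClass_mul_eq (hx : IsCentralSeq x) (h : ∀ a, (fun n => x n * a) ≋ fun _ => a)
    (z : CentralSequenceAlgebra A) : hx.toClass * z = z := by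
  obtain ⟨y, hy, rfl⟩ := exists_rep z
  rw [← toClass_mul, toClass_eq_iff]
  intro a
  obtain ⟨C, hC⟩ := hx.bounded
  obtain ⟨D, hD⟩ := hy.bounded
  have h1 := (hy.central a).mul_left hC
  have h2 := (h a).mul_right hD
  simp only [mul_assoc] at h1 h2 ⊢
  exact (h1.trans h2).trans (hy.central a).symm

end IsCentralSeq

end CentralSequences

/-! ### The Rokhlin property by families of sequences -/

section Rokhlin

variable {G H A : Type*} [CommGroup G] [TopologicalSpace G] [IsTopologicalGroup G] [CompactSpace G]
  [CommGroup H] [NonUnitalCStarAlgebra A]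

/-- A family of sequences, indexed by a group of characters, that witnesses the Rokhlin
property. -/
structure IsRokhlin (e : H →* PontryaginDual G) (α : CStarAction G A) (w : H → ℕ → A) : Prop where
  central : ∀ h, IsCentralSeq (w h)
  star_mul : ∀ h a, (fun n => star (w h n) * (w h n * a)) ≋ fun _ => a
  mul : ∀ g h a, (fun n => w g n * (w h n * a)) ≋ fun n => w (g * h) n * a
  equivariant : ∀ g h a, (fun n => α g (w h n) * a) ≋ fun n => star (e h g : ℂ) • (w h n * a)

lemma groupShift_toContinuousMap (g : G) (χ : PontryaginDual G) :
    groupShift g χ.toContinuousMap = star (χ g : ℂ) • χ.toContinuousMap := by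
  ext h
  change ((χ (g⁻¹ * h) : Circle) : ℂ) = star (χ g : ℂ) * (χ h : ℂ)
  rw [map_mul, map_inv, Circle.coe_mul, Circle.coe_inv_eq_conj]
  rfl

/-- The classes of the sequences are a unitary representation of H with unit w_1, hence extend to
C(G). Equivariance holds on characters by assumption and passes to their closed span. -/
lemma IsRokhlin.hasRokhlinProperty {e : H →* PontryaginDual G} (he : IsDualPairing e)
    {α : CStarAction G A} {w : H → ℕ → A} (hw : IsRokhlin e α w) : HasRokhlinProperty α := by
  have hunit : ∀ h z, star (hw.central h).toClass * (hw.central h).toClass * z = z := fun h z => by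
    rw [← IsCentralSeq.toClass_star, ← IsCentralSeq.toClass_mul]
    refine IsCentralSeq.toClass_mul_eq _ (fun a => ?_) z
    simpa only [mul_assoc] using hw.star_mul h a
  have hmul : ∀ g h, (hw.central (g * h)).toClass =
      (hw.central g).toClass * (hw.central h).toClass := fun g h => by
    rw [← IsCentralSeq.toClass_mul, IsCentralSeq.toClass_eq_iff]
    intro a
    simpa only [mul_assoc] using (hw.mul g h a).symm
  -- Each w_h⋆ w_h is a self-adjoint left unit, hence a two-sided unit. All of these therefore
  -- coincide, and multiplicativity at 1 identifies the common value with w_1.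
  have hone : ∀ h, star (hw.central h).toClass * (hw.central h).toClass =
      (hw.central 1).toClass := by
    have h1 : star (hw.central 1).toClass * (hw.central 1).toClass = (hw.central 1).toClass := by
      calc star (hw.central 1).toClass * (hw.central 1).toClass
          = star (hw.central 1).toClass * (hw.central 1).toClass * (hw.central 1).toClass := by
            rw [mul_assoc, ← hmul 1 1]
            simp
        _ = _ := hunit 1 _
    intro h
    have hs : star (star (hw.central h).toClass * (hw.central h).toClass) =
        star (hw.central h).toClass * (hw.central h).toClass := by rw [StarMul.star_mul, star_star]
    have h2 : ∀ z, z * (star (hw.central h).toClass * (hw.central h).toClass) = z := fun z => by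
      rw [← star_star (z * _), StarMul.star_mul, hs, hunit, star_star]
    rw [← h1, ← hunit 1 (star (hw.central h).toClass * (hw.central h).toClass), h2]
  obtain ⟨Φ, hΦ⟩ := he.exists_hom (fun h => (hw.central h).toClass)
    (fun z => by rw [← hone 1]; exact hunit 1 z) hmul hone
  have hΦc : Continuous Φ := AddMonoidHomClass.continuous_of_bound Φ 1 fun a => by
    simpa using NonUnitalStarAlgHom.norm_apply_le Φ a
  have hequi : ∀ g f, Φ (groupShift g f) = centralMap (α g) (Φ f) := fun g f => by
    have hcl : IsClosed {f | Φ (groupShift g f) = centralMap (α g) (Φ f)} := by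
      refine isClosed_eq (hΦc.comp ?_) (Continuous.comp ?_ hΦc)
      · exact ContinuousMap.continuous_precomp
          (⟨fun h => g⁻¹ * h, continuous_const_mul g⁻¹⟩ : C(G, G))
      · exact AddMonoidHomClass.continuous_of_bound (centralMap (α g)) 1 fun a => by
          simpa using NonUnitalStarAlgHom.norm_apply_le (centralMap (α g)) a
    refine hcl.closure_subset_iff.2 ?_ (dense_span_characters e he.separates f)
    intro f hf
    induction hf using Submodule.span_induction with
    | mem f hf =>
      obtain ⟨h, rfl⟩ := hf
      change Φ (groupShift g (e h).toContinuousMap) = centralMap (α g) (Φ (e h).toContinuousMap)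
      rw [groupShift_toContinuousMap, map_smul, hΦ, IsCentralSeq.centralMap_toClass,
        ← IsCentralSeq.toClass_smul, eq_comm, IsCentralSeq.toClass_eq_iff]
      intro a
      simpa only [smul_mul_assoc] using hw.equivariant g h a
    | zero =>
      change Φ (groupShift g 0) = _
      rw [show groupShift g (0 : C(G, ℂ)) = 0 from rfl, map_zero, map_zero]
    | add x y _ _ hx hy =>
      change Φ (groupShift g x + groupShift g y) = _
      rw [map_add, map_add, map_add, hx, hy]
    | smul c x _ hx =>
      change Φ (c • groupShift g x) = _
      rw [map_smul, map_smul, map_smul, hx]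
  refine ⟨NonUnitalStarAlgHom.codRestrict Φ (continuousCentral α) fun f => ?_, fun x => ?_,
    fun g f => hequi g f⟩
  · change Continuous fun g => centralMap (α g) (Φ f)
    simp only [← hequi]
    refine hΦc.comp ?_
    -- Currying shows that translation is continuous in the uniform norm, so the image of C(G)
    -- consists of elements with continuous orbits.
    let F : C(G × G, ℂ) := ⟨fun p => f (p.1⁻¹ * p.2), by fun_prop⟩
    exact F.curry.continuous
  · have h1 : Φ 1 = (hw.central 1).toClass := by
      rw [← hΦ 1]
      congr 1
      ext
      simp
    have h2 : ∀ z, (hw.central 1).toClass * z = z := fun z => by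
      rw [← hone 1]; exact hunit 1 z
    have hs : star (hw.central 1).toClass = (hw.central 1).toClass := by
      rw [← hone 1, StarMul.star_mul, star_star]
    refine ⟨Subtype.ext ?_, Subtype.ext ?_⟩
    · change Φ 1 * (x : CentralSequenceAlgebra A) = x
      rw [h1, h2]
    · change (x : CentralSequenceAlgebra A) * Φ 1 = x
      rw [h1, ← star_star ((x : CentralSequenceAlgebra A) * _), StarMul.star_mul, hs, h2, star_star]

/-- The images of the characters are contractions, so they have contractive representatives.
Separability supplies a sequence representing the unit. -/
lemma HasRokhlinProperty.exists_isRokhlin [TopologicalSpace.SeparableSpace A]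
    (e : H →* PontryaginDual G) {α : CStarAction G A} (hα : HasRokhlinProperty α) :
    ∃ w : H → ℕ → A, IsRokhlin e α w ∧ ∀ h n, ‖w h n‖ ≤ 1 := by
  obtain ⟨φ, hφ1, hφ⟩ := hα
  let Φ : C(G, ℂ) →⋆ₙₐ[ℂ] CentralSequenceAlgebra A :=
    (NonUnitalStarSubalgebraClass.subtype (continuousCentral α)).comp φ
  have hz : ∀ h, ‖Φ (e h).toContinuousMap‖ ≤ 1 := fun h => by
    refine (NonUnitalStarAlgHom.norm_apply_le Φ _).trans ?_
    rw [ContinuousMap.norm_le _ zero_le_one]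
    intro g
    exact (Circle.norm_coe _).le
  choose w hw hw1 hwz using fun h => IsCentralSeq.exists_rep_norm_le _ (hz h)
  obtain ⟨u, hu1, hu2, hu3, hu4⟩ := exists_approxUnit_sequence (A := A)
  have hu : IsCentralSeq u := .of_tendsto hu1 hu3 hu4
  -- The homomorphism is unital only relative to the continuous part. The class of the approximate
  -- unit is invariant, hence lies in that part, and it is a unit for the whole algebra; so the two
  -- units agree.
  have hunit : Φ 1 = hu.toClass := by
    have hmem : hu.toClass ∈ continuousCentral α := by
      change Continuous fun g => centralMap (α g) hu.toClass
      have : ∀ g, centralMap (α g) hu.toClass = hu.toClass := fun g => by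
        rw [IsCentralSeq.centralMap_toClass, IsCentralSeq.toClass_eq_iff]
        intro a
        refine AsympEq.trans ?_ (hu3 a).symm
        simpa using (hu3 ((α g).symm a)).map_equiv (α g)
      simp only [this]
      exact continuous_const
    have h1 : Φ 1 * hu.toClass = hu.toClass :=
      congrArg Subtype.val (hφ1 ⟨hu.toClass, hmem⟩).1
    have h2 : ∀ z, z * hu.toClass = z := fun z => by
      have hs : star hu.toClass = hu.toClass := by
        rw [← IsCentralSeq.toClass_star, IsCentralSeq.toClass_eq_iff]
        intro a
        simp only [hu2]
        exact .refl _
      rw [← star_star (z * _), star_mul, hs, hu.toClass_mul_eq hu3, star_star]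
    rw [← h2 (Φ 1), h1]
  refine ⟨w, ⟨hw, fun h a => ?_, fun g h a => ?_, fun g h a => ?_⟩, hw1⟩
  · have : star (hw h).toClass * (hw h).toClass = hu.toClass := by
      rw [← hunit, hwz, ← map_star, ← map_mul]
      congr 1
      ext g
      change star ((e h g : Circle) : ℂ) * ((e h g : Circle) : ℂ) = 1
      have := Circle.coe_inv_eq_conj (e h g)
      rw [← starRingEnd_apply, ← this, ← Circle.coe_mul, inv_mul_cancel, Circle.coe_one]
    rw [← IsCentralSeq.toClass_star, ← IsCentralSeq.toClass_mul, IsCentralSeq.toClass_eq_iff]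
      at this
    refine AsympEq.trans ?_ (hu3 a)
    simpa only [mul_assoc] using this a
  · have : (hw g).toClass * (hw h).toClass = (hw (g * h)).toClass := by
      rw [hwz, hwz, hwz, ← map_mul, map_mul e]
      rfl
    rw [← IsCentralSeq.toClass_mul, IsCentralSeq.toClass_eq_iff] at this
    simpa only [mul_assoc] using this a
  · have : centralMap (α g) (hw h).toClass = star (e h g : ℂ) • (hw h).toClass := by
      rw [hwz, ← map_smul, ← groupShift_toContinuousMap]
      exact (hφ g _).symm
    rw [IsCentralSeq.centralMap_toClass, ← IsCentralSeq.toClass_smul,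
      IsCentralSeq.toClass_eq_iff] at this
    simpa only [smul_mul_assoc] using this a

end Rokhlin

/-! ### Integration over compact groups and orthogonality of characters -/

section CompactGroup

variable {G A : Type*} [CommGroup G] [TopologicalSpace G] [IsTopologicalGroup G] [CompactSpace G]
  [MeasurableSpace G] [BorelSpace G] [NonUnitalCStarAlgebra A] {α : CStarAction G A}
  {μ : Measure G} [IsFiniteMeasureOnCompacts μ] [μ.IsMulLeftInvariant]

/-- A continuous function on a compact group as an element of the convolution algebra. -/
def ConvAlg.ofContinuousMap (f : C(G, A)) : ConvAlg α μ :=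
  ConvAlg.mk f f.continuous (HasCompactSupport.of_compactSpace f)

@[simp] lemma ConvAlg.ofContinuousMap_apply (f : C(G, A)) (s : G) :
    (ConvAlg.ofContinuousMap f : ConvAlg α μ) s = f s := rfl

lemma ConvAlg.norm_ofContinuousMap_le (f : C(G, A)) :
    ‖(ConvAlg.ofContinuousMap f : ConvAlg α μ)‖ ≤ μ.real Set.univ * ‖f‖ := by
  refine (ConvAlg.norm_le_integral _).trans ?_
  have : ∫ s, ‖f s‖ ∂μ ≤ ∫ _, ‖f‖ ∂μ :=
    integral_mono (ConvAlg.integrable_norm (ConvAlg.ofContinuousMap f : ConvAlg α μ))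
      (integrable_const _) fun s => f.norm_coe_le_norm s
  simpa using this

variable (α μ) in
/-- The inclusion of `C(G, A)` into the crossed product. -/
def crossedOfCont : C(G, A) →L[ℂ] CrossedProduct α μ :=
  LinearMap.mkContinuous
    { toFun := fun f => CStarCompletion.of (ConvAlg.ofContinuousMap f)
      map_add' := fun f g => CStarCompletion.of_add (ConvAlg.ofContinuousMap f)
        (ConvAlg.ofContinuousMap g)
      map_smul' := fun c f => CStarCompletion.of_smul c (ConvAlg.ofContinuousMap f) }
    (μ.real Set.univ) fun f => by
    change ‖CStarCompletion.of _‖ ≤ _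
    rw [CStarCompletion.norm_of]
    exact ConvAlg.norm_ofContinuousMap_le f

lemma crossedOfCont_apply (f : C(G, A)) :
    crossedOfCont α μ f = CStarCompletion.of (ConvAlg.ofContinuousMap f) := rfl

end CompactGroup

section IntegralCLM

variable {X E : Type*} [TopologicalSpace X] [CompactSpace X] [MeasurableSpace X] [BorelSpace X]
  [NormedAddCommGroup E] [NormedSpace ℂ E] (μ : Measure X) [IsFiniteMeasureOnCompacts μ]

lemma ContinuousMap.integrable_of_compactSpace (f : C(X, E)) : Integrable f μ :=
  f.continuous.integrable_of_hasCompactSupport (HasCompactSupport.of_compactSpace f)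

/-- Integration of continuous functions on a compact space. -/
def integralCLM : C(X, E) →L[ℂ] E :=
  LinearMap.mkContinuous
    { toFun := fun f => ∫ x, f x ∂μ
      map_add' := fun f g => integral_add (f.integrable_of_compactSpace μ)
        (g.integrable_of_compactSpace μ)
      map_smul' := fun c f => integral_smul c f } (μ.real Set.univ) fun f => by
    refine (norm_integral_le_integral_norm _).trans ?_
    have : ∫ s, ‖f s‖ ∂μ ≤ ∫ _, ‖f‖ ∂μ :=
      integral_mono (f.integrable_of_compactSpace μ).norm
        (integrable_const _) fun s => f.norm_coe_le_norm s
    simpa using this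

end IntegralCLM

section Orthogonality

variable {G : Type*} [CommGroup G] [TopologicalSpace G] [IsTopologicalGroup G]
  [MeasurableSpace G] [BorelSpace G] (μ : Measure G) [μ.IsMulLeftInvariant]

/-- Translating by g with χ(g) ≠ 1 multiplies the integral by χ(g). -/
lemma integral_character_of_ne_one {χ : PontryaginDual G} (hχ : χ ≠ 1) :
    ∫ s, (χ s : ℂ) ∂μ = 0 := by
  obtain ⟨g, hg⟩ : ∃ g, χ g ≠ 1 := by
    by_contra! h
    exact hχ (PontryaginDual.ext h)
  have h1 := integral_mul_left_eq_self (μ := μ) (fun s => (χ s : ℂ)) g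
  simp only [map_mul, Circle.coe_mul] at h1
  rw [integral_const_mul] at h1
  have h2 : ((χ g : ℂ) - 1) * ∫ s, (χ s : ℂ) ∂μ = 0 := by rw [sub_mul, h1, one_mul, sub_self]
  refine (mul_eq_zero.1 h2).resolve_left fun h => hg ?_
  exact Circle.ext (by simpa using sub_eq_zero.1 h)

end Orthogonality

/-! ### Characters separate the points of a compact abelian group -/

section PeterWeyl

open WeakDual

/-- The trivial action on the complex numbers. -/
def trivialAction (G : Type*) [Group G] [TopologicalSpace G] : CStarAction G ℂ where
  toHom := 1
  continuous_apply _ := continuous_const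

variable {G : Type*} [CommGroup G] [TopologicalSpace G] [IsTopologicalGroup G] [CompactSpace G]
  [MeasurableSpace G] [BorelSpace G] {μ : Measure G}

lemma trivialAction_mul_comm [μ.IsHaarMeasure] (f g : ConvAlg (trivialAction G) μ) :
    f * g = g * f := by
  ext s
  rw [ConvAlg.mul_apply, ConvAlg.mul_apply, ← integral_div_left_eq_self _ μ s]
  refine integral_congr_ae (Eventually.of_forall fun t => ?_)
  change f (s / t) * g ((s / t)⁻¹ * s) = g t * f (t⁻¹ * s)
  have h1 : s / t = t⁻¹ * s := by rw [div_eq_mul_inv, mul_comm]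
  have h2 : (t⁻¹ * s)⁻¹ * s = t := by simp
  rw [h1, h2, mul_comm]

instance [μ.IsHaarMeasure] : NonUnitalCommCStarAlgebra (CrossedProduct (trivialAction G) μ) where
  mul_comm x y := by
    revert x; refine CStarCompletion.eq_of_eqOn (continuous_id.mul continuous_const)
      (continuous_const.mul continuous_id) fun f => ?_
    revert y; refine CStarCompletion.eq_of_eqOn (continuous_const.mul continuous_id)
      (continuous_id.mul continuous_const) fun g => ?_
    simp only [← CStarCompletion.of_mul, trivialAction_mul_comm f g]

/-- Left translation of a continuous function. -/
def leftShift (f : C(G, ℂ)) : C(G, C(G, ℂ)) :=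
  ContinuousMap.curry ⟨fun p : G × G => f (p.1⁻¹ * p.2), by fun_prop⟩

lemma leftShift_apply (f : C(G, ℂ)) (g s : G) : leftShift f g s = f (g⁻¹ * s) := rfl

/-- In a convolution product a translation may be moved from one factor to the other. After applying
a character of the algebra, this makes the dependence on the translation multiplicative. -/
lemma leftShift_mul_right [μ.IsHaarMeasure] (f k : C(G, ℂ)) (g h : G) :
    (ConvAlg.ofContinuousMap (leftShift f (g * h)) : ConvAlg (trivialAction G) μ) *
      ConvAlg.ofContinuousMap k =
    ConvAlg.ofContinuousMap (leftShift f g) * ConvAlg.ofContinuousMap (leftShift k h) := by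
  ext s
  rw [ConvAlg.mul_apply, ConvAlg.mul_apply, ← integral_mul_left_eq_self _ h]
  refine integral_congr_ae (Eventually.of_forall fun t => ?_)
  change f ((g * h)⁻¹ * (h * t)) * k ((h * t)⁻¹ * s) = f (g⁻¹ * t) * k (h⁻¹ * (t⁻¹ * s))
  congr 2
  · rw [mul_inv, mul_assoc, inv_mul_cancel_left]
  · rw [mul_inv, mul_assoc]

variable (μ) in
-- The C⋆-algebra of G is commutative, so some multiplicative functional ω is nonzero on f₀ = L_{g₀}
-- f - f, which is nonzero there by faithfulness on C(G). The quotient ω(L_g f₀) / ω(f₀) is then a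
-- character of G; the choice of f₀ forces it to be nontrivial at g₀.
lemma exists_character_ne_one [T2Space G] [μ.IsHaarMeasure] {g₀ : G} (hg₀ : g₀ ≠ 1) :
    ∃ χ : PontryaginDual G, χ g₀ ≠ 1 := by
  let J := crossedOfCont (trivialAction G) μ
  have hJmul : ∀ (f k : C(G, ℂ)) (g h : G),
      J (leftShift f (g * h)) * J k = J (leftShift f g) * J (leftShift k h) := fun f k g h => by
    simp only [J, crossedOfCont_apply, ← CStarCompletion.of_mul, leftShift_mul_right]
  have hshift1 : ∀ f : C(G, ℂ), leftShift f 1 = f := fun f => by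
    ext s; simp [leftShift_apply]
  obtain ⟨f, hf⟩ : ∃ f : C(G, ℂ), leftShift f g₀ - f ≠ 0 := by
    obtain ⟨f, hf0, hf1, -⟩ := exists_continuous_zero_one_of_isClosed
      (isClosed_singleton (x := (1 : G))) (isClosed_singleton (x := g₀)) (by simpa using hg₀.symm)
    refine ⟨⟨fun s => (f s : ℂ), by fun_prop⟩, fun h => ?_⟩
    have h1 := DFunLike.congr_fun h g₀
    have h2 : f 1 = 0 := hf0 rfl
    have h3 : f g₀ = 1 := hf1 rfl
    simp [leftShift_apply, h2, h3] at h1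
  set f₀ := leftShift f g₀ - f with hf₀
  have hJ0 : J f₀ ≠ 0 := fun h => by
    have h1 : ‖(ConvAlg.ofContinuousMap f₀ : ConvAlg (trivialAction G) μ)‖ = 0 := by
      rw [← CStarCompletion.norm_of, ← crossedOfCont_apply]
      exact norm_eq_zero.2 h
    refine hf (ContinuousMap.ext fun s => ?_)
    exact DFunLike.congr_fun (ConvAlg.eq_zero_of_norm_eq_zero h1) s
  -- The Gelfand transform is isometric for unital algebras, so the functional is found on the
  -- unitization.
  obtain ⟨ω, hω⟩ : ∃ ω : characterSpace ℂ (Unitization ℂ (CrossedProduct (trivialAction G) μ)),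
      ω (J f₀ : Unitization ℂ _) ≠ 0 := by
    by_contra! h
    have h1 : gelfandTransform ℂ _ (J f₀ : Unitization ℂ (CrossedProduct (trivialAction G) μ))
        = gelfandTransform ℂ _ 0 := by
      ext ω
      rw [map_zero]
      exact h ω
    exact hJ0 (Unitization.inr_injective ((gelfandTransform_isometry _).injective h1))
  let Ω : C(G, ℂ) → ℂ := fun k => ω (J k : Unitization ℂ (CrossedProduct (trivialAction G) μ))
  have hΩc : Continuous Ω :=
    (map_continuous ω).comp (Unitization.isometry_inr.continuous.comp J.continuous)
  have hΩsub : ∀ k l, Ω (k - l) = Ω k - Ω l := fun k l => by simp [Ω]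
  have hΩmul : ∀ (f k : C(G, ℂ)) (g h : G),
      Ω (leftShift f (g * h)) * Ω k = Ω (leftShift f g) * Ω (leftShift k h) := fun f k g h => by
    simp only [Ω, ← map_mul, ← Unitization.inr_mul, hJmul]
  let c : G → ℂ := fun g => Ω (leftShift f₀ g) / Ω f₀
  have hc1 : c 1 = 1 := by simp only [c, hshift1]; exact div_self hω
  have hcmul : ∀ g h, c (g * h) = c g * c h := fun g h => by
    have h1 := hΩmul f₀ f₀ g h
    simp only [c]
    have : Ω f₀ ≠ 0 := hω
    field_simp
    exact h1
  have hcc : Continuous c := (hΩc.comp (leftShift f₀).continuous).div_const _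
  -- The function c is bounded by compactness; an absolute value above 1 would grow along powers,
  -- and one below 1 is excluded by passing to the inverse.
  have hcnorm : ∀ g, ‖c g‖ = 1 := by
    obtain ⟨C, hC⟩ : ∃ C, ∀ g, ‖c g‖ ≤ C := by
      obtain ⟨C, hC⟩ := isCompact_univ.exists_bound_of_continuousOn hcc.continuousOn
      exact ⟨C, fun g => hC g trivial⟩
    have hpow : ∀ g (n : ℕ), c (g ^ n) = c g ^ n := fun g n => by
      induction n with
      | zero => simpa using hc1
      | succ n ih => rw [pow_succ, pow_succ, hcmul, ih]
    have hle : ∀ g, ‖c g‖ ≤ 1 := fun g => by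
      by_contra! hgt
      obtain ⟨n, hn⟩ := pow_unbounded_of_one_lt C hgt
      have := hC (g ^ n)
      rw [hpow, norm_pow] at this
      linarith
    intro g
    refine le_antisymm (hle g) ?_
    have h1 : ‖c g‖ * ‖c g⁻¹‖ = 1 := by rw [← norm_mul, ← hcmul, mul_inv_cancel, hc1, norm_one]
    nlinarith [hle g⁻¹, norm_nonneg (c g)]
  let χ : G →ₜ* Circle :=
    { toFun := fun g => ⟨c g, mem_sphere_zero_iff_norm.2 (hcnorm g)⟩
      map_one' := Circle.ext hc1
      map_mul' := fun g h => Circle.ext (hcmul g h)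
      continuous_toFun := hcc.subtype_mk _ }
  refine ⟨(χ : PontryaginDual G), fun h => ?_⟩
  have hcg : c g₀ = 1 := congrArg Subtype.val h
  -- If c(g₀) = 1, moving g₀ from f to f₀ gives ω(L_{g₀} f) = ω(f), that is ω(f₀) = 0.
  have h1 := hΩmul f f₀ 1 g₀
  rw [one_mul, hshift1] at h1
  have h2 : Ω (leftShift f₀ g₀) = Ω f₀ := (div_eq_one_iff_eq hω).1 hcg
  rw [h2] at h1
  have h3 : Ω (leftShift f g₀) = Ω f := mul_right_cancel₀ hω h1
  exact hω (by change Ω f₀ = 0; rw [hf₀, hΩsub, h3, sub_self])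

end PeterWeyl

/-! ### Pontryagin duality for discrete and for compact groups -/

section Pairings

/-- Evaluation of characters at a point of the group. -/
def evalCharacter (H : Type*) [CommGroup H] [TopologicalSpace H] [IsTopologicalGroup H]
    [LocallyCompactSpace H] : H →* PontryaginDual (PontryaginDual H) where
  toFun h := ({ toFun := fun χ => χ h
                map_one' := rfl
                map_mul' := fun _ _ => rfl
                continuous_toFun := ((ContinuousMonoidHom.instContinuousEval (A := H)
                  (B := Circle)).continuous_eval).comp
                    (continuous_id.prodMk continuous_const) } : PontryaginDual H →ₜ* Circle)
  map_one' := PontryaginDual.ext fun χ => map_one χ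
  map_mul' g h := PontryaginDual.ext fun χ => map_mul χ g h

lemma evalCharacter_apply {H : Type*} [CommGroup H] [TopologicalSpace H] [IsTopologicalGroup H]
    [LocallyCompactSpace H] (h : H) (χ : PontryaginDual H) : evalCharacter H h χ = χ h := rfl

lemma isDualPairing_evalCharacter (H : Type*) [CommGroup H] [TopologicalSpace H]
    [IsTopologicalGroup H] [DiscreteTopology H] : IsDualPairing (evalCharacter H) where
  separates _ _ h := PontryaginDual.ext h
  exists_eval ξ :=
    ⟨({ ξ with continuous_toFun := continuous_of_discreteTopology } : H →ₜ* Circle), fun _ => rfl⟩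

/-- The image of Haar measure under the evaluation map j into the double dual X is, up to scaling,
Haar measure on X, because both integrate all nontrivial characters to zero. Haar measure has full
support and the image of j is closed, so j is onto. -/
lemma isDualPairing_id (G : Type*) [CommGroup G] [TopologicalSpace G] [IsTopologicalGroup G]
    [CompactSpace G] [T2Space G] : IsDualPairing (MonoidHom.id (PontryaginDual G)) where
  separates g g' h := by
    borelize G
    by_contra hne
    obtain ⟨χ, hχ⟩ := exists_character_ne_one (Measure.haar : Measure G) (g₀ := g * g'⁻¹)
      (by rwa [ne_eq, mul_inv_eq_one])
    refine hχ ?_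
    rw [map_mul, map_inv, mul_inv_eq_one]
    exact h χ
  exists_eval ξ := by
    borelize G
    let X := PontryaginDual (PontryaginDual G)
    borelize X
    let μ : Measure G := Measure.haar
    let lam : Measure X := Measure.haar
    let e := evalCharacter (PontryaginDual G)
    have he : IsDualPairing e := isDualPairing_evalCharacter _
    let j : C(G, X) := ⟨evalCharacter G, by
      have : IsInducing (fun (ξ : X) (χ : PontryaginDual G) => ξ χ) :=
        ContinuousMonoidHom.isClosedEmbedding_coe.isInducing
      exact this.continuous_iff.2 (continuous_pi fun χ => map_continuous χ)⟩
    -- Neither measure is normalised, hence the crosswise total masses. Only the characters of X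
    -- given by elements of the dual of G are tested; they separate the points of X, so their span
    -- is dense.
    have hint : ∀ F : C(X, ℂ),
        lam.real Set.univ • integralCLM μ (F.comp j) = μ.real Set.univ • integralCLM lam F := by
      intro F
      have hF := dense_span_characters e he.separates F
      refine closure_minimal (t := {F : C(X, ℂ) | lam.real Set.univ • integralCLM μ (F.comp j) =
        μ.real Set.univ • integralCLM lam F}) ?_ (isClosed_eq ?_ ?_) hF
      · intro F hF
        induction hF using Submodule.span_induction with
        | mem F hF =>
          obtain ⟨χ, rfl⟩ := hF
          change _ = _
          have h1 : integralCLM μ ((e χ).toContinuousMap.comp j) = ∫ s, (χ s : ℂ) ∂μ := rfl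
          have h2 : integralCLM lam (e χ).toContinuousMap = ∫ s, (e χ s : ℂ) ∂lam := rfl
          rw [h1, h2]
          by_cases hχ : χ = 1
          · subst hχ
            simp [mul_comm]
          · rw [integral_character_of_ne_one μ hχ, integral_character_of_ne_one lam, smul_zero,
              smul_zero]
            intro h
            refine hχ (PontryaginDual.ext fun g => ?_)
            exact DFunLike.congr_fun h (j g)
        | zero => change _ = _; simp [ContinuousMap.zero_comp]
        | add F F' _ _ h h' =>
          change _ = _ at h h' ⊢
          rw [ContinuousMap.add_comp, map_add, map_add, smul_add, smul_add, h, h']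
        | smul c F _ h =>
          change _ = _ at h ⊢
          rw [ContinuousMap.smul_comp, map_smul, map_smul, smul_comm, h, smul_comm]
      · exact ((integralCLM (E := ℂ) μ).continuous.comp
          (ContinuousMap.continuous_precomp j)).fun_const_smul _
      · exact (integralCLM lam).continuous.fun_const_smul _
    have hsurj : Function.Surjective j := by
      intro x
      by_contra hx
      have hcl : IsClosed (Set.range j) := (isCompact_range j.continuous).isClosed
      -- A bump function that vanishes on the image but not at x has integral zero on one side and
      -- positive integral on the other.
      obtain ⟨f, hf0, hf1, hf⟩ := exists_continuous_zero_one_of_isClosed hcl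
        (isClosed_singleton (x := x)) (by simpa using hx)
      have h1 := hint ⟨fun y => (f y : ℂ), by fun_prop⟩
      have h2 : integralCLM μ ((⟨fun y => (f y : ℂ), by fun_prop⟩ : C(X, ℂ)).comp j) = 0 := by
        change ∫ s, (f (j s) : ℂ) ∂μ = 0
        simp [show ∀ s, f (j s) = 0 from fun s => hf0 ⟨s, rfl⟩]
      have h3 : integralCLM lam (⟨fun y => (f y : ℂ), by fun_prop⟩ : C(X, ℂ)) =
          ((∫ y, f y ∂lam : ℝ) : ℂ) := integral_ofReal
      have h4 : 0 < ∫ y, f y ∂lam :=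
        f.continuous.integral_pos_of_hasCompactSupport_nonneg_nonzero
          (HasCompactSupport.of_compactSpace _) (fun y => (hf y).1) (x := x)
          (by rw [hf1 rfl]; exact one_ne_zero)
      have h5 : 0 < μ.real Set.univ := measureReal_univ_pos
      rw [h2, h3, smul_zero] at h1
      have := h1.symm
      simp [h5.ne', h4.ne'] at this
    obtain ⟨g, hg⟩ := hsurj
      ({ ξ with continuous_toFun := continuous_of_discreteTopology } : PontryaginDual G →ₜ* Circle)
    exact ⟨g, fun χ => DFunLike.congr_fun hg χ⟩

end Pairings

/-! ### Testing asymptotic relations on dense subspaces; perturbing Rokhlin families -/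

namespace CStarCompletion

variable {R : Type*} [PreCStarAlgebra R]

variable (R) in
/-- The canonical map into the completion, as a linear map. -/
def ofLinear : R →ₗ[ℂ] CStarCompletion R where
  toFun := of
  map_add' := of_add
  map_smul' := of_smul

lemma of_sub (f g : R) : (of (f - g) : CStarCompletion R) = of f - of g :=
  map_sub (ofLinear R) f g

end CStarCompletion

section Multiplication

variable {B : Type*} [NonUnitalCStarAlgebra B] {s : Set B}

lemma norm_mulLeftCLM_le {y : ℕ → B} {C : ℝ} (hy : ∀ n, ‖y n‖ ≤ C) (n : ℕ) :
    ‖ContinuousLinearMap.mul ℂ B (y n)‖ ≤ C :=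
  (ContinuousLinearMap.opNorm_mul_apply_le ℂ B _).trans (hy n)

lemma norm_mulRightCLM_le {y : ℕ → B} {C : ℝ} (hy : ∀ n, ‖y n‖ ≤ C) (n : ℕ) :
    ‖(ContinuousLinearMap.mul ℂ B).flip (y n)‖ ≤ C :=
  ContinuousLinearMap.opNorm_le_bound _ ((norm_nonneg _).trans (hy n)) fun x => by
    refine (norm_mul_le x (y n)).trans ?_
    rw [mul_comm]
    exact mul_le_mul_of_nonneg_right (hy n) (norm_nonneg _)

lemma norm_seq_mul_le {y z : ℕ → B} {C D : ℝ} (hy : ∀ n, ‖y n‖ ≤ C) (hz : ∀ n, ‖z n‖ ≤ D)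
    (n : ℕ) : ‖y n * z n‖ ≤ C * D :=
  (norm_mul_le _ _).trans (mul_le_mul (hy n) (hz n) (norm_nonneg _)
    ((norm_nonneg _).trans (hy n)))

/-- Bounded sequences of left multipliers that agree asymptotically on a set with dense span agree
asymptotically everywhere. -/
lemma AsympEq.mul_of_dense_span (hs : ∀ b, b ∈ closure (Submodule.span ℂ s : Set B))
    {y z : ℕ → B} {C D : ℝ} (hy : ∀ n, ‖y n‖ ≤ C) (hz : ∀ n, ‖z n‖ ≤ D)
    (h : ∀ b ∈ s, (fun n => y n * b) ≋ fun n => z n * b) (b : B) :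
    (fun n => y n * b) ≋ fun n => z n * b :=
  AsympEq.of_mem_closure (T := fun n => ContinuousLinearMap.mul ℂ B (y n))
    (S := fun n => ContinuousLinearMap.mul ℂ B (z n)) (C := max C D)
    (fun n => (norm_mulLeftCLM_le hy n).trans (le_max_left _ _))
    (fun n => (norm_mulLeftCLM_le hz n).trans (le_max_right _ _)) h (hs b)

lemma AsympEq.mul_eq_self_of_dense_span (hs : ∀ b, b ∈ closure (Submodule.span ℂ s : Set B))
    {y : ℕ → B} {C : ℝ} (hy : ∀ n, ‖y n‖ ≤ C)
    (h : ∀ b ∈ s, (fun n => y n * b) ≋ fun _ => b) (b : B) :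
    (fun n => y n * b) ≋ fun _ => b :=
  AsympEq.of_mem_closure (T := fun n => ContinuousLinearMap.mul ℂ B (y n))
    (S := fun _ => ContinuousLinearMap.id ℂ B) (C := max C 1)
    (fun n => (norm_mulLeftCLM_le hy n).trans (le_max_left _ _))
    (fun _ => ContinuousLinearMap.norm_id_le.trans (le_max_right _ _)) h (hs b)

/-- Asymptotic twisted commutation can be checked on a set with dense span. -/
lemma AsympEq.mul_comm_of_dense_span (hs : ∀ b, b ∈ closure (Submodule.span ℂ s : Set B))
    (σ : B ≃⋆ₐ[ℂ] B) {y : ℕ → B} {C : ℝ} (hy : ∀ n, ‖y n‖ ≤ C)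
    (h : ∀ b ∈ s, (fun n => y n * b) ≋ fun n => σ b * y n) (b : B) :
    (fun n => y n * b) ≋ fun n => σ b * y n := by
  let S : B →L[ℂ] B := LinearMap.mkContinuous
    { toFun := σ, map_add' := map_add σ, map_smul' := map_smul σ } 1 fun b => by
      rw [one_mul]; exact (StarAlgEquiv.norm_map σ b).le
  have hσ : ‖S‖ ≤ 1 := LinearMap.mkContinuous_norm_le _ zero_le_one _
  have hC : 0 ≤ C := (norm_nonneg _).trans (hy 0)
  exact AsympEq.of_mem_closure (T := fun n => ContinuousLinearMap.mul ℂ B (y n))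
    (S := fun n => ((ContinuousLinearMap.mul ℂ B).flip (y n)).comp S) (C := C)
    (norm_mulLeftCLM_le hy)
    (fun n => (ContinuousLinearMap.opNorm_comp_le _ _).trans ((mul_le_mul
      (norm_mulRightCLM_le hy n) hσ (norm_nonneg _) hC).trans_eq (mul_one C))) h (hs b)

end Multiplication

section Perturbation

variable {G H A : Type*} [CommGroup G] [TopologicalSpace G] [CommGroup H]
  [NonUnitalCStarAlgebra A]

/-- Being a Rokhlin family only depends on the multipliers that the sequences define. -/
lemma IsRokhlin.congr {e : H →* PontryaginDual G} {α : CStarAction G A} {u w : H → ℕ → A}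
    {C : ℝ} (hw : IsRokhlin e α w) (hu : ∀ h n, ‖u h n‖ ≤ C) (hn : ∀ h n, ‖w h n‖ ≤ C)
    (hl : ∀ h a, (fun n => u h n * a) ≋ fun n => w h n * a)
    (hr : ∀ h a, (fun n => a * u h n) ≋ fun n => a * w h n) : IsRokhlin e α u where
  central h := ⟨⟨C, hu h⟩, fun a =>
    (hl h a).trans (((hw.central h).central a).trans (hr h a).symm)⟩
  star_mul h a := by
    have hus : ∀ n, ‖star (u h n)‖ ≤ C := fun n => (norm_star _).trans_le (hu h n)
    have hws : ∀ n, ‖star (w h n)‖ ≤ C := fun n => (norm_star _).trans_le (hn h n)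
    -- One sequence can be replaced by the other only when adjacent to a fixed element. After the
    -- right factor is replaced, centrality carries a to the left, next to the remaining factor, and
    -- back afterwards.
    have h3 := (hw.central h).central a
    have h6 := (hr h (star a)).star.mul_right (hn h)
    simp only [StarMul.star_mul, star_star, mul_assoc] at h6
    exact ((hl h a).mul_left hus).trans ((h3.mul_left hus).trans
      (h6.trans ((h3.mul_left hws).symm.trans (hw.star_mul h a))))
  mul g h a := by
    have h3 := (hw.central h).central a
    have h6 := (hl g a).mul_right (hn h)
    simp only [mul_assoc] at h6
    exact ((hl h a).mul_left (hu g)).trans ((h3.mul_left (hu g)).trans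
      (h6.trans ((h3.mul_left (hn g)).symm.trans ((hw.mul g h a).trans (hl (g * h) a).symm))))
  equivariant g h a := by
    have h1 := (hl h (α g⁻¹ a)).map_equiv (α g)
    simp only [map_mul (α g), CStarAction.apply_inv_apply] at h1
    exact h1.trans ((hw.equivariant g h a).trans ((hl h a).symm.smul _))

end Perturbation

/-! ### Crossed products by discrete groups -/

section Discrete

variable {H A : Type*} [CommGroup H] [TopologicalSpace H] [IsTopologicalGroup H]
  [DiscreteTopology H] [MeasurableSpace H] [BorelSpace H] [NonUnitalCStarAlgebra A]
  {β : CStarAction H A} {ν : Measure H} [ν.IsHaarMeasure]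

variable (ν) in
lemma haar_real_singleton_pos : 0 < ν.real {(1 : H)} := by
  rw [measureReal_def]
  refine ENNReal.toReal_pos ?_ ?_
  · exact (isOpen_discrete ({1} : Set H)).measure_ne_zero ν (Set.singleton_nonempty 1)
  · exact (isCompact_singleton (x := (1 : H))).measure_lt_top.ne

lemma integral_eq_of_forall_ne {E : Type*} [NormedAddCommGroup E] [NormedSpace ℝ E]
    [CompleteSpace E] {F : H → E} (h : H) (hF : ∀ t, t ≠ h → F t = 0) :
    ∫ t, F t ∂ν = ν.real {(1 : H)} • F h := by
  rw [← setIntegral_eq_integral_of_forall_compl_eq_zero (s := {h}) (fun t ht => hF t ht),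
    integral_singleton, measureReal_def, Measure.haar_singleton, ← measureReal_def]

/-- The function with value `a` at `h` and zero elsewhere. -/
def ConvAlg.single (h : H) (a : A) : ConvAlg β ν :=
  ConvAlg.mk (open Classical in fun t => if t = h then a else 0) continuous_of_discreteTopology
    (HasCompactSupport.intro (isCompact_singleton (x := h)) fun _ ht => if_neg ht)

lemma ConvAlg.single_self (h : H) (a : A) : (ConvAlg.single h a : ConvAlg β ν) h = a :=
  if_pos rfl

lemma ConvAlg.single_of_ne {h t : H} (ht : t ≠ h) (a : A) :
    (ConvAlg.single h a : ConvAlg β ν) t = 0 :=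
  if_neg ht

lemma ConvAlg.single_add (h : H) (a b : A) :
    (ConvAlg.single h (a + b) : ConvAlg β ν) = ConvAlg.single h a + ConvAlg.single h b := by
  ext t
  by_cases ht : t = h
  · subst ht; simp [ConvAlg.single_self]
  · simp [ConvAlg.single_of_ne ht]

lemma ConvAlg.single_smul (h : H) (c : ℂ) (a : A) :
    (ConvAlg.single h (c • a) : ConvAlg β ν) = c • ConvAlg.single h a := by
  ext t
  by_cases ht : t = h
  · subst ht; simp [ConvAlg.single_self]
  · simp [ConvAlg.single_of_ne ht]

/-- Convolution against ν leaves the mass of a point as a factor. The normalisation in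
`crossedSingle` removes it, so that (a u_h)(b u_k) = a β_h(b) u_{hk} holds exactly. -/
lemma ConvAlg.single_mul_single (h k : H) (a b : A) :
    (ConvAlg.single h a * ConvAlg.single k b : ConvAlg β ν) =
      (ν.real {(1 : H)} : ℂ) • ConvAlg.single (h * k) (a * β h b) := by
  ext s
  rw [ConvAlg.mul_apply, integral_eq_of_forall_ne h fun t ht => by simp [ConvAlg.single_of_ne ht],
    ConvAlg.single_self, ConvAlg.smul_apply, Complex.coe_smul]
  congr 1
  by_cases hs : s = h * k
  · subst hs; simp [ConvAlg.single_self]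
  · rw [ConvAlg.single_of_ne hs, ConvAlg.single_of_ne (fun h' => hs (by rw [← h']; simp)), map_zero,
      mul_zero]

lemma ConvAlg.star_single (h : H) (a : A) :
    star (ConvAlg.single h a : ConvAlg β ν) = ConvAlg.single h⁻¹ (β h⁻¹ (star a)) := by
  ext s
  rw [ConvAlg.star_apply]
  by_cases hs : s = h⁻¹
  · subst hs; simp [ConvAlg.single_self]
  · rw [ConvAlg.single_of_ne hs, ConvAlg.single_of_ne (fun h' => hs (by rw [← h', inv_inv])),
      star_zero, map_zero]

lemma ConvAlg.charMul_single (χ : PontryaginDual H) (h : H) (a : A) :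
    ConvAlg.charMul χ (ConvAlg.single h a : ConvAlg β ν) = (χ h : ℂ) • ConvAlg.single h a := by
  ext s
  by_cases hs : s = h
  · subst hs; simp
  · simp [ConvAlg.single_of_ne hs]

lemma ConvAlg.eq_sum_single (f : ConvAlg β ν) :
    ∃ s : Finset H, f = ∑ h ∈ s, ConvAlg.single h (f h) := by
  have hfin : (tsupport f).Finite := f.hasCompactSupport.isCompact.finite_of_discrete
  refine ⟨hfin.toFinset, ConvAlg.ext fun t => ?_⟩
  let ev : ConvAlg β ν →+ A :=
    { toFun := fun g => g t, map_zero' := rfl, map_add' := fun _ _ => rfl }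
  change _ = ev _
  rw [map_sum]
  change _ = ∑ h ∈ hfin.toFinset, (ConvAlg.single h (f h) : ConvAlg β ν) t
  by_cases ht : t ∈ tsupport f
  · rw [Finset.sum_eq_single t (fun h _ hh => ConvAlg.single_of_ne hh.symm _)
      (fun h => (h (hfin.mem_toFinset.2 ht)).elim), ConvAlg.single_self]
  · rw [ConvAlg.apply_eq_zero ht, Finset.sum_eq_zero]
    intro h hh
    refine ConvAlg.single_of_ne (fun hth => ht ?_) _
    rw [hth]; exact hfin.mem_toFinset.1 hh

variable (β ν) in
/-- The element `a u_h` of the crossed product by a discrete group. -/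
def crossedSingle (h : H) : A →L[ℂ] CrossedProduct β ν :=
  LinearMap.mkContinuous
    { toFun := fun a => (ν.real {(1 : H)} : ℂ)⁻¹ • CStarCompletion.of (ConvAlg.single h a)
      map_add' := fun a b => by rw [ConvAlg.single_add, CStarCompletion.of_add, smul_add]
      map_smul' := fun c a => by
        rw [ConvAlg.single_smul, CStarCompletion.of_smul, smul_comm]; rfl } 1 fun a => by
    have hc := haar_real_singleton_pos ν
    change ‖(ν.real {(1 : H)} : ℂ)⁻¹ • CStarCompletion.of (ConvAlg.single h a : ConvAlg β ν)‖ ≤ _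
    rw [norm_smul, CStarCompletion.norm_of, norm_inv, Complex.norm_real,
      Real.norm_of_nonneg hc.le, one_mul, inv_mul_le_iff₀ hc]
    refine (ConvAlg.norm_le_integral _).trans ?_
    rw [integral_eq_of_forall_ne h fun t ht => by simp [ConvAlg.single_of_ne ht],
      ConvAlg.single_self]
    rfl

lemma crossedSingle_apply (h : H) (a : A) : crossedSingle β ν h a =
    (ν.real {(1 : H)} : ℂ)⁻¹ • CStarCompletion.of (ConvAlg.single h a) := rfl

lemma norm_crossedSingle_le (h : H) (a : A) : ‖crossedSingle β ν h a‖ ≤ ‖a‖ := by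
  have := (crossedSingle β ν h).le_of_opNorm_le
    (LinearMap.mkContinuous_norm_le _ zero_le_one _) a
  rwa [one_mul] at this

lemma crossedSingle_mul (h k : H) (a b : A) :
    crossedSingle β ν h a * crossedSingle β ν k b = crossedSingle β ν (h * k) (a * β h b) := by
  have hc : (ν.real {(1 : H)} : ℂ) ≠ 0 := by exact_mod_cast (haar_real_singleton_pos ν).ne'
  simp only [crossedSingle_apply, smul_mul_assoc, mul_smul_comm, ← CStarCompletion.of_mul,
    ConvAlg.single_mul_single, CStarCompletion.of_smul]
  rw [inv_smul_smul₀ hc]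

lemma star_crossedSingle (h : H) (a : A) :
    star (crossedSingle β ν h a) = crossedSingle β ν h⁻¹ (β h⁻¹ (star a)) := by
  simp only [crossedSingle_apply, star_smul, ← CStarCompletion.of_star, ConvAlg.star_single]
  congr 1
  rw [star_inv₀, Complex.star_def, Complex.conj_ofReal]

lemma dualAction_crossedSingle (χ : PontryaginDual H) (h : H) (a : A) :
    dualAction β ν χ (crossedSingle β ν h a) = (χ h : ℂ) • crossedSingle β ν h a := by
  change dualHom β ν χ _ = _
  rw [crossedSingle_apply, map_smul, dualHom_of, ConvAlg.charMul_single, CStarCompletion.of_smul,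
    smul_comm]

lemma of_eq_sum_crossedSingle (f : ConvAlg β ν) : ∃ s : Finset H,
    CStarCompletion.of f = ∑ h ∈ s, crossedSingle β ν h ((ν.real {(1 : H)} : ℂ) • f h) := by
  have hc : (ν.real {(1 : H)} : ℂ) ≠ 0 := by exact_mod_cast (haar_real_singleton_pos ν).ne'
  obtain ⟨s, hs⟩ := f.eq_sum_single
  refine ⟨s, ?_⟩
  change CStarCompletion.ofLinear _ f = _
  conv_lhs => rw [hs]
  rw [map_sum]
  refine Finset.sum_congr rfl fun h _ => ?_
  rw [crossedSingle_apply, ConvAlg.single_smul, CStarCompletion.of_smul, inv_smul_smul₀ hc]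
  rfl

variable (β ν) in
lemma dense_span_crossedSingle (b : CrossedProduct β ν) :
    b ∈ closure (Submodule.span ℂ (Set.range fun p : H × A => crossedSingle β ν p.1 p.2) :
      Set (CrossedProduct β ν)) := by
  refine closure_mono ?_ (CStarCompletion.denseRange_of b)
  rintro _ ⟨f, rfl⟩
  obtain ⟨s, hs⟩ := of_eq_sum_crossedSingle f
  rw [hs]
  exact Submodule.sum_mem _ fun h _ => Submodule.subset_span ⟨(h, _), rfl⟩

variable (β ν) in
lemma separableSpace_crossedProduct_of_discrete [Countable H] [TopologicalSpace.SeparableSpace A] :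
    TopologicalSpace.SeparableSpace (CrossedProduct β ν) := by
  have h1 : TopologicalSpace.IsSeparable
      (Set.range fun p : H × A => crossedSingle β ν p.1 p.2) :=
    TopologicalSpace.isSeparable_range
      (continuous_prod_of_discrete_left.2 fun h => (crossedSingle β ν h).continuous)
  exact TopologicalSpace.isSeparable_univ_iff.1
    ((h1.span (R := ℂ)).closure.mono fun b _ => dense_span_crossedSingle β ν b)

/-- Two uses of the C⋆-identity: b = a x gives ‖a x‖ ≤ M ‖a‖, and then a = x⋆ gives ‖x‖ ≤ M. This
converts bounds on matrix coefficients into norm bounds without a unit. -/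
lemma norm_le_of_forall_norm_mul_mul_le {x : A} {M : ℝ} (hM : 0 ≤ M)
    (h : ∀ a b, ‖a * x * star b‖ ≤ M * ‖a‖ * ‖b‖) : ‖x‖ ≤ M := by
  have key : ∀ {y : A} {M : ℝ}, 0 ≤ M → ‖y‖ * ‖y‖ ≤ M * ‖y‖ → ‖y‖ ≤ M := fun {y M} hM hy => by
    obtain h0 | h0 := (norm_nonneg y).eq_or_lt
    · rw [← h0]; exact hM
    · exact le_of_mul_le_mul_right hy h0
  have h1 : ∀ a, ‖a * x‖ ≤ M * ‖a‖ := fun a =>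
    key (by positivity) (by rw [← CStarRing.norm_self_mul_star]; exact h a (a * x))
  refine key hM ?_
  rw [← CStarRing.norm_star_mul_self]
  simpa using h1 (star x)

/-- The coefficients of a function are bounded by its norm in the crossed product. -/
lemma ConvAlg.norm_coeff_le (f : ConvAlg β ν) (k : H) :
    ‖(ν.real {(1 : H)} : ℂ) • f k‖ ≤ ‖f‖ := by
  set c := ν.real {(1 : H)} with hc
  have hc0 : 0 < c := haar_real_singleton_pos ν
  refine norm_le_of_forall_norm_mul_mul_le (norm_nonneg f) fun a b => ?_
  have hn : ∀ (h : H) (a : A),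
      √‖∫ t, (ConvAlg.single h a : ConvAlg β ν) t * star ((ConvAlg.single h a : ConvAlg β ν) t) ∂ν‖
        = √c * ‖a‖ := fun h a => by
    rw [integral_eq_of_forall_ne h fun t ht => by simp [ConvAlg.single_of_ne ht],
      ConvAlg.single_self, norm_smul, CStarRing.norm_self_mul_star, Real.norm_of_nonneg hc0.le,
      Real.sqrt_mul hc0.le, Real.sqrt_mul_self (norm_nonneg a)]
  -- Between vectors supported at 1 and at k, the regular representation sees exactly the value
  -- f(k), namely c² a f(k) b⋆, while the two vectors contribute c ‖a‖ ‖b‖.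
  have h1 := ConvAlg.norm_mul_mul_star_apply_one_le (ConvAlg.single 1 a) f (ConvAlg.single k b)
  rw [hn, hn, ConvAlg.mul_star_apply_one,
    integral_eq_of_forall_ne k fun t ht => by simp [ConvAlg.single_of_ne ht], ConvAlg.single_self,
    ConvAlg.mul_apply, integral_eq_of_forall_ne 1 fun t ht => by simp [ConvAlg.single_of_ne ht],
    ConvAlg.single_self, CStarAction.one_apply, inv_one, one_mul, norm_smul,
    Real.norm_of_nonneg hc0.le] at h1
  have h2 : a * ((c : ℂ) • f k) * star b = c • (a * f k) * star b := by
    rw [Complex.coe_smul, mul_smul_comm]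
  rw [h2]
  refine le_of_mul_le_mul_left (h1.trans_eq ?_) hc0
  have : √c * √c = c := Real.mul_self_sqrt hc0.le
  linear_combination ‖a‖ * ‖f‖ * ‖b‖ * this

variable (β ν) in
/-- The coefficient at `k`, as a map on the crossed product by a discrete group. -/
def crossedCoeff (k : H) : CrossedProduct β ν →L[ℂ] A :=
  LinearMap.extendOfNorm
    { toFun := fun f : ConvAlg β ν => (ν.real {(1 : H)} : ℂ) • f k
      map_add' := fun f g => smul_add _ (f k) (g k)
      map_smul' := fun c f => smul_comm _ c (f k) } (CStarCompletion.ofLinear (ConvAlg β ν))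

lemma crossedCoeff_of (k : H) (f : ConvAlg β ν) :
    crossedCoeff β ν k (CStarCompletion.of f) = (ν.real {(1 : H)} : ℂ) • f k := by
  refine LinearMap.extendOfNorm_eq (e := CStarCompletion.ofLinear (ConvAlg β ν))
    CStarCompletion.denseRange_of ⟨1, fun f => ?_⟩ f
  rw [one_mul]
  exact (ConvAlg.norm_coeff_le f k).trans_eq (CStarCompletion.norm_of f).symm

lemma norm_crossedCoeff_le (k : H) (b : CrossedProduct β ν) : ‖crossedCoeff β ν k b‖ ≤ ‖b‖ := by
  refine CStarCompletion.induction₁ (p := fun b => ‖crossedCoeff β ν k b‖ ≤ ‖b‖)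
    (isClosed_le (crossedCoeff β ν k).continuous.norm continuous_norm) (fun f => ?_) b
  rw [crossedCoeff_of, CStarCompletion.norm_of]
  exact ConvAlg.norm_coeff_le f k

lemma crossedCoeff_crossedSingle_self (k : H) (a : A) :
    crossedCoeff β ν k (crossedSingle β ν k a) = a := by
  have hc : (ν.real {(1 : H)} : ℂ) ≠ 0 := by exact_mod_cast (haar_real_singleton_pos ν).ne'
  rw [crossedSingle_apply, map_smul, crossedCoeff_of, ConvAlg.single_self, inv_smul_smul₀ hc]

lemma crossedCoeff_crossedSingle_of_ne {k h : H} (hk : k ≠ h) (a : A) :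
    crossedCoeff β ν k (crossedSingle β ν h a) = 0 := by
  rw [crossedSingle_apply, map_smul, crossedCoeff_of, ConvAlg.single_of_ne hk, smul_zero, smul_zero]

/-- The coefficient map is a contractive left inverse of the contraction a ↦ a u_k, so relations in
degree k are relations in A. -/
lemma asympEq_crossedSingle_iff {k : H} {x y : ℕ → A} :
    ((fun n => crossedSingle β ν k (x n)) ≋ fun n => crossedSingle β ν k (y n)) ↔ x ≋ y := by
  refine ⟨fun h => h.of_norm_le (c := 1) fun n => ?_, fun h => h.of_norm_le (c := 1) fun n => ?_⟩
  · rw [one_mul, ← map_sub]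
    simpa only [crossedCoeff_crossedSingle_self] using
      norm_crossedCoeff_le k (crossedSingle β ν k (x n - y n))
  · rw [one_mul, ← map_sub]
    exact norm_crossedSingle_le _ _

/-- A nontrivial element of a discrete abelian group is detected by a character. -/
lemma exists_character_apply_ne_one_of_discrete {h : H} (hh : h ≠ 1) :
    ∃ χ : PontryaginDual H, χ h ≠ 1 := by
  obtain ⟨c, hc⟩ := CharacterModule.exists_character_apply_ne_zero_of_ne_zero
    (A := Additive H) (a := Additive.ofMul h) hh
  -- There are enough characters with values in ℚ/ℤ; the exponential `j` has kernel exactly ℤ and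
  -- embeds ℚ/ℤ in the circle.
  let j : ℚ →+ Additive Circle :=
    { toFun := fun q => Additive.ofMul (AddCircle.toCircle (((q : ℝ) : AddCircle (1 : ℝ))))
      map_zero' := by simp
      map_add' := fun p q => by
        rw [← ofMul_mul, ← AddCircle.toCircle_add]; push_cast; rfl }
  have hj : ∀ q, j q = 0 ↔ q ∈ AddSubgroup.zmultiples (1 : ℚ) := fun q => by
    have h1 : j q = 0 ↔ ((q : ℝ) : AddCircle (1 : ℝ)) = 0 := by
      rw [← (AddCircle.injective_toCircle (one_ne_zero' ℝ)).eq_iff, AddCircle.toCircle_zero]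
      rfl
    rw [h1, AddCircle.coe_eq_zero_iff, AddSubgroup.mem_zmultiples_iff]
    refine exists_congr fun n => ?_
    rw [zsmul_one, zsmul_one]
    norm_cast
  let J : AddCircle (1 : ℚ) →+ Additive Circle :=
    QuotientAddGroup.lift _ j fun q hq => (hj q).2 hq
  have hJ : ∀ z, J z = 0 → z = 0 := fun z hz => by
    obtain ⟨q, rfl⟩ := QuotientAddGroup.mk_surjective z
    exact (QuotientAddGroup.eq_zero_iff q).2 ((hj q).1 hz)
  let χ : H →ₜ* Circle :=
    { toMonoidHom := MonoidHom.toAdditive.symm (J.comp c)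
      continuous_toFun := continuous_of_discreteTopology }
  exact ⟨χ, fun h1 => hc (hJ _ h1)⟩

/-- The coefficient maps are given by averaging over the dual action. -/
lemma crossedSingle_crossedCoeff_eq_integral [MeasurableSpace (PontryaginDual H)]
    [BorelSpace (PontryaginDual H)] (lam : Measure (PontryaginDual H)) [lam.IsHaarMeasure]
    [IsProbabilityMeasure lam] (k : H) (b : CrossedProduct β ν) :
    crossedSingle β ν k (crossedCoeff β ν k b) =
      ∫ χ, (χ k⁻¹ : ℂ) • dualAction β ν χ b ∂lam := by
  have hcont : ∀ b, Continuous fun χ : PontryaginDual H => (χ k⁻¹ : ℂ) • dualAction β ν χ b :=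
    fun b => (evalCharacter H k⁻¹).toContinuousMap.continuous.smul
      ((dualAction β ν).continuous_apply b)
  have hint : ∀ b, Integrable (fun χ : PontryaginDual H => (χ k⁻¹ : ℂ) • dualAction β ν χ b) lam :=
    fun b => (hcont b).integrable_of_hasCompactSupport (HasCompactSupport.of_compactSpace _)
  let E : CrossedProduct β ν →L[ℂ] CrossedProduct β ν := LinearMap.mkContinuous
    { toFun := fun b => ∫ χ, (χ k⁻¹ : ℂ) • dualAction β ν χ b ∂lam
      map_add' := fun b b' => by
        simp only [map_add, smul_add]
        exact integral_add (hint b) (hint b')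
      map_smul' := fun c b => by
        simp only [map_smul, smul_comm _ c]
        exact integral_smul c _ } 1 fun b => by
    refine (norm_integral_le_of_norm_le_const (C := ‖b‖) (Eventually.of_forall fun χ => ?_)).trans
      (by simp)
    rw [norm_smul, Circle.norm_coe, one_mul, CStarAction.norm_apply]
  -- Both sides are continuous and linear; on a u_h the integral is that of the character of
  -- evaluation at k⁻¹ h, and orthogonality decides.
  have key : Set.EqOn ((crossedSingle β ν k).comp (crossedCoeff β ν k)) E
      (closure (Submodule.span ℂ (Set.range fun p : H × A => crossedSingle β ν p.1 p.2) :
        Set (CrossedProduct β ν))) := by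
    refine ContinuousLinearMap.eqOn_closure_span ?_
    rintro _ ⟨⟨h, a⟩, rfl⟩
    change crossedSingle β ν k (crossedCoeff β ν k (crossedSingle β ν h a)) =
      ∫ χ, (χ k⁻¹ : ℂ) • dualAction β ν χ (crossedSingle β ν h a) ∂lam
    simp only [dualAction_crossedSingle, smul_smul]
    rw [integral_smul_const]
    have h1 : ∀ χ : PontryaginDual H, (χ k⁻¹ : ℂ) * χ h = evalCharacter H (k⁻¹ * h) χ :=
      fun χ => by rw [evalCharacter_apply, map_mul, Circle.coe_mul]
    simp only [h1]
    by_cases hk : k = h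
    · subst hk
      simp [crossedCoeff_crossedSingle_self]
    · rw [crossedCoeff_crossedSingle_of_ne hk, map_zero, integral_character_of_ne_one, zero_smul]
      intro h2
      obtain ⟨χ, hχ⟩ := exists_character_apply_ne_one_of_discrete (h := k⁻¹ * h)
        (by rwa [ne_eq, inv_mul_eq_one])
      exact hχ (DFunLike.congr_fun h2 χ)
  exact key (dense_span_crossedSingle β ν b)

/-- The sequence is x_h u_h⁻¹. The unitary u_h⁻¹ undoes the twist by x_h, so the product commutes
with A, and asymptotic invariance of x_h makes it commute with each u_k. Equivariance is exact,
since the element has degree h⁻¹. -/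
lemma IsImplementing.isRokhlin_dualAction {x : H → ℕ → A} (hx : IsImplementing β.toHom x) :
    IsRokhlin (evalCharacter H) (dualAction β ν) fun h n => crossedSingle β ν h⁻¹ (x h n) := by
  have hd := dense_span_crossedSingle β ν
  have hn : ∀ h n, ‖crossedSingle β ν h⁻¹ (x h n)‖ ≤ 1 := fun h n =>
    (norm_crossedSingle_le _ _).trans (hx.norm_le h n)
  have hns : ∀ h n, ‖star (crossedSingle β ν h⁻¹ (x h n))‖ ≤ 1 := fun h n =>
    (norm_star _).trans_le (hn h n)
  refine ⟨fun h => ⟨⟨1, hn h⟩, ?_⟩, fun h => ?_, fun g h => ?_, fun χ h b => ?_⟩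
  · refine AsympEq.mul_comm_of_dense_span hd (StarAlgEquiv.refl ℂ _) (hn h) ?_
    rintro _ ⟨⟨k, a⟩, rfl⟩
    change (fun n => crossedSingle β ν h⁻¹ (x h n) * crossedSingle β ν k a) ≋
      fun n => crossedSingle β ν k a * crossedSingle β ν h⁻¹ (x h n)
    simp only [crossedSingle_mul, mul_comm k h⁻¹]
    rw [asympEq_crossedSingle_iff]
    have h1 := (hx.invariant k h (β h⁻¹ a)).symm
    have h2 := (hx.mul_comm_inv h (β k⁻¹ a)).map_equiv (β k)
    simp only [map_mul, CStarAction.apply_inv_apply] at h2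
    have h3 : β k (β h⁻¹ (β k⁻¹ a)) = β h⁻¹ a := by
      rw [← CStarAction.mul_apply, ← CStarAction.mul_apply, mul_comm k, mul_inv_cancel_right]
    rw [h3] at h2
    exact h1.trans h2.symm
  · simp only [← mul_assoc]
    refine AsympEq.mul_eq_self_of_dense_span hd (C := 1 * 1)
      (norm_seq_mul_le (hns h) (hn h)) ?_
    rintro _ ⟨⟨k, a⟩, rfl⟩
    simp only [mul_assoc, star_crossedSingle, crossedSingle_mul, inv_inv, mul_inv_cancel, one_mul,
      CStarAction.one_apply]
    refine asympEq_crossedSingle_iff.2 ?_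
    have h1 := (hx.star_mul h (β h⁻¹ a)).map_equiv (β h)
    simpa only [map_mul (β h), CStarAction.apply_inv_apply] using h1
  · simp only [← mul_assoc]
    refine AsympEq.mul_of_dense_span hd (norm_seq_mul_le (hn g) (hn h)) (hn (g * h)) ?_
    rintro _ ⟨⟨k, a⟩, rfl⟩
    simp only [mul_assoc, crossedSingle_mul, mul_inv]
    refine asympEq_crossedSingle_iff.2 ?_
    have h1 := (hx.invariant g⁻¹ h (β (g⁻¹ * h⁻¹) a)).mul_left (hx.norm_le g)
    exact h1.trans (hx.mul g h (β (g⁻¹ * h⁻¹) a))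
  · refine AsympEq.of_eq fun n => ?_
    rw [dualAction_crossedSingle, smul_mul_assoc, evalCharacter_apply, map_inv,
      Circle.coe_inv_eq_conj]
    rfl

/-- The projection onto degree h⁻¹ averages χ(h) α̂_χ(w_n). By hypothesis the integrand is
asymptotically unchanged under L for each χ, and dominated convergence passes this to the average.
The operator L will be multiplication by a fixed element, on either side. -/
lemma crossedSingle_crossedCoeff_asympEq {w : ℕ → CrossedProduct β ν} (hn : ∀ n, ‖w n‖ ≤ 1)
    (h : H) (L : CrossedProduct β ν →L[ℂ] CrossedProduct β ν)
    (hL : ∀ χ, (fun n => (χ h : ℂ) • L (dualAction β ν χ (w n))) ≋ fun n => L (w n)) :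
    (fun n => L (crossedSingle β ν h⁻¹ (crossedCoeff β ν h⁻¹ (w n)))) ≋ fun n => L (w n) := by
  obtain ⟨k, rfl⟩ : ∃ k, h = k⁻¹ := ⟨h⁻¹, (inv_inv h).symm⟩
  rw [inv_inv]
  borelize (PontryaginDual H)
  -- The dual group is compact, and normalising Haar measure on the whole of it gives a probability
  -- measure.
  let K : TopologicalSpace.PositiveCompacts (PontryaginDual H) := ⊤
  let lam : Measure (PontryaginDual H) := Measure.haarMeasure K
  have : IsProbabilityMeasure lam := ⟨Measure.haarMeasure_self (K₀ := K)⟩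
  have hcont : ∀ n, Continuous fun χ : PontryaginDual H =>
      (χ k⁻¹ : ℂ) • dualAction β ν χ (w n) := fun n =>
    (evalCharacter H k⁻¹).toContinuousMap.continuous.smul
      ((dualAction β ν).continuous_apply (w n))
  have hint : ∀ n, Integrable (fun χ : PontryaginDual H =>
      (χ k⁻¹ : ℂ) • dualAction β ν χ (w n)) lam := fun n =>
    (hcont n).integrable_of_hasCompactSupport (HasCompactSupport.of_compactSpace _)
  have hint' : ∀ n, Integrable (fun χ : PontryaginDual H =>
      L ((χ k⁻¹ : ℂ) • dualAction β ν χ (w n)) - L (w n)) lam := fun n =>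
    (L.integrable_comp (hint n)).sub (integrable_const _)
  have e : ∀ n, L (crossedSingle β ν k (crossedCoeff β ν k (w n))) - L (w n) =
      ∫ χ : PontryaginDual H, (L ((χ k⁻¹ : ℂ) • dualAction β ν χ (w n)) - L (w n)) ∂lam :=
    fun n => by
      rw [crossedSingle_crossedCoeff_eq_integral lam, ← L.integral_comp_comm (hint n),
        integral_sub (L.integrable_comp (hint n)) (integrable_const _), integral_const,
        probReal_univ, one_smul]
  rw [AsympEq]
  simp only [e]
  rw [← integral_zero (PontryaginDual H) (CrossedProduct β ν) (μ := lam)]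
  refine tendsto_integral_of_dominated_convergence (fun _ => ‖L‖ + ‖L‖)
    (fun n => (hint' n).aestronglyMeasurable)
    (integrable_const _) (fun n => Eventually.of_forall fun χ => ?_)
    (Eventually.of_forall fun χ => ?_)
  · refine (norm_sub_le _ _).trans (add_le_add (L.unit_le_opNorm _ ?_) (L.unit_le_opNorm _ (hn n)))
    rw [norm_smul, Circle.norm_coe, one_mul, CStarAction.norm_apply]
    exact hn n
  · simp only [map_smul]
    exact hL χ

/-- Commutation of x_h u_h⁻¹ with a u_k, read in degree h⁻¹ k, says x_h β_h⁻¹(a) ≈ a β_k(x_h). The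
case k = 1 is the twist relation, and comparing it with general k gives invariance. -/
lemma IsImplementing.of_isRokhlin_crossedSingle {x : H → ℕ → A} (hxn : ∀ h n, ‖x h n‖ ≤ 1)
    (hu : IsRokhlin (evalCharacter H) (dualAction β ν) fun h n => crossedSingle β ν h⁻¹ (x h n)) :
    IsImplementing β.toHom x := by
  have hcomm : ∀ h k a, (fun n => x h n * β h⁻¹ a) ≋ fun n => a * β k (x h n) := fun h k a => by
    have h1 := (hu.central h).central (crossedSingle β ν k a)
    simp only [crossedSingle_mul, mul_comm k h⁻¹] at h1
    exact asympEq_crossedSingle_iff.1 h1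
  have htwist : ∀ h k a, (fun n => x h n * a) ≋ fun n => β h a * β k (x h n) := fun h k a => by
    simpa only [CStarAction.inv_apply_apply] using hcomm h k (β h a)
  have hinv : ∀ g h a, (fun n => β g (x h n) * a) ≋ fun n => x h n * a := fun g h a => by
    have h1 := (htwist h 1 (β g⁻¹ a)).map_equiv (β g)
    simp only [map_mul (β g), CStarAction.apply_inv_apply, CStarAction.one_apply] at h1
    have h2 : β g (β h (β g⁻¹ a)) = β h a := by
      rw [← CStarAction.mul_apply, ← CStarAction.mul_apply, mul_comm g, mul_inv_cancel_right]
    rw [h2] at h1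
    exact h1.trans (htwist h g a).symm
  refine ⟨hxn, fun h a => ?_, fun h a => ?_, fun g h a => ?_, hinv⟩
  · simpa only [CStarAction.one_apply] using htwist h 1 a
  · have h1 := hu.star_mul h (crossedSingle β ν 1 (β h a))
    simp only [star_crossedSingle, crossedSingle_mul, inv_inv, mul_inv_cancel, mul_one,
      CStarAction.inv_apply_apply] at h1
    have h2 := (asympEq_crossedSingle_iff.1 h1).map_equiv (β h⁻¹)
    simpa only [map_mul (β h⁻¹), CStarAction.inv_apply_apply] using h2
  · have h1 := hu.mul g h (crossedSingle β ν 1 (β (g * h) a))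
    simp only [crossedSingle_mul, mul_one, mul_inv, map_mul (β g⁻¹)] at h1
    have h2 : β g⁻¹ (β h⁻¹ (β (g * h) a)) = a := by
      rw [mul_comm g h, CStarAction.mul_apply, CStarAction.inv_apply_apply,
        CStarAction.inv_apply_apply]
    have h3 : β (g⁻¹ * h⁻¹) (β (g * h) a) = a := by rw [CStarAction.mul_apply, h2]
    rw [h2, h3] at h1
    exact ((hinv g⁻¹ h a).mul_left (hxn g)).symm.trans (asympEq_crossedSingle_iff.1 h1)

/-- Replacing w_h by its component of degree h⁻¹ changes neither the left nor the right asymptotic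
multiplier. Left multiplication uses equivariance directly; right multiplication uses it after
commuting b past α̂_χ(w_h), which is again central. -/
lemma IsRokhlin.isRokhlin_crossedCoeff {w : H → ℕ → CrossedProduct β ν}
    (hw : IsRokhlin (evalCharacter H) (dualAction β ν) w) (hn : ∀ h n, ‖w h n‖ ≤ 1) :
    IsRokhlin (evalCharacter H) (dualAction β ν)
      fun h n => crossedSingle β ν h⁻¹ (crossedCoeff β ν h⁻¹ (w h n)) := by
  have hconj : ∀ (χ : PontryaginDual H) (h : H), (χ h : ℂ) * star (χ h : ℂ) = 1 := fun χ h => by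
    rw [← Circle.coe_one, ← mul_inv_cancel (χ h), Circle.coe_mul, Circle.coe_inv_eq_conj]; rfl
  have hequi : ∀ h χ b, (fun n => (χ h : ℂ) • (dualAction β ν χ (w h n) * b)) ≋
      fun n => w h n * b := fun h χ b => by
    have h1 := (hw.equivariant χ h b).smul (χ h : ℂ)
    simpa only [evalCharacter_apply, smul_smul, hconj, one_smul] using h1
  refine hw.congr (C := 1) (fun h n => (norm_crossedSingle_le _ _).trans
    ((norm_crossedCoeff_le _ _).trans (hn h n))) hn
    (fun h b => crossedSingle_crossedCoeff_asympEq (hn h) h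
      ((ContinuousLinearMap.mul ℂ (CrossedProduct β ν)).flip b) fun χ => hequi h χ b)
    fun h b => crossedSingle_crossedCoeff_asympEq (hn h) h
      (ContinuousLinearMap.mul ℂ (CrossedProduct β ν) b) fun χ => ?_
  have h1 := (((hw.central h).map (dualAction β ν χ)).central b).smul (χ h : ℂ)
  exact h1.symm.trans ((hequi h χ b).trans ((hw.central h).central b))

variable (β ν) in
theorem isApproximatelyRepresentable_iff_hasRokhlinProperty_dualAction [Countable H]
    [TopologicalSpace.SeparableSpace A] :
    IsApproximatelyRepresentable β.toHom ↔ HasRokhlinProperty (dualAction β ν) := by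
  refine ⟨fun h => ?_, fun h => ?_⟩
  · obtain ⟨x, hx⟩ := h.exists_isImplementing
    exact (hx.isRokhlin_dualAction (ν := ν)).hasRokhlinProperty (isDualPairing_evalCharacter H)
  · have := separableSpace_crossedProduct_of_discrete β ν
    obtain ⟨w, hw, hn⟩ := h.exists_isRokhlin (evalCharacter H)
    exact (IsImplementing.of_isRokhlin_crossedSingle
      (fun h n => (norm_crossedCoeff_le _ _).trans (hn h n))
      (hw.isRokhlin_crossedCoeff hn)).isApproximatelyRepresentable

end Discrete

/-! ### Convergence in the crossed product and approximate units of functions -/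

namespace ConvAlg

section Convergence

variable {G A : Type*} [CommGroup G] [TopologicalSpace G] [MeasurableSpace G]
  [NonUnitalCStarAlgebra A] {α : CStarAction G A} {μ : Measure G}
  [IsTopologicalGroup G] [BorelSpace G] [IsFiniteMeasureOnCompacts μ] [μ.IsMulLeftInvariant]

/-- Dominated pointwise convergence implies convergence in the norm of the crossed product. -/
lemma asympEq_of_pointwise {F F' : ℕ → ConvAlg α μ} (g : ConvAlg α μ) {C : ℝ}
    (hb : ∀ n s, ‖F n s - F' n s‖ ≤ C * ‖g s‖)
    (h : ∀ s, (fun n => F n s) ≋ fun n => F' n s) : F ≋ F' := by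
  rw [AsympEq.iff_norm]
  refine squeeze_zero (fun _ => norm_nonneg _) (fun n => norm_le_integral _) ?_
  rw [← integral_zero G ℝ (μ := μ)]
  refine tendsto_integral_of_dominated_convergence (fun s => C * ‖g s‖)
    (fun n => (integrable_norm _).aestronglyMeasurable) ((integrable_norm g).const_mul C)
    (fun n => Eventually.of_forall fun s => ?_) (Eventually.of_forall fun s => ?_)
  · rw [norm_norm]
    exact hb n s
  · exact AsympEq.iff_norm.1 (h s)

lemma lmul_asympEq {f f' : ℕ → ConvAlg α μ} {v : ℕ → A} (hv : ∀ n, ‖v n‖ ≤ 1) (h : f ≋ f') :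
    (fun n => lmul (v n) (f n)) ≋ fun n => lmul (v n) (f' n) :=
  h.of_norm_le (c := 1) fun n => by
    rw [← lmul_sub]
    exact (norm_lmul_le _ _).trans (mul_le_mul_of_nonneg_right (hv n) (norm_nonneg _))

lemma charMul_lmul (χ : PontryaginDual G) (a : A) (f : ConvAlg α μ) :
    charMul χ (lmul a f) = lmul a (charMul χ f) := by
  ext s; simp [mul_smul_comm]

lemma asympEq_of_iff {f f' : ℕ → ConvAlg α μ} :
    ((fun n => (CStarCompletion.of (f n) : CrossedProduct α μ)) ≋
      fun n => CStarCompletion.of (f' n)) ↔ f ≋ f' := by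
  rw [AsympEq.iff_norm, AsympEq.iff_norm]
  simp only [← CStarCompletion.of_sub, CStarCompletion.norm_of]

end Convergence

end ConvAlg

section ApproximateUnit

variable {R : Type*} [PreCStarAlgebra R]

/-- A dense ⋆-subalgebra of a separable C⋆-algebra contains a sequential approximate unit. -/
lemma exists_approxUnit_sequence_of_dense [TopologicalSpace.SeparableSpace (CStarCompletion R)] :
    ∃ f : ℕ → R, (∀ n, ‖f n‖ ≤ 1) ∧ (∀ g, (fun n => f n * g) ≋ fun _ => g) ∧
      (∀ g, (fun n => g * f n) ≋ fun _ => g) ∧ ∀ g, (fun n => star (f n) * g) ≋ fun _ => g := by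
  obtain ⟨e, he1, hes, hel, her⟩ := exists_approxUnit_sequence (A := CStarCompletion R)
  have hex : ∀ n : ℕ, ∃ f : R, ‖f‖ ≤ 1 ∧
      ‖e n - CStarCompletion.of f‖ ≤ 2 * (1 / ((n : ℝ) + 1)) := fun n => by
    have hpos : (0 : ℝ) < 1 / ((n : ℝ) + 1) := by positivity
    obtain ⟨g, hg⟩ := CStarCompletion.denseRange_of.exists_dist_lt (e n) hpos
    rw [dist_eq_norm] at hg
    set δ : ℝ := 1 / ((n : ℝ) + 1) with hδ
    have hg1 : ‖g‖ ≤ 1 + δ := by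
      rw [← CStarCompletion.norm_of]
      have := norm_sub_norm_le (CStarCompletion.of g) (e n)
      rw [norm_sub_rev] at this
      linarith [he1 n]
    have hr : (0 : ℝ) < 1 + δ := by positivity
    -- An approximant within δ of a contraction has norm at most 1 + δ; rescaling makes it a
    -- contraction at the cost of another δ.
    refine ⟨(((1 + δ)⁻¹ : ℝ) : ℂ) • g, ?_, ?_⟩
    · rw [norm_smul, Complex.norm_real, Real.norm_of_nonneg (by positivity),
        inv_mul_le_iff₀ hr, mul_one]
      exact hg1
    · have h1 : ‖g - (((1 + δ)⁻¹ : ℝ) : ℂ) • g‖ ≤ δ := by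
        have : g - (((1 + δ)⁻¹ : ℝ) : ℂ) • g = ((1 - (1 + δ)⁻¹ : ℝ) : ℂ) • g := by
          rw [Complex.ofReal_sub, Complex.ofReal_one, sub_smul, one_smul]
        have h2 : 1 - (1 + δ)⁻¹ = δ * (1 + δ)⁻¹ := by field_simp; ring
        rw [this, norm_smul, Complex.norm_real, h2, Real.norm_of_nonneg (by positivity), mul_assoc]
        refine mul_le_of_le_one_right hpos.le ?_
        rw [inv_mul_le_iff₀ hr, mul_one]
        exact hg1
      rw [← CStarCompletion.norm_of, CStarCompletion.of_sub] at h1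
      have := norm_add_le (e n - CStarCompletion.of g)
        (CStarCompletion.of g - CStarCompletion.of ((((1 + δ)⁻¹ : ℝ) : ℂ) • g))
      rw [sub_add_sub_cancel] at this
      linarith
  choose f hf1 hf2 using hex
  have hfe : (fun n => (CStarCompletion.of (f n) : CStarCompletion R)) ≋ e := by
    refine AsympEq.symm (AsympEq.iff_norm.2 ?_)
    refine squeeze_zero (fun _ => norm_nonneg _) hf2 ?_
    simpa using (tendsto_one_div_add_atTop_nhds_zero_nat (𝕜 := ℝ)).const_mul 2
  have key : ∀ {x y : ℕ → R}, ((fun n => (CStarCompletion.of (x n) : CStarCompletion R)) ≋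
      fun n => CStarCompletion.of (y n)) → x ≋ y := fun {x y} h => by
    rw [AsympEq.iff_norm] at h ⊢
    simpa only [← CStarCompletion.of_sub, CStarCompletion.norm_of] using h
  refine ⟨f, hf1, fun g => key ?_, fun g => key ?_, fun g => key ?_⟩
  · simp only [CStarCompletion.of_mul]
    exact (hfe.mul_const _).trans (hel _)
  · simp only [CStarCompletion.of_mul]
    exact (hfe.const_mul _).trans (her _)
  · simp only [CStarCompletion.of_mul, CStarCompletion.of_star]
    have h1 := (hfe.star.mul_const (CStarCompletion.of g))
    simp only [hes] at h1
    exact h1.trans (hel _)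

end ApproximateUnit

/-! ### From the Rokhlin property to approximate representability -/

section RokhlinToRepresentable

variable {G A : Type*} [CommGroup G] [TopologicalSpace G] [IsTopologicalGroup G] [CompactSpace G]
  [MeasurableSpace G] [BorelSpace G] [NonUnitalCStarAlgebra A] {α : CStarAction G A}
  {μ : Measure G} [μ.IsHaarMeasure]

variable (α μ) in
lemma separableSpace_crossedProduct_of_compact [T2Space G] [SecondCountableTopology G]
    [TopologicalSpace.SeparableSpace A] :
    TopologicalSpace.SeparableSpace (CrossedProduct α μ) := by
  have hd : DenseRange (crossedOfCont α μ) := by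
    refine CStarCompletion.denseRange_of.mono ?_
    rintro _ ⟨f, rfl⟩
    exact ⟨⟨f, f.continuous⟩, rfl⟩
  have : SecondCountableTopology A := UniformSpace.secondCountable_of_separable A
  exact hd.separableSpace (crossedOfCont α μ).continuous

/-- At each s the value is χ(s) g(s) α_s(v_χ). Equivariance turns α_s(v_χ) into conj(χ(s)) v_χ,
which cancels χ(s), and centrality moves v_χ to the left. Thus, as a multiplier, v_χ implements the
dual automorphism. -/
lemma IsRokhlin.rmul_asympEq {v : PontryaginDual G → ℕ → A}
    (hv : IsRokhlin (MonoidHom.id (PontryaginDual G)) α v) (hn : ∀ χ n, ‖v χ n‖ ≤ 1)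
    (χ : PontryaginDual G) (g : ConvAlg α μ) :
    (fun n => (ConvAlg.charMul χ g).rmul (v χ n)) ≋ fun n => ConvAlg.lmul (v χ n) g := by
  refine ConvAlg.asympEq_of_pointwise g (C := 2) (fun n s => ?_) fun s => ?_
  · refine (norm_sub_le _ _).trans ?_
    rw [two_mul]
    refine add_le_add ((norm_mul_le _ _).trans ?_) ((norm_mul_le _ _).trans ?_)
    · rw [CStarAction.norm_apply, ConvAlg.charMul_apply, norm_smul, Circle.norm_coe, one_mul]
      exact mul_le_of_le_one_right (norm_nonneg _) (hn χ n)
    · exact mul_le_of_le_one_left (norm_nonneg _) (hn χ n)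
  · simp only [ConvAlg.rmul_apply, ConvAlg.lmul_apply, ConvAlg.charMul_apply, smul_mul_assoc]
    have h1 := (((hv.central χ).map (α s)).central (g s)).symm.trans (hv.equivariant s χ (g s))
    have h2 := h1.smul (χ s : ℂ)
    have h3 : (χ s : ℂ) * star (χ s : ℂ) = 1 := by
      rw [← Circle.coe_one, ← mul_inv_cancel (χ s), Circle.coe_mul, Circle.coe_inv_eq_conj]; rfl
    simpa only [MonoidHom.id_apply, smul_smul, h3, one_smul] using h2

/-- The elements v_χ f_n lie in the crossed product, and both (v_χ f_n) g and (χ g)(v_χ f_n) are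
asymptotically v_χ g because f_n is an approximate unit. All relations then reduce to those of v_χ
applied to the values of g. -/
lemma IsRokhlin.isImplementing_dualAction {v : PontryaginDual G → ℕ → A}
    (hv : IsRokhlin (MonoidHom.id (PontryaginDual G)) α v) (hn : ∀ χ n, ‖v χ n‖ ≤ 1)
    {f : ℕ → ConvAlg α μ} (hf1 : ∀ n, ‖f n‖ ≤ 1) (hfl : ∀ g, (fun n => f n * g) ≋ fun _ => g)
    (hfr : ∀ g, (fun n => g * f n) ≋ fun _ => g)
    (hfs : ∀ g, (fun n => star (f n) * g) ≋ fun _ => g) :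
    IsImplementing (dualAction α μ).toHom
      fun χ n => CStarCompletion.of (ConvAlg.lmul (v χ n) (f n)) := by
  have hd : ∀ b : CrossedProduct α μ, b ∈ closure (Submodule.span ℂ
      (Set.range (CStarCompletion.of : ConvAlg α μ → CrossedProduct α μ)) :
        Set (CrossedProduct α μ)) := fun b =>
    closure_mono Submodule.subset_span (CStarCompletion.denseRange_of b)
  have hy : ∀ χ n, ‖ConvAlg.lmul (v χ n) (f n)‖ ≤ 1 := fun χ n =>
    (ConvAlg.norm_lmul_le _ _).trans (mul_le_one₀ (hn χ n) (norm_nonneg _) (hf1 n))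
  have hx : ∀ χ n, ‖(CStarCompletion.of (ConvAlg.lmul (v χ n) (f n)) : CrossedProduct α μ)‖ ≤ 1 :=
    fun χ n => (CStarCompletion.norm_of _).trans_le (hy χ n)
  have hl : ∀ χ g, (fun n => ConvAlg.lmul (v χ n) (f n) * g) ≋
      fun n => ConvAlg.lmul (v χ n) g := fun χ g => by
    simp only [ConvAlg.lmul_mul]
    exact ConvAlg.lmul_asympEq (hn χ) (hfl g)
  have hr : ∀ χ g, (fun n => ConvAlg.charMul χ g * ConvAlg.lmul (v χ n) (f n)) ≋
      fun n => ConvAlg.lmul (v χ n) g := fun χ g => by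
    simp only [ConvAlg.mul_lmul]
    have h1 := (hv.rmul_asympEq (μ := μ) hn χ g).mul_right hf1
    refine h1.trans ?_
    simp only [ConvAlg.lmul_mul]
    exact ConvAlg.lmul_asympEq (hn χ) (hfr g)
  refine ⟨hx, fun χ => ?_, fun χ => ?_, fun χ ψ => ?_, fun ψ χ => ?_⟩
  · refine AsympEq.mul_comm_of_dense_span hd _ (hx χ) ?_
    rintro _ ⟨g, rfl⟩
    have h1 := (hl χ g).trans (hr χ g).symm
    have h2 : (dualAction α μ).toHom χ (CStarCompletion.of g) =
        CStarCompletion.of (ConvAlg.charMul χ g) := dualHom_of α μ χ g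
    simp only [h2, ← CStarCompletion.of_mul]
    exact ConvAlg.asympEq_of_iff.2 h1
  · simp only [← mul_assoc]
    refine AsympEq.mul_eq_self_of_dense_span hd (C := 1 * 1)
      (norm_seq_mul_le (fun n => (norm_star _).trans_le (hx χ n)) (hx χ)) ?_
    rintro _ ⟨g, rfl⟩
    simp only [mul_assoc, ← CStarCompletion.of_mul, ← CStarCompletion.of_star]
    refine ConvAlg.asympEq_of_iff.2 ?_
    refine ((hl χ g).mul_left fun n => (norm_star _).trans_le (hy χ n)).trans ?_
    simp only [ConvAlg.star_lmul_mul, ConvAlg.lmul_lmul]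
    refine AsympEq.trans (AsympEq.mul_left
      (fun n => (norm_star (f n)).trans_le (hf1 n)) ?_) (hfs g)
    refine ConvAlg.asympEq_of_pointwise g (C := 2) (fun n s => ?_) fun s => ?_
    · rw [ConvAlg.lmul_apply, two_mul]
      refine (norm_sub_le _ _).trans (add_le_add ((norm_mul_le _ _).trans ?_) le_rfl)
      refine mul_le_of_le_one_left (norm_nonneg _) ?_
      rw [CStarRing.norm_star_mul_self]
      exact mul_le_one₀ (hn χ n) (norm_nonneg _) (hn χ n)
    · simpa only [ConvAlg.lmul_apply, mul_assoc] using hv.star_mul χ (g s)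
  · simp only [← mul_assoc]
    refine AsympEq.mul_of_dense_span hd (norm_seq_mul_le (hx χ) (hx ψ)) (hx (χ * ψ)) ?_
    rintro _ ⟨g, rfl⟩
    simp only [mul_assoc, ← CStarCompletion.of_mul]
    refine ConvAlg.asympEq_of_iff.2 ?_
    -- The second factor is moved to the right of χ-twisted g, so that the first meets a fixed
    -- element and becomes v_χ; the second is then treated likewise.
    have h1 := ((hl ψ g).trans (hr ψ g).symm).mul_left (hy χ)
    have h2 := (hl χ (ConvAlg.charMul ψ g)).mul_right (hy ψ)
    have h3 := ConvAlg.lmul_asympEq (hn χ) (hr ψ g)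
    simp only [mul_assoc] at h2
    simp only [← ConvAlg.lmul_mul] at h3
    refine h1.trans (h2.trans (h3.trans (AsympEq.trans ?_ (hl (χ * ψ) g).symm)))
    simp only [ConvAlg.lmul_lmul]
    refine ConvAlg.asympEq_of_pointwise g (C := 2) (fun n s => ?_) fun s => ?_
    · rw [ConvAlg.lmul_apply, ConvAlg.lmul_apply, two_mul]
      refine (norm_sub_le _ _).trans (add_le_add ((norm_mul_le _ _).trans ?_)
        ((norm_mul_le _ _).trans ?_))
      · refine mul_le_of_le_one_left (norm_nonneg _) ?_
        exact (norm_mul_le _ _).trans (mul_le_one₀ (hn χ n) (norm_nonneg _) (hn ψ n))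
      · exact mul_le_of_le_one_left (norm_nonneg _) (hn (χ * ψ) n)
    · simpa only [ConvAlg.lmul_apply, mul_assoc] using hv.mul χ ψ (g s)
  · refine AsympEq.mul_of_dense_span hd (C := 1)
      (fun n => ((dualAction α μ).norm_apply ψ _).trans_le (hx χ n)) (hx χ) ?_
    rintro _ ⟨g, rfl⟩
    have h2 : ∀ f, (dualAction α μ).toHom ψ (CStarCompletion.of f) =
        CStarCompletion.of (ConvAlg.charMul ψ f) := dualHom_of α μ ψ
    simp only [h2, ← CStarCompletion.of_mul]
    refine ConvAlg.asympEq_of_iff.2 ?_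
    refine AsympEq.trans ?_ (hl χ g).symm
    -- The automorphism for ψ is isometric and commutes with left multiplication by v_χ, so the
    -- error equals the one already estimated for ψ⁻¹ g.
    refine (hl χ (ConvAlg.charMul ψ⁻¹ g)).of_norm_le (c := 1) fun n => ?_
    have h3 : ConvAlg.charMul ψ (ConvAlg.charMul ψ⁻¹ g) = g := by
      rw [← ConvAlg.charMul_mul, mul_inv_cancel, ConvAlg.charMul_one]
    have h4 := ConvAlg.norm_charMul ψ (ConvAlg.lmul (v χ n) (f n) * ConvAlg.charMul ψ⁻¹ g -
      ConvAlg.lmul (v χ n) (ConvAlg.charMul ψ⁻¹ g))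
    rw [map_sub, map_mul, ConvAlg.charMul_lmul ψ _ (ConvAlg.charMul ψ⁻¹ g), h3] at h4
    rw [one_mul]
    exact h4.le

end RokhlinToRepresentable

/-! ### Spectral subspaces and matrix coefficients over a compact group -/

section SpectralSubspaces

lemma PontryaginDual.smul_smul {G E : Type*} [Monoid G] [TopologicalSpace G]
    [AddCommGroup E] [Module ℂ E] (χ ψ : PontryaginDual G) (t : G) (a : E) :
    (χ t : ℂ) • (ψ t : ℂ) • a = ((χ * ψ) t : ℂ) • a := by
  rw [_root_.smul_smul, ← Circle.coe_mul]
  rfl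

variable {G A : Type*} [CommGroup G] [TopologicalSpace G] [IsTopologicalGroup G] [CompactSpace G]
  [MeasurableSpace G] [BorelSpace G] [NonUnitalCStarAlgebra A] (α : CStarAction G A)
  (μ : Measure G) [μ.IsHaarMeasure]

/-- The elements on which the action is given by (the inverse of) a character. -/
def CStarAction.IsSpectral (η : PontryaginDual G) (b : A) : Prop :=
  ∀ t, α t b = (η⁻¹ t : ℂ) • b

/-- The map `a ↦ ∫ θ(t) α_t(a) dt` onto a spectral subspace. -/
def CStarAction.spectralProj (θ : PontryaginDual G) (a : A) : A := ∫ t, (θ t : ℂ) • α t a ∂μ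

variable {α μ}

lemma PontryaginDual.continuous_smul_apply {X E : Type*} [TopologicalSpace X]
    [NormedAddCommGroup E] [NormedSpace ℂ E] (θ : PontryaginDual G) {u : X → G} {f : X → E}
    (hu : Continuous u) (hf : Continuous f) : Continuous fun x => (θ (u x) : ℂ) • f x :=
  (θ.toContinuousMap.continuous.comp hu).smul hf

variable (α μ) in
lemma CStarAction.integrable_spectralProj (θ : PontryaginDual G) (a : A) :
    Integrable (fun t => (θ t : ℂ) • α t a) μ :=
  (θ.continuous_smul_apply continuous_id (α.continuous_apply a)).integrable_of_hasCompactSupport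
    (HasCompactSupport.of_compactSpace _)

namespace CStarAction

lemma isSpectral_spectralProj (θ : PontryaginDual G) (a : A) :
    α.IsSpectral θ (α.spectralProj μ θ a) := fun r => by
  have h1 : α r (α.spectralProj μ θ a) = ∫ t, α r ((θ t : ℂ) • α t a) ∂μ :=
    ((α.toCLM r).integral_comp_comm (α.integrable_spectralProj μ θ a)).symm
  rw [h1, spectralProj, ← integral_smul, ← integral_mul_left_eq_self _ r⁻¹]
  refine integral_congr_ae (Eventually.of_forall fun t => ?_)
  dsimp only
  rw [map_smul, ← mul_apply, mul_inv_cancel_left, map_mul, map_inv, Circle.coe_mul, mul_smul]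
  rfl

lemma IsSpectral.spectralProj {η : PontryaginDual G} {b : A} (hb : α.IsSpectral η b) :
    α.spectralProj μ η b = (μ.real Set.univ : ℂ) • b := by
  rw [CStarAction.spectralProj]
  simp only [hb _, PontryaginDual.smul_smul, mul_inv_cancel]
  simp

lemma IsSpectral.mul {η γ : PontryaginDual G} {a b : A} (ha : α.IsSpectral η a)
    (hb : α.IsSpectral γ b) : α.IsSpectral (η * γ) (a * b) := fun t => by
  rw [map_mul, ha, hb, smul_mul_smul_comm, mul_inv]
  rfl

lemma IsSpectral.smul {η : PontryaginDual G} {b : A} (c : ℂ) (hb : α.IsSpectral η b) :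
    α.IsSpectral η (c • b) := fun t => by rw [map_smul, hb, smul_comm]

/-- A spectral factor leaves the integral at the price of shifting the character. -/
lemma spectralProj_mul (θ : PontryaginDual G) {η : PontryaginDual G} (a : A) {b : A}
    (hb : α.IsSpectral η b) :
    α.spectralProj μ θ (a * b) = α.spectralProj μ (θ * η⁻¹) a * b := by
  rw [spectralProj, spectralProj,
    ← integral_mul_const_of_integrable (α.integrable_spectralProj μ _ a)]
  refine integral_congr_ae (Eventually.of_forall fun t => ?_)
  dsimp only
  rw [map_mul, hb, mul_smul_comm, PontryaginDual.smul_smul, smul_mul_assoc]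

lemma spectralProj_add (θ : PontryaginDual G) (a b : A) :
    α.spectralProj μ θ (a + b) = α.spectralProj μ θ a + α.spectralProj μ θ b := by
  simp only [spectralProj, map_add, smul_add]
  exact integral_add (α.integrable_spectralProj μ θ a) (α.integrable_spectralProj μ θ b)

lemma spectralProj_smul (θ : PontryaginDual G) (c : ℂ) (a : A) :
    α.spectralProj μ θ (c • a) = c • α.spectralProj μ θ a := by
  simp only [spectralProj, map_smul, smul_comm _ c]
  exact integral_smul c _

/-- The spectral subspaces of an action of a compact abelian group span a dense subspace. -/
lemma dense_span_isSpectral [T2Space G] (α : CStarAction G A) (a : A) :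
    a ∈ closure (Submodule.span ℂ {b : A | ∃ η, α.IsSpectral η b} : Set A) := by
  borelize G
  let μ : Measure G := Measure.haar
  let S : Submodule ℂ A := (Submodule.span ℂ {b : A | ∃ η, α.IsSpectral η b}).topologicalClosure
  have hS : IsClosed (S : Set A) := Submodule.isClosed_topologicalClosure _
  let π : A →L[ℂ] A ⧸ S := S.mkQL
  change a ∈ S
  suffices h : π a = 0 from (Submodule.Quotient.mk_eq_zero S).1 h
  by_contra hne
  obtain ⟨φ, -, hφ⟩ := exists_dual_vector ℂ (π a) (norm_ne_zero_iff.2 hne)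
  -- Hahn–Banach: φ annihilates the closed span of the spectral elements but not a. The function F
  -- then has vanishing integral against every character, although F(1) ≠ 0.
  let F : C(G, ℂ) := ⟨fun t => φ (π (α t a)),
    φ.continuous.comp (π.continuous.comp (α.continuous_apply a))⟩
  let L : C(G, ℂ) →L[ℂ] ℂ := (integralCLM μ).comp ((ContinuousLinearMap.mul ℂ C(G, ℂ)).flip F)
  have hL : ∀ h : C(G, ℂ), L h = ∫ t, h t * F t ∂μ := fun h => rfl
  have hL0 : Set.EqOn L (0 : C(G, ℂ) →L[ℂ] ℂ) (closure (Submodule.span ℂ (Set.range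
      fun θ : PontryaginDual G => θ.toContinuousMap) : Set C(G, ℂ))) := by
    refine ContinuousLinearMap.eqOn_closure_span ?_
    rintro _ ⟨θ, rfl⟩
    rw [hL]
    have h1 : ∫ t, (θ t : ℂ) * F t ∂μ = (φ.comp π) (α.spectralProj μ θ a) := by
      rw [spectralProj, ← ContinuousLinearMap.integral_comp_comm _
        (α.integrable_spectralProj μ θ a)]
      refine integral_congr_ae (Eventually.of_forall fun t => ?_)
      simp [F]
    have h2 : π (α.spectralProj μ θ a) = 0 :=
      (Submodule.Quotient.mk_eq_zero S).2 (Submodule.le_topologicalClosure _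
        (Submodule.subset_span ⟨θ, isSpectral_spectralProj θ a⟩))
    refine h1.trans ?_
    rw [ContinuousLinearMap.comp_apply, h2, map_zero]
    rfl
  -- Characters are dense in C(G), so F is orthogonal to F itself, contradicting F(1) ≠ 0.
  have h3 : L (star F) = 0 := hL0 (dense_span_characters (MonoidHom.id (PontryaginDual G))
    (isDualPairing_id G).separates (star F))
  rw [hL] at h3
  have h4 : ∀ t, (star F) t * F t = ((‖F t‖ ^ 2 : ℝ) : ℂ) := fun t => by
    rw [ContinuousMap.star_apply, Complex.star_def, Complex.conj_mul']
    push_cast; rfl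
  simp only [h4] at h3
  have h6 : ((∫ t, ‖F t‖ ^ 2 ∂μ : ℝ) : ℂ) = 0 := integral_ofReal.symm.trans h3
  have h5 : 0 < ∫ t, ‖F t‖ ^ 2 ∂μ := by
    refine Continuous.integral_pos_of_hasCompactSupport_nonneg_nonzero (x := (1 : G))
      (F.continuous.norm.pow 2) (HasCompactSupport.of_compactSpace _) (fun t => by positivity) ?_
    have : F 1 ≠ 0 := by
      change φ (π (α 1 a)) ≠ 0
      rw [one_apply, hφ]
      simpa using hne
    positivity
  exact h5.ne' (by exact_mod_cast h6)

end CStarAction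

namespace ConvAlg

/-- The function `s ↦ χ(s) a`. -/
def charSmul (χ : PontryaginDual G) (a : A) : ConvAlg α μ :=
  ofContinuousMap ⟨fun s => (χ s : ℂ) • a, χ.continuous_smul_apply continuous_id continuous_const⟩

lemma charSmul_apply (χ : PontryaginDual G) (a : A) (s : G) :
    (charSmul χ a : ConvAlg α μ) s = (χ s : ℂ) • a := rfl

/-- The Fourier coefficient of a function with values in the coefficient algebra. -/
def fourier (ζ : PontryaginDual G) (f : ConvAlg α μ) : A := ∫ s, (ζ⁻¹ s : ℂ) • f s ∂μ

lemma integrable_fourier (ζ : PontryaginDual G) (f : ConvAlg α μ) :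
    Integrable (fun s => (ζ s : ℂ) • f s) μ :=
  (ζ.continuous_smul_apply continuous_id f.continuous).integrable_of_hasCompactSupport
    (HasCompactSupport.of_compactSpace _)

/-- The matrix coefficients of a function with respect to the decomposition of the regular
representation into isotypic components. -/
def matrixCoeff (ψ ζ : PontryaginDual G) (f : ConvAlg α μ) : A :=
  α.spectralProj μ (ψ * ζ⁻¹) (fourier ζ f)

lemma isSpectral_matrixCoeff (ψ ζ : PontryaginDual G) (f : ConvAlg α μ) :
    α.IsSpectral (ψ * ζ⁻¹) (matrixCoeff ψ ζ f) := CStarAction.isSpectral_spectralProj _ _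

lemma matrixCoeff_add (ψ ζ : PontryaginDual G) (f g : ConvAlg α μ) :
    matrixCoeff ψ ζ (f + g) = matrixCoeff ψ ζ f + matrixCoeff ψ ζ g := by
  have : fourier ζ (f + g) = fourier ζ f + fourier ζ g := by
    simp only [fourier, add_apply, smul_add]
    exact integral_add (integrable_fourier _ f) (integrable_fourier _ g)
  rw [matrixCoeff, this, CStarAction.spectralProj_add]
  rfl

lemma matrixCoeff_smul (ψ ζ : PontryaginDual G) (c : ℂ) (f : ConvAlg α μ) :
    matrixCoeff ψ ζ (c • f) = c • matrixCoeff ψ ζ f := by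
  have : fourier ζ (c • f) = c • fourier ζ f := by
    simp only [fourier, smul_apply, smul_comm _ c]
    exact integral_smul c _
  rw [matrixCoeff, this, CStarAction.spectralProj_smul]
  rfl

/-- The dual action shifts matrices along their diagonals; invariance under it means constancy along
diagonals. -/
lemma matrixCoeff_charMul (ψ ζ θ : PontryaginDual G) (f : ConvAlg α μ) :
    matrixCoeff ψ ζ (charMul θ f) = matrixCoeff (ψ * θ⁻¹) (ζ * θ⁻¹) f := by
  have h1 : fourier ζ (charMul θ f) = fourier (ζ * θ⁻¹) f := by
    simp only [fourier, charMul_apply, PontryaginDual.smul_smul, mul_inv, inv_inv]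
  have h2 : ψ * θ⁻¹ * (ζ * θ⁻¹)⁻¹ = ψ * ζ⁻¹ := by
    rw [mul_inv, inv_inv, mul_comm ζ⁻¹, mul_assoc, inv_mul_cancel_left]
  rw [matrixCoeff, matrixCoeff, h1, h2]

/-- For spectral b, the value α_t(θ(t⁻¹ s) b) is a scalar multiple of b, so the convolution integral
collapses to one Fourier coefficient. -/
lemma mul_charSmul {η : PontryaginDual G} {b : A} (hb : α.IsSpectral η b) (θ : PontryaginDual G)
    (f : ConvAlg α μ) : f * charSmul θ b = charSmul θ (fourier (θ * η) f * b) := by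
  ext s
  rw [mul_apply, charSmul_apply, fourier,
    ← integral_mul_const_of_integrable (integrable_fourier _ f), ← integral_smul]
  refine integral_congr_ae (Eventually.of_forall fun t => ?_)
  dsimp only
  rw [charSmul_apply, map_smul, hb, map_mul, Circle.coe_mul, mul_comm, mul_smul, map_inv]
  change f t * ((θ s : ℂ) • ((θ⁻¹ t : Circle) : ℂ) • (η⁻¹ t : ℂ) • b) = _
  rw [PontryaginDual.smul_smul, mul_smul_comm, mul_smul_comm, ← mul_inv, smul_mul_assoc]

lemma fourier_charSmul_mul (ζ θ : PontryaginDual G) (c : A) (f : ConvAlg α μ) :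
    fourier ζ (charSmul θ c * f) = c * matrixCoeff θ ζ f := by
  have h1 : ∀ s, (ζ⁻¹ s : ℂ) • (charSmul θ c * f : ConvAlg α μ) s =
      ∫ t, (ζ⁻¹ s : ℂ) • (((θ t : ℂ) • c) * α t (f (t⁻¹ * s))) ∂μ := fun s => by
    rw [mul_apply, integral_smul]; rfl
  rw [fourier, integral_congr_ae (Eventually.of_forall h1)]
  rw [integral_integral_swap_of_hasCompactSupport, matrixCoeff, CStarAction.spectralProj,
    ← integral_const_mul_of_integrable (α.integrable_spectralProj μ _ _)]
  · refine integral_congr_ae (Eventually.of_forall fun t => ?_)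
    dsimp only
    rw [← integral_mul_left_eq_self _ t, fourier]
    have h2 : α t (∫ s, (ζ⁻¹ s : ℂ) • f s ∂μ) = ∫ s, α t ((ζ⁻¹ s : ℂ) • f s) ∂μ :=
      ((α.toCLM t).integral_comp_comm (integrable_fourier _ f)).symm
    have hi : Integrable (fun s => α t ((ζ⁻¹ s : ℂ) • f s)) μ :=
      (α.toCLM t).integrable_comp (integrable_fourier ζ⁻¹ f)
    rw [h2, mul_smul_comm, ← integral_const_mul_of_integrable hi, ← integral_smul]
    refine integral_congr_ae (Eventually.of_forall fun s => ?_)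
    dsimp only
    rw [inv_mul_cancel_left, map_mul, Circle.coe_mul, mul_comm, mul_smul, smul_mul_assoc,
      PontryaginDual.smul_smul, mul_comm ζ⁻¹, map_smul, mul_smul_comm, smul_comm]
  · refine PontryaginDual.continuous_smul_apply ζ⁻¹ continuous_fst (Continuous.mul ?_ ?_)
    · exact θ.continuous_smul_apply continuous_snd continuous_const
    · exact α.continuous_comp continuous_snd (f.continuous.comp (by fun_prop))
  · exact HasCompactSupport.of_compactSpace _

lemma matrixCoeff_mul_charSmul {η : PontryaginDual G} {b : A} (hb : α.IsSpectral η b)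
    (ψ θ : PontryaginDual G) (f : ConvAlg α μ) :
    matrixCoeff ψ θ (f * charSmul θ b) =
      (μ.real Set.univ : ℂ) • (matrixCoeff ψ (θ * η) f * b) := by
  have h1 : ∀ a, fourier θ (charSmul θ a : ConvAlg α μ) = (μ.real Set.univ : ℂ) • a := fun a => by
    simp only [fourier, charSmul_apply, PontryaginDual.smul_smul, inv_mul_cancel]
    simp
  rw [mul_charSmul hb, matrixCoeff, h1, CStarAction.spectralProj_smul,
    CStarAction.spectralProj_mul _ _ hb, matrixCoeff, mul_inv, mul_assoc]

lemma matrixCoeff_charSmul_mul {η : PontryaginDual G} {b : A} (hb : α.IsSpectral η b)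
    (θ ζ : PontryaginDual G) (f : ConvAlg α μ) :
    matrixCoeff (η * θ) ζ (charSmul θ b * f) =
      (μ.real Set.univ : ℂ) • (b * matrixCoeff θ ζ f) := by
  rw [matrixCoeff, fourier_charSmul_mul, mul_assoc]
  exact (hb.mul (isSpectral_matrixCoeff θ ζ f)).spectralProj

/-- The function s ↦ θ(s) b acts like b times the matrix unit at (θη, θ), so the product of matrices
has a single term. This is why no summation over the dual group is needed. -/
lemma matrixCoeff_mul_charSmul_mul {η : PontryaginDual G} {b : A} (hb : α.IsSpectral η b)
    (ψ θ ζ : PontryaginDual G) (f g : ConvAlg α μ) :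
    matrixCoeff ψ ζ (f * charSmul θ b * g) =
      matrixCoeff ψ (θ * η) f * (b * matrixCoeff θ ζ g) := by
  rw [mul_charSmul hb, matrixCoeff, fourier_charSmul_mul, mul_assoc,
    CStarAction.spectralProj_mul _ _ (hb.mul (isSpectral_matrixCoeff θ ζ g)), matrixCoeff]
  congr 2
  rw [mul_inv, mul_inv, mul_inv, inv_inv, mul_comm η⁻¹, mul_comm θ⁻¹ ζ, mul_assoc, mul_assoc,
    inv_mul_cancel_left]

lemma matrixCoeff_charSmul {η : PontryaginDual G} {b : A} (hb : α.IsSpectral η b)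
    (θ : PontryaginDual G) : matrixCoeff (η * θ) θ (charSmul θ b : ConvAlg α μ) =
      (μ.real Set.univ : ℂ) • (μ.real Set.univ : ℂ) • b := by
  have h1 : fourier θ (charSmul θ b : ConvAlg α μ) = (μ.real Set.univ : ℂ) • b := by
    simp only [fourier, charSmul_apply, PontryaginDual.smul_smul, inv_mul_cancel]
    simp
  rw [matrixCoeff, h1, mul_inv_cancel_right, (hb.smul _).spectralProj]

/-- This identifies `matrixCoeff` with a matrix coefficient of the regular representation, between
vectors in the isotypic components of ψ and ζ. -/
lemma mul_mul_star_charSmul_apply_one (ψ ζ : PontryaginDual G) (c b : A) (f : ConvAlg α μ) :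
    (charSmul ψ c * f * star (charSmul ζ b) : ConvAlg α μ) 1 = c * matrixCoeff ψ ζ f * star b := by
  rw [mul_star_apply_one, ← fourier_charSmul_mul, fourier,
    ← integral_mul_const_of_integrable (integrable_fourier _ _)]
  refine integral_congr_ae (Eventually.of_forall fun t => ?_)
  dsimp only
  rw [charSmul_apply, star_smul, mul_smul_comm, smul_mul_assoc]
  congr 1
  exact (Circle.coe_inv_eq_conj (ζ t)).symm

/-- Each vector s ↦ χ(s) a has norm √μ(G) ‖a‖ in the regular module, and two of them contribute the
factor μ(G). -/
lemma norm_matrixCoeff_le (ψ ζ : PontryaginDual G) (f : ConvAlg α μ) :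
    ‖matrixCoeff ψ ζ f‖ ≤ μ.real Set.univ * ‖f‖ := by
  refine norm_le_of_forall_norm_mul_mul_le (by positivity) fun c b => ?_
  have hn : ∀ (χ : PontryaginDual G) (a : A),
      √‖∫ t, (charSmul χ a : ConvAlg α μ) t * star ((charSmul χ a : ConvAlg α μ) t) ∂μ‖
        = √(μ.real Set.univ) * ‖a‖ := fun χ a => by
    have h1 : ∀ t, (charSmul χ a : ConvAlg α μ) t * star ((charSmul χ a : ConvAlg α μ) t) =
        a * star a := fun t => by
      rw [charSmul_apply, star_smul, smul_mul_smul_comm]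
      have : (χ t : ℂ) * star (χ t : ℂ) = 1 := by
        rw [← Circle.coe_one, ← mul_inv_cancel (χ t), Circle.coe_mul, Circle.coe_inv_eq_conj]; rfl
      rw [this, one_smul]
    simp only [h1, integral_const]
    rw [norm_smul, CStarRing.norm_self_mul_star, Real.norm_of_nonneg measureReal_nonneg,
      Real.sqrt_mul measureReal_nonneg, Real.sqrt_mul_self (norm_nonneg a)]
  have h1 := norm_mul_mul_star_apply_one_le (charSmul ψ c) f (charSmul ζ b)
  rw [hn, hn, mul_mul_star_charSmul_apply_one] at h1
  refine h1.trans_eq ?_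
  have : √(μ.real Set.univ) * √(μ.real Set.univ) = μ.real Set.univ :=
    Real.mul_self_sqrt measureReal_nonneg
  linear_combination ‖c‖ * ‖f‖ * ‖b‖ * this

/-- The adjoint is read off from the regular representation after multiplying by b and c⋆; the
estimate with M = 0 removes these factors. -/
lemma star_matrixCoeff (ψ ζ : PontryaginDual G) (f : ConvAlg α μ) :
    star (matrixCoeff ψ ζ f) = matrixCoeff ζ ψ (star f) := by
  have key : ∀ b c, b * star (matrixCoeff ψ ζ f) * star c =
      b * matrixCoeff ζ ψ (star f) * star c := fun b c => by
    have h1 : ∀ g : ConvAlg α μ, star (g 1) = (star g) 1 := fun g => by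
      rw [star_apply, inv_one, CStarAction.one_apply]
    rw [← mul_mul_star_charSmul_apply_one ζ ψ b c (star f)]
    have h2 := h1 (charSmul ψ c * f * star (charSmul ζ b))
    rw [mul_mul_star_charSmul_apply_one] at h2
    simpa only [star_mul, star_star, mul_assoc] using h2
  refine sub_eq_zero.1 (norm_le_zero_iff.1 (norm_le_of_forall_norm_mul_mul_le le_rfl fun b c => ?_))
  rw [mul_sub, sub_mul, key, sub_self, norm_zero, zero_mul, zero_mul]

lemma charMul_charSmul (χ θ : PontryaginDual G) (b : A) :
    charMul χ (charSmul θ b : ConvAlg α μ) = charSmul (χ * θ) b := by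
  ext s
  rw [charMul_apply, charSmul_apply, PontryaginDual.smul_smul]
  rfl

end ConvAlg

variable (α μ) in
/-- The element `s ↦ χ(s) a` of the crossed product. -/
def crossedChar (χ : PontryaginDual G) (a : A) : CrossedProduct α μ :=
  CStarCompletion.of (ConvAlg.charSmul χ a)

variable (α μ) in
/-- The matrix coefficients of the regular representation, on the crossed product. -/
def crossedMatrixCoeff (ψ ζ : PontryaginDual G) : CrossedProduct α μ →L[ℂ] A :=
  LinearMap.extendOfNorm
    { toFun := fun f : ConvAlg α μ => ConvAlg.matrixCoeff ψ ζ f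
      map_add' := ConvAlg.matrixCoeff_add ψ ζ
      map_smul' := ConvAlg.matrixCoeff_smul ψ ζ } (CStarCompletion.ofLinear (ConvAlg α μ))

lemma crossedMatrixCoeff_of (ψ ζ : PontryaginDual G) (f : ConvAlg α μ) :
    crossedMatrixCoeff α μ ψ ζ (CStarCompletion.of f) = ConvAlg.matrixCoeff ψ ζ f := by
  refine LinearMap.extendOfNorm_eq (e := CStarCompletion.ofLinear (ConvAlg α μ))
    CStarCompletion.denseRange_of ⟨μ.real Set.univ, fun f => ?_⟩ f
  exact (ConvAlg.norm_matrixCoeff_le ψ ζ f).trans_eq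
    (congrArg _ (CStarCompletion.norm_of f).symm)

lemma norm_crossedMatrixCoeff_le (ψ ζ : PontryaginDual G) (x : CrossedProduct α μ) :
    ‖crossedMatrixCoeff α μ ψ ζ x‖ ≤ μ.real Set.univ * ‖x‖ := by
  refine CStarCompletion.induction₁
    (p := fun x => ‖crossedMatrixCoeff α μ ψ ζ x‖ ≤ μ.real Set.univ * ‖x‖)
    (isClosed_le (crossedMatrixCoeff α μ ψ ζ).continuous.norm
      (continuous_const.mul continuous_norm)) (fun f => ?_) x
  rw [crossedMatrixCoeff_of, CStarCompletion.norm_of]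
  exact ConvAlg.norm_matrixCoeff_le ψ ζ f

lemma AsympEq.crossedMatrixCoeff {x y : ℕ → CrossedProduct α μ} (h : x ≋ y)
    (ψ ζ : PontryaginDual G) :
    (fun n => crossedMatrixCoeff α μ ψ ζ (x n)) ≋ fun n => crossedMatrixCoeff α μ ψ ζ (y n) :=
  h.of_norm_le (c := μ.real Set.univ) fun n => by
    rw [← map_sub]
    exact norm_crossedMatrixCoeff_le ψ ζ _

lemma isSpectral_crossedMatrixCoeff (ψ ζ : PontryaginDual G) (x : CrossedProduct α μ) :
    α.IsSpectral (ψ * ζ⁻¹) (crossedMatrixCoeff α μ ψ ζ x) := fun t => by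
  refine CStarCompletion.induction₁ (p := fun x => α t (crossedMatrixCoeff α μ ψ ζ x) =
    ((ψ * ζ⁻¹)⁻¹ t : ℂ) • crossedMatrixCoeff α μ ψ ζ x)
    (isClosed_eq ((α.toCLM t).continuous.comp (crossedMatrixCoeff α μ ψ ζ).continuous)
      ((crossedMatrixCoeff α μ ψ ζ).continuous.fun_const_smul _)) (fun f => ?_) x
  rw [crossedMatrixCoeff_of]
  exact ConvAlg.isSpectral_matrixCoeff ψ ζ f t

lemma crossedMatrixCoeff_dualAction (ψ ζ θ : PontryaginDual G) (x : CrossedProduct α μ) :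
    crossedMatrixCoeff α μ ψ ζ (dualAction α μ θ x) =
      crossedMatrixCoeff α μ (ψ * θ⁻¹) (ζ * θ⁻¹) x := by
  refine CStarCompletion.induction₁ (p := fun x => crossedMatrixCoeff α μ ψ ζ (dualHom α μ θ x) =
      crossedMatrixCoeff α μ (ψ * θ⁻¹) (ζ * θ⁻¹) x)
    (isClosed_eq ((crossedMatrixCoeff α μ ψ ζ).continuous.comp (continuous_dualHom α μ θ))
      (crossedMatrixCoeff α μ _ _).continuous) (fun f => ?_) x
  rw [dualHom_of, crossedMatrixCoeff_of, crossedMatrixCoeff_of, ConvAlg.matrixCoeff_charMul]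

lemma star_crossedMatrixCoeff (ψ ζ : PontryaginDual G) (x : CrossedProduct α μ) :
    star (crossedMatrixCoeff α μ ψ ζ x) = crossedMatrixCoeff α μ ζ ψ (star x) := by
  refine CStarCompletion.induction₁ (p := fun x => star (crossedMatrixCoeff α μ ψ ζ x) =
      crossedMatrixCoeff α μ ζ ψ (star x))
    (isClosed_eq (crossedMatrixCoeff α μ ψ ζ).continuous.star
      ((crossedMatrixCoeff α μ ζ ψ).continuous.comp continuous_star)) (fun f => ?_) x
  rw [← CStarCompletion.of_star, crossedMatrixCoeff_of, crossedMatrixCoeff_of,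
    ConvAlg.star_matrixCoeff]

lemma crossedMatrixCoeff_mul_crossedChar {η : PontryaginDual G} {b : A} (hb : α.IsSpectral η b)
    (ψ θ : PontryaginDual G) (x : CrossedProduct α μ) :
    crossedMatrixCoeff α μ ψ θ (x * crossedChar α μ θ b) =
      (μ.real Set.univ : ℂ) • (crossedMatrixCoeff α μ ψ (θ * η) x * b) := by
  refine CStarCompletion.induction₁ (p := fun x => crossedMatrixCoeff α μ ψ θ
      (x * crossedChar α μ θ b) =
      (μ.real Set.univ : ℂ) • (crossedMatrixCoeff α μ ψ (θ * η) x * b))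
    (isClosed_eq ((crossedMatrixCoeff α μ ψ θ).continuous.comp
      (continuous_id.mul continuous_const))
      (((crossedMatrixCoeff α μ _ _).continuous.mul continuous_const).fun_const_smul _))
    (fun f => ?_) x
  rw [crossedChar, ← CStarCompletion.of_mul, crossedMatrixCoeff_of, crossedMatrixCoeff_of,
    ConvAlg.matrixCoeff_mul_charSmul hb]

lemma crossedMatrixCoeff_crossedChar_mul {η : PontryaginDual G} {b : A} (hb : α.IsSpectral η b)
    (θ ζ : PontryaginDual G) (x : CrossedProduct α μ) :
    crossedMatrixCoeff α μ (η * θ) ζ (crossedChar α μ θ b * x) =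
      (μ.real Set.univ : ℂ) • (b * crossedMatrixCoeff α μ θ ζ x) := by
  refine CStarCompletion.induction₁ (p := fun x => crossedMatrixCoeff α μ (η * θ) ζ
      (crossedChar α μ θ b * x) =
      (μ.real Set.univ : ℂ) • (b * crossedMatrixCoeff α μ θ ζ x))
    (isClosed_eq ((crossedMatrixCoeff α μ (η * θ) ζ).continuous.comp
      (continuous_const.mul continuous_id))
      ((continuous_const.mul (crossedMatrixCoeff α μ _ _).continuous).fun_const_smul _))
    (fun f => ?_) x
  rw [crossedChar, ← CStarCompletion.of_mul, crossedMatrixCoeff_of, crossedMatrixCoeff_of,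
    ConvAlg.matrixCoeff_charSmul_mul hb]

lemma crossedMatrixCoeff_mul_crossedChar_mul {η : PontryaginDual G} {b : A}
    (hb : α.IsSpectral η b) (ψ θ ζ : PontryaginDual G) (x y : CrossedProduct α μ) :
    crossedMatrixCoeff α μ ψ ζ (x * crossedChar α μ θ b * y) =
      crossedMatrixCoeff α μ ψ (θ * η) x * (b * crossedMatrixCoeff α μ θ ζ y) := by
  refine CStarCompletion.induction₁ (p := fun x => crossedMatrixCoeff α μ ψ ζ
      (x * crossedChar α μ θ b * y) =
      crossedMatrixCoeff α μ ψ (θ * η) x * (b * crossedMatrixCoeff α μ θ ζ y))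
    (isClosed_eq ((crossedMatrixCoeff α μ ψ ζ).continuous.comp
      ((continuous_id.mul continuous_const).mul continuous_const))
      ((crossedMatrixCoeff α μ _ _).continuous.mul continuous_const)) (fun f => ?_) x
  refine CStarCompletion.induction₁ (p := fun y => crossedMatrixCoeff α μ ψ ζ
      (CStarCompletion.of f * crossedChar α μ θ b * y) =
      crossedMatrixCoeff α μ ψ (θ * η) (CStarCompletion.of f) *
        (b * crossedMatrixCoeff α μ θ ζ y))
    (isClosed_eq ((crossedMatrixCoeff α μ ψ ζ).continuous.comp
      (continuous_const.mul continuous_id))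
      (continuous_const.mul (continuous_const.mul (crossedMatrixCoeff α μ _ _).continuous)))
    (fun g => ?_) y
  rw [crossedChar, ← CStarCompletion.of_mul, ← CStarCompletion.of_mul, crossedMatrixCoeff_of,
    crossedMatrixCoeff_of, crossedMatrixCoeff_of, ConvAlg.matrixCoeff_mul_charSmul_mul hb]

lemma crossedMatrixCoeff_crossedChar {η : PontryaginDual G} {b : A} (hb : α.IsSpectral η b)
    (θ : PontryaginDual G) : crossedMatrixCoeff α μ (η * θ) θ (crossedChar α μ θ b) =
      (μ.real Set.univ : ℂ) • (μ.real Set.univ : ℂ) • b := by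
  rw [crossedChar, crossedMatrixCoeff_of, ConvAlg.matrixCoeff_charSmul hb]

lemma dualAction_crossedChar (χ θ : PontryaginDual G) (b : A) :
    (dualAction α μ).toHom χ (crossedChar α μ θ b) = crossedChar α μ (χ * θ) b := by
  change dualHom α μ χ _ = _
  rw [crossedChar, dualHom_of, ConvAlg.charMul_charSmul]
  rfl

end SpectralSubspaces

/-! ### From approximate representability to the Rokhlin property -/

section RepresentableToRokhlin

variable {G A : Type*} [CommGroup G] [TopologicalSpace G] [IsTopologicalGroup G] [CompactSpace G]
  [MeasurableSpace G] [BorelSpace G] [NonUnitalCStarAlgebra A] {α : CStarAction G A}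
  {μ : Measure G} [μ.IsHaarMeasure]

/-- The normalised diagonal matrix coefficients of an element of the crossed product that shifts
the isotypic components by `χ`. -/
def diagCoeff (χ θ : PontryaginDual G) (x : CrossedProduct α μ) : A :=
  (μ.real Set.univ : ℂ)⁻¹ • crossedMatrixCoeff α μ (χ * θ) θ x

variable (μ) in
lemma haar_real_univ_ne_zero : (μ.real Set.univ : ℂ) ≠ 0 := by
  have : 0 < μ.real Set.univ := measureReal_univ_pos
  exact_mod_cast this.ne'

lemma crossedMatrixCoeff_eq_smul_diagCoeff (χ θ : PontryaginDual G) (x : CrossedProduct α μ) :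
    crossedMatrixCoeff α μ (χ * θ) θ x = (μ.real Set.univ : ℂ) • diagCoeff χ θ x := by
  rw [diagCoeff, smul_inv_smul₀ (haar_real_univ_ne_zero μ)]

lemma norm_diagCoeff_le (χ θ : PontryaginDual G) (x : CrossedProduct α μ) :
    ‖diagCoeff χ θ x‖ ≤ ‖x‖ := by
  have h0 : 0 < μ.real Set.univ := measureReal_univ_pos
  rw [diagCoeff, norm_smul, norm_inv, Complex.norm_real, Real.norm_of_nonneg h0.le,
    inv_mul_le_iff₀ h0]
  exact norm_crossedMatrixCoeff_le _ _ _

lemma star_diagCoeff (χ θ : PontryaginDual G) (x : CrossedProduct α μ) :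
    star (diagCoeff χ θ x) =
      (μ.real Set.univ : ℂ)⁻¹ • crossedMatrixCoeff α μ θ (χ * θ) (star x) := by
  rw [diagCoeff, star_smul, star_crossedMatrixCoeff, star_inv₀, Complex.star_def,
    Complex.conj_ofReal]

lemma isSpectral_diagCoeff (χ θ : PontryaginDual G) (x : CrossedProduct α μ) :
    α.IsSpectral χ (diagCoeff χ θ x) := by
  have h := isSpectral_crossedMatrixCoeff (χ * θ) θ x
  rw [mul_inv_cancel_right] at h
  exact h.smul _

lemma AsympEq.of_smul {E : Type*} [NormedAddCommGroup E] [NormedSpace ℂ E] {x y : ℕ → E} {c : ℂ}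
    (hc : c ≠ 0) (h : (fun n => c • x n) ≋ fun n => c • y n) : x ≋ y := by
  simpa only [inv_smul_smul₀ hc] using h.smul c⁻¹

namespace IsImplementing

variable {x : PontryaginDual G → ℕ → CrossedProduct α μ}
  (hx : IsImplementing (dualAction α μ).toHom x) {η : PontryaginDual G} {b : A}

include hx

/-- Compare the entries at (ηχθ, θ) in x_χ (θ ⊗ b) ≈ (χθ ⊗ b) x_χ, where θ ⊗ b stands for s ↦ θ(s)
b. Two factors μ(G) cancel, one from the product and one from the normalisation. -/
lemma diagCoeff_mul_comm (hb : α.IsSpectral η b) (χ θ : PontryaginDual G) :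
    (fun n => diagCoeff χ (θ * η) (x χ n) * b) ≋ fun n => b * diagCoeff χ θ (x χ n) := by
  have hm := haar_real_univ_ne_zero μ
  have h1 := (hx.twist χ (crossedChar α μ θ b)).crossedMatrixCoeff (η * (χ * θ)) θ
  rw [dualAction_crossedChar] at h1
  simp only [crossedMatrixCoeff_mul_crossedChar hb, crossedMatrixCoeff_crossedChar_mul hb,
    crossedMatrixCoeff_eq_smul_diagCoeff] at h1
  have e : η * (χ * θ) = χ * (θ * η) := by rw [mul_comm η, mul_assoc]
  rw [e] at h1
  simp only [crossedMatrixCoeff_eq_smul_diagCoeff, smul_mul_assoc, mul_smul_comm] at h1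
  exact (h1.of_smul hm).of_smul hm

/-- The dual automorphism for θ⁻¹ θ' moves one position of the χ-diagonal to the other, and x_χ is
asymptotically invariant under it. -/
lemma diagCoeff_mul_asympEq (hb : α.IsSpectral η b) (χ θ θ' : PontryaginDual G) :
    (fun n => diagCoeff χ θ (x χ n) * b) ≋ fun n => diagCoeff χ θ' (x χ n) * b := by
  have hm := haar_real_univ_ne_zero μ
  have h1 := (hx.invariant (θ⁻¹ * θ') χ (crossedChar α μ (θ' * η⁻¹) b)).crossedMatrixCoeff
    (χ * θ') (θ' * η⁻¹)
  simp only [crossedMatrixCoeff_mul_crossedChar hb, crossedMatrixCoeff_dualAction,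
    inv_mul_cancel_right] at h1
  have e1 : θ' * (θ⁻¹ * θ')⁻¹ = θ := by rw [mul_inv, inv_inv, mul_comm θ, mul_inv_cancel_left]
  have e2 : χ * θ' * (θ⁻¹ * θ')⁻¹ = χ * θ := by rw [mul_assoc, e1]
  rw [e1, e2] at h1
  simp only [crossedMatrixCoeff_eq_smul_diagCoeff, smul_mul_assoc] at h1
  exact (h1.of_smul hm).of_smul hm

lemma mul_diagCoeff_asympEq (hb : α.IsSpectral η b) (χ θ θ' : PontryaginDual G) :
    (fun n => diagCoeff χ θ' (x χ n) * b) ≋ fun n => b * diagCoeff χ θ (x χ n) :=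
  (hx.diagCoeff_mul_asympEq hb χ θ' (θ * η)).trans (hx.diagCoeff_mul_comm hb χ θ)

/-- Since x_χ⋆ (χθ ⊗ b) x_χ ≈ x_χ⋆ x_χ (θ ⊗ b) ≈ θ ⊗ b, the entry at (ηθ, θ) gives the relation. The
element b in the middle is what turns the product of matrices into a product of two entries. -/
lemma star_diagCoeff_mul (hb : α.IsSpectral η b) (χ θ : PontryaginDual G) :
    (fun n => star (diagCoeff χ (η * θ) (x χ n)) * (b * diagCoeff χ θ (x χ n))) ≋
      fun _ => b := by
  have hm := haar_real_univ_ne_zero μ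
  have h1 := (hx.twist χ (crossedChar α μ θ b)).mul_left (hx.norm_star_le χ)
  rw [dualAction_crossedChar] at h1
  have h2 := (h1.symm.trans (hx.star_mul χ _)).crossedMatrixCoeff (η * θ) θ
  simp only [← mul_assoc] at h2
  simp only [crossedMatrixCoeff_mul_crossedChar_mul hb, crossedMatrixCoeff_crossedChar hb] at h2
  have e : χ * θ * η = χ * (η * θ) := by rw [mul_assoc, mul_comm θ]
  rw [e] at h2
  have h3 : ∀ n, crossedMatrixCoeff α μ (η * θ) (χ * (η * θ)) (star (x χ n)) =
      (μ.real Set.univ : ℂ) • star (diagCoeff χ (η * θ) (x χ n)) := fun n => by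
    rw [star_diagCoeff, smul_inv_smul₀ hm]
  simp only [h3, crossedMatrixCoeff_eq_smul_diagCoeff, smul_mul_assoc, mul_smul_comm] at h2
  exact (h2.of_smul hm).of_smul hm

/-- The same device for products: x_χ (ψθ ⊗ b) x_ψ ≈ x_χ x_ψ (θ ⊗ b) ≈ x_{χψ} (θ ⊗ b), read at the
entry (χψθη, θ). -/
lemma diagCoeff_mul_diagCoeff (hb : α.IsSpectral η b) (χ ψ θ : PontryaginDual G) :
    (fun n => diagCoeff χ (ψ * (θ * η)) (x χ n) * (b * diagCoeff ψ θ (x ψ n))) ≋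
      fun n => diagCoeff (χ * ψ) (θ * η) (x (χ * ψ) n) * b := by
  have hm := haar_real_univ_ne_zero μ
  have h1 := (hx.twist ψ (crossedChar α μ θ b)).mul_left (hx.norm_le χ)
  rw [dualAction_crossedChar] at h1
  have h2 := (h1.symm.trans (hx.mul χ ψ _)).crossedMatrixCoeff (χ * ψ * (θ * η)) θ
  simp only [← mul_assoc (x χ _)] at h2
  simp only [crossedMatrixCoeff_mul_crossedChar_mul hb, crossedMatrixCoeff_mul_crossedChar hb] at h2
  have e1 : ψ * θ * η = ψ * (θ * η) := mul_assoc _ _ _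
  have e2 : ∀ z, crossedMatrixCoeff α μ (χ * ψ * (θ * η)) (ψ * (θ * η)) z =
      (μ.real Set.univ : ℂ) • diagCoeff χ (ψ * (θ * η)) z := fun z => by
    rw [mul_assoc, crossedMatrixCoeff_eq_smul_diagCoeff]
  simp only [e1, e2, crossedMatrixCoeff_eq_smul_diagCoeff, smul_mul_assoc, mul_smul_comm] at h2
  exact (h2.of_smul hm).of_smul hm

/-- The entry lemmas involve different positions on the same diagonal; constancy along the diagonal
brings all of them to position 1. Equivariance is exact, because the entries are spectral. The other
relations extend from spectral b by density. -/
lemma isRokhlin_diagCoeff [T2Space G] : IsRokhlin (MonoidHom.id (PontryaginDual G)) α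
    fun χ n => diagCoeff χ 1 (x χ n) := by
  have hd := α.dense_span_isSpectral
  have hn : ∀ χ θ n, ‖diagCoeff χ θ (x χ n)‖ ≤ 1 := fun χ θ n =>
    (norm_diagCoeff_le χ θ _).trans (hx.norm_le χ n)
  have hns : ∀ χ θ n, ‖star (diagCoeff χ θ (x χ n))‖ ≤ 1 := fun χ θ n =>
    (norm_star _).trans_le (hn χ θ n)
  refine ⟨fun χ => ⟨⟨1, hn χ 1⟩, ?_⟩, fun χ => ?_, fun χ ψ => ?_, fun g χ a => ?_⟩
  · refine AsympEq.mul_comm_of_dense_span hd (StarAlgEquiv.refl ℂ _) (hn χ 1) ?_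
    rintro b ⟨η, hb⟩
    exact hx.mul_diagCoeff_asympEq hb χ 1 1
  · simp only [← mul_assoc]
    refine AsympEq.mul_eq_self_of_dense_span hd (norm_seq_mul_le (hns χ 1) (hn χ 1)) ?_
    rintro b ⟨η, hb⟩
    simp only [mul_assoc]
    have h1 := hx.star_diagCoeff_mul hb χ η⁻¹
    rw [mul_inv_cancel] at h1
    exact ((hx.mul_diagCoeff_asympEq hb χ η⁻¹ 1).mul_left (hns χ 1)).trans h1
  · simp only [← mul_assoc]
    refine AsympEq.mul_of_dense_span hd (norm_seq_mul_le (hn χ 1) (hn ψ 1)) (hn (χ * ψ) 1) ?_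
    rintro b ⟨η, hb⟩
    simp only [mul_assoc]
    have h1 := (hx.mul_diagCoeff_asympEq hb ψ 1 1).mul_left (hn χ 1)
    have h2 := (hx.diagCoeff_mul_asympEq hb χ 1 (ψ * (1 * η))).mul_right (hn ψ 1)
    simp only [mul_assoc] at h2
    exact (h1.trans h2).trans ((hx.diagCoeff_mul_diagCoeff hb χ ψ 1).trans
      (hx.diagCoeff_mul_asympEq hb (χ * ψ) (1 * η) 1))
  · refine AsympEq.of_eq fun n => ?_
    rw [isSpectral_diagCoeff χ 1 (x χ n) g, smul_mul_assoc, MonoidHom.id_apply]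
    congr 1
    exact Circle.coe_inv_eq_conj (χ g)

end IsImplementing

variable (α μ) in
theorem hasRokhlinProperty_iff_isApproximatelyRepresentable_dualAction [T2Space G]
    [SecondCountableTopology G] [TopologicalSpace.SeparableSpace A] :
    HasRokhlinProperty α ↔ IsApproximatelyRepresentable (dualAction α μ).toHom := by
  refine ⟨fun h => ?_, fun h => ?_⟩
  · have := separableSpace_crossedProduct_of_compact α μ
    obtain ⟨v, hv, hn⟩ := h.exists_isRokhlin (MonoidHom.id (PontryaginDual G))
    obtain ⟨f, hf1, hfl, hfr, hfs⟩ := exists_approxUnit_sequence_of_dense (R := ConvAlg α μ)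
    exact (hv.isImplementing_dualAction hn hf1 hfl hfr hfs).isApproximatelyRepresentable
  · obtain ⟨x, hx⟩ := h.exists_isImplementing
    exact hx.isRokhlin_diagCoeff.hasRokhlinProperty (isDualPairing_id G)

end RepresentableToRokhlin

end

theorem theorem4p25 {G H A : Type*}
    [CommGroup G] [TopologicalSpace G] [IsTopologicalGroup G] [CompactSpace G] [T2Space G]
    [SecondCountableTopology G] [MeasurableSpace G] [BorelSpace G]
    (μ : Measure G) [μ.IsHaarMeasure]
    [CommGroup H] [TopologicalSpace H] [IsTopologicalGroup H] [DiscreteTopology H] [Countable H]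
    [MeasurableSpace H] [BorelSpace H]
    (ν : Measure H) [ν.IsHaarMeasure]
    [NonUnitalCStarAlgebra A] [TopologicalSpace.SeparableSpace A]
    (α : CStarAction G A) (β : CStarAction H A) :
    (HasRokhlinProperty α ↔ IsApproximatelyRepresentable (dualAction α μ).toHom) ∧
    (IsApproximatelyRepresentable β.toHom ↔ HasRokhlinProperty (dualAction β ν)) := by
  exact ⟨hasRokhlinProperty_iff_isApproximatelyRepresentable_dualAction α μ,
    isApproximatelyRepresentable_iff_hasRokhlinProperty_dualAction β ν⟩
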